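/- **Setting.** Let $M$ be a smooth $n$-dimensional manifold (Hausdorff, without boundary). A *scaled bounded geometry structure* on $M$ consists of a countable index set $\mathscr A$ and, for each $\alpha\in\mathscr A$, a diffeomorphism $\phi_\alpha\colon U_\alpha\to(-2,2)^n$ from an open set $U_\alpha\subset M$ and a scaling $\rho_\alpha=(\rho_{\alpha,1},\dots,\rho_{\alpha,n})\in(0,1]^n$, such that 1. there is $N\in\mathbb N$ such that any $N+1$ of the sets $U_\alpha$ with pairwise distinct indices have empty intersection; 2. $M=\bigcup_\alpha\phi_\alpha^{-1}((-1,1)^n)$; 3. for each multi-index $\gamma$, the derivatives $\partial^\gamma\tau_{\beta\alpha}^j$ of the components of the transition functions $\tau_{\beta\alpha}=\phi_\beta\circ\phi_\alpha^{-1}\colon\phi_\alpha(U_\alpha\cap U_\beta)\to\phi_\beta(U_\alpha\cap U_\beta)$ are bounded uniformly in $\alpha,\beta,j$; 4. for each multi-index $\gamma$ there is $C_\gamma<\infty$ such that $|\partial^\gamma(\rho_{\alpha,i}\partial_i\tau_{\beta\alpha}^j)|\le C_\gamma\rho_{\beta,j}$ on $\phi_\alpha(U_\alpha\cap U_\beta)$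 for all $\alpha,\beta,i,j$. Fix such a structure. Let $C^\infty_{\rm uni}(M)$ denote the space of smooth functions $f$ on $M$ for which $f\circ\phi_\alpha^{-1}$ is bounded on $(-2,2)^n$ with all derivatives, uniformly in $\alpha$. Let $\mathcal W$ denote the space of smooth vector fields on $M$ whose coefficients in the coordinates $\phi_\alpha$ are bounded on $(-2,2)^n$ with all derivatives, uniformly in $\alpha$. A *weight* is a smooth function $w>0$ on $M$ with $\frac{Ww}{w}\in C^\infty_{\rm uni}(M)$ for all $W\in\mathcal W$. Put $U'_\alpha=\phi_\alpha^{-1}((-\frac32,\frac32)^n)$. A *weight family* is a family of positive numbers $w_\alpha$, $\alpha\in\mathscr A$, such that for some $C$ one has $w_\alpha\le Cw_\beta$ whenever $U'_\alpha\cap U'_\beta\ne\emptyset$. It is *equivalent* to the weight $w$ if $C^{-1}w_\alpha\le w\le Cw_\alpha$ on $U'_\alpha$ for some $C$ independent of $\alpha$. **Function spaces.** Fix $\chi\in C_c^\infty((-2,2)^n)$ with $\chi=1$ on $[-1,1]^n$. Let $\chi_\alpha=\phi_\alpha^*\chi$ and $S_\alpha(x)=(x^1/\rho_{\alpha,1},\dots,x^n/\rho_{\alpha,n})$.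 For a weight $w$, equivalent to a weight family $\{w_\alpha\}$, and $s\in\mathbb R$, the weighted Sobolev space $wH^s_{\mathcal V}(M)$ consists of all distributions $u\in\mathcal D'(M)$ such that $(\phi_\alpha)_*(\chi_\alpha u)\in H^s(\mathbb R^n)$ for all $\alpha$ and $$\|u\|_{wH^s_{\mathcal V}(M)}^2:=\sum_{\alpha}\bigl\|w_\alpha^{-1}(S_\alpha)_*(\phi_\alpha)_*(\chi_\alpha u)\bigr\|_{H^s(\mathbb R^n)}^2<\infty.$$ For $k\in\mathbb N_0$, the space $wH^{(s;k)}_{\mathcal V;\mathcal W}(M)$ consists of all $u\in wH^s_{\mathcal V}(M)$ such that $W_1\cdots W_ju\in wH^s_{\mathcal V}(M)$ for all $j\le k$ and all $W_1,\dots,W_j\in\mathcal W$. Its norm is $$\|u\|_{wH^{(s;k)}_{\mathcal V;\mathcal W}}^2:=\sum_{j=0}^k\ \sum_{W_1,\dots,W_j\in\mathscr W}\|W_1\cdots W_ju\|_{wH^s_{\mathcal V}}^2,$$ where $\mathscr W\subset\mathcal W$ is a finite set which spans $\mathcal W$ over $C^\infty_{\rm uni}(M)$. **Theorem (Rellich compactness).**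 Let $w,w'$ be weights such that $w/w'\to0$ at infinity in $M$ (that is, for every $\epsilon>0$ there is a compact subset of $M$ outside of which $w/w'<\epsilon$). Let $s,s'\in\mathbb R$. * If $s>s'$, then $wH^s_{\mathcal V}(M)\subset w'H^{s'}_{\mathcal V}(M)$, and the inclusion map $wH^s_{\mathcal V}(M)\hookrightarrow w'H^{s'}_{\mathcal V}(M)$ is compact. * More generally, if $k,k'\in\mathbb N_0$, $s\ge s'$ and $k\ge k'$, with at least one of these two inequalities strict, then $wH^{(s;k)}_{\mathcal V;\mathcal W}(M)\subset w'H^{(s';k')}_{\mathcal V;\mathcal W}(M)$, and the inclusion map $wH^{(s;k)}_{\mathcal V;\mathcal W}(M)\hookrightarrow w'H^{(s';k')}_{\mathcal V;\mathcal W}(M)$ is compact. Both parts hold for every choice of $\chi$, of weight families equivalent to $w$ and to $w'$, and of $\mathscr W$. -/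

import Mathlib

open scoped Manifold ContDiff SchwartzMap Distributions LineDeriv Topology
open TopologicalSpace MeasureTheory Set

/-- `ℝⁿ` with the Euclidean norm. -/
abbrev Euc (n : ℕ) : Type := EuclideanSpace ℝ (Fin n)

namespace ScaledBG
noncomputable section

theorem contDiff_mul_of_tsupport_subset {n : ℕ} {Ω : Set (Euc n)} (hΩ : IsOpen Ω)
    {f g : Euc n → ℝ} (hf : ContDiff ℝ ∞ f) (hs : tsupport f ⊆ Ω) (hg : ContDiffOn ℝ ∞ g Ω) :
    ContDiff ℝ ∞ (fun x => f x * g x) := by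
  rw [contDiff_iff_contDiffAt]
  intro x
  by_cases hx : x ∈ tsupport f
  · exact hf.contDiffAt.mul (hg.contDiffAt (hΩ.mem_nhds (hs hx)))
  · refine (contDiffAt_const (c := (0 : ℝ))).congr_of_eventuallyEq ?_
    filter_upwards [(isClosed_tsupport f).isOpen_compl.mem_nhds hx] with y hy
    simp [image_eq_zero_of_notMem_tsupport hy]

theorem exists_contDiff_eqOn {n : ℕ} {Ω : Opens (Euc n)} {g : Euc n → ℝ}
    (hg : ContDiffOn ℝ ∞ g Ω) (K : Compacts (Euc n)) (hK : (K : Set (Euc n)) ⊆ Ω) :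
    ∃ h : Euc n → ℝ, ContDiff ℝ ∞ h ∧ EqOn h g K := by
  obtain ⟨V, hVo, hKV, hVΩ, -⟩ :=
    exists_open_between_and_isCompact_closure K.isCompact Ω.isOpen hK
  obtain ⟨η, hη, -, hηs, hη1⟩ := exists_contMDiff_support_eq_eq_one_iff (𝓡 n) (n := ⊤)
    hVo K.isCompact.isClosed hKV
  refine ⟨fun x => η x * g x, contDiff_mul_of_tsupport_subset Ω.isOpen hη.contDiff ?_ hg, ?_⟩
  · rw [tsupport, hηs]; exact hVΩ
  · intro x hx
    simp [(hη1 x).1 hx]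

/-- Multiplication of test functions on `Ω` by a function which is smooth on `Ω`. -/
def mulTest {n : ℕ} {Ω : Opens (Euc n)} (g : Euc n → ℝ) (hg : ContDiffOn ℝ ∞ g Ω) :
    𝓓(Ω, ℝ) →L[ℝ] 𝓓(Ω, ℝ) :=
  TestFunction.limitCLM ℝ
    (fun ψ => ⟨fun x => ψ x * g x,
      contDiff_mul_of_tsupport_subset Ω.isOpen ψ.contDiff ψ.tsupport_subset hg,
      ψ.hasCompactSupport.mul_right,
      (closure_mono (Function.support_mul_subset_left _ _)).trans ψ.tsupport_subset⟩)
    (fun K hK => TestFunction.ofSupportedInCLM ℝ hK ∘L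
      ContDiffMapSupportedIn.bilinLeftCLM (ContinuousLinearMap.mul ℝ ℝ)
        (exists_contDiff_eqOn hg K hK).choose_spec.1)
    (fun K hK ψ => by
      ext x
      by_cases hx : x ∈ K
      · have := (exists_contDiff_eqOn hg K hK).choose_spec.2 hx
        simp [TestFunction.ofSupportedIn, this]
      · have h0 : ψ x = 0 := ψ.zero_on_compl hx
        simp [TestFunction.ofSupportedIn, h0])

@[simp] theorem mulTest_apply {n : ℕ} {Ω : Opens (Euc n)} {g : Euc n → ℝ}
    (hg : ContDiffOn ℝ ∞ g Ω) (ψ : 𝓓(Ω, ℝ)) (x : Euc n) : mulTest g hg ψ x = ψ x * g x := rfl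

/-- Product `g T` of a distribution `T` on `Ω` with a function `g` smooth on `Ω`. -/
def mulDistribution {n : ℕ} {Ω : Opens (Euc n)} (g : Euc n → ℝ) (hg : ContDiffOn ℝ ∞ g Ω) :
    𝓓'(Ω, ℂ) →ₗ[ℂ] 𝓓'(Ω, ℂ) where
  toFun T := (mulTest g hg).precompCompactConvergenceCLM ℂ T
  map_add' _ _ := rfl
  map_smul' _ _ := rfl

theorem mulDistribution_apply {n : ℕ} {Ω : Opens (Euc n)} {g : Euc n → ℝ}
    (hg : ContDiffOn ℝ ∞ g Ω) (T : 𝓓'(Ω, ℂ)) (ψ : 𝓓(Ω, ℝ)) :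
    mulDistribution g hg T ψ = T (mulTest g hg ψ) := rfl

/-- `ψ ↦ χ ψ`, from Schwartz functions to test functions on `Ω`, for a fixed test function `χ`. -/
def cutSchwartz {n : ℕ} {Ω : Opens (Euc n)} (χ : 𝓓(Ω, ℝ)) : 𝓢(Euc n, ℝ) →L[ℝ] 𝓓(Ω, ℝ) :=
  let K : Compacts (Euc n) := ⟨tsupport χ, χ.hasCompactSupport⟩
  let Φ : 𝓢(Euc n, ℝ) →ₗ[ℝ] 𝓓_{K}(Euc n, ℝ) :=
    { toFun := fun ψ => ⟨fun x => χ x * ψ x, χ.contDiff.mul (ψ.smooth ⊤), fun x hx => by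
        simp [image_eq_zero_of_notMem_tsupport (f := χ) hx]⟩
      map_add' := fun ψ ψ' => by ext x; exact mul_add _ _ _
      map_smul' := fun c ψ => by ext x; exact mul_left_comm _ _ _ }
  TestFunction.ofSupportedInCLM ℝ (K := K) χ.tsupport_subset ∘L
    { toLinearMap := Φ
      cont := by
        refine WithSeminorms.continuous_of_isBounded (schwartz_withSeminorms ℝ (Euc n) ℝ)
          (ContDiffMapSupportedIn.withSeminorms ℝ (Euc n) ℝ ⊤ K) Φ (.of_real fun k => ?_)
        obtain ⟨C, hC⟩ : ∃ C : ℝ, 0 ≤ C ∧ ∀ i ∈ Finset.range (k + 1), ∀ x, ‖iteratedFDeriv ℝ i χ x‖ ≤ C := by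
          have h1 : ∀ i : ℕ, ∃ C : ℝ, ∀ x, ‖iteratedFDeriv ℝ i χ x‖ ≤ C := fun i =>
            (χ.contDiff.continuous_iteratedFDeriv (by exact_mod_cast le_top)).bounded_above_of_compact_support
              (χ.hasCompactSupport.iteratedFDeriv (𝕜 := ℝ) i)
          choose C hC using h1
          exact ⟨∑ i ∈ Finset.range (k + 1), |C i|, by positivity, fun i hi x => (hC i x).trans
            ((le_abs_self _).trans (Finset.single_le_sum (f := fun i => |C i|) (fun _ _ => abs_nonneg _) hi))⟩
        refine ⟨(Finset.range (k + 1)).image fun i => (0, i), 2 ^ k * C, fun ψ => ?_⟩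
        have hb : 0 ≤ C := hC.1
        refine (ContDiffMapSupportedIn.seminorm_top_le_iff ℝ (by
          refine mul_nonneg (by positivity) (apply_nonneg _ _)) k (Φ ψ)).2 fun x _ => ?_
        refine (norm_iteratedFDeriv_mul_le (N := ∞) (f := χ) (g := ψ) χ.contDiff (ψ.smooth ⊤) x
          (by exact_mod_cast le_top)).trans ?_
        have h2 : ∀ i ∈ Finset.range (k + 1), ‖iteratedFDeriv ℝ (k - i) ψ x‖ ≤
            (((Finset.range (k + 1)).image fun i => (0, i)).sup
              (schwartzSeminormFamily ℝ (Euc n) ℝ)) ψ := fun i hi => by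
          refine (SchwartzMap.norm_iteratedFDeriv_le_seminorm ℝ ψ (k - i) x).trans ?_
          exact Seminorm.le_finset_sup_apply (p := schwartzSeminormFamily ℝ (Euc n) ℝ) (i := (0, k - i)) (Finset.mem_image.2 ⟨k - i, by simp, rfl⟩)
        calc _ ≤ ∑ i ∈ Finset.range (k + 1), (k.choose i : ℝ) * C *
              (((Finset.range (k + 1)).image fun i => (0, i)).sup
                (schwartzSeminormFamily ℝ (Euc n) ℝ)) ψ := by
              refine Finset.sum_le_sum fun i hi => ?_
              gcongr
              · exact hC.2 i hi x
              · exact h2 i hi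
          _ = _ := by
              rw [← Finset.sum_mul, ← Finset.sum_mul, ← Nat.cast_sum, Nat.sum_range_choose]
              push_cast; ring }

@[simp] theorem cutSchwartz_apply {n : ℕ} {Ω : Opens (Euc n)} (χ : 𝓓(Ω, ℝ)) (ψ : 𝓢(Euc n, ℝ))
    (x : Euc n) : cutSchwartz χ ψ x = χ x * ψ x := rfl

section Manifold
variable {n : ℕ} {M : Type*} [TopologicalSpace M] [ChartedSpace (Euc n) M]

variable (n M) in
/-- The smooth charts of `M`: the elements of the maximal `C^∞` atlas, i.e. the diffeomorphisms
from open subsets of `M` onto open subsets of `ℝⁿ`. -/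
abbrev Chart : Type _ :=
  {e : OpenPartialHomeomorph M (Euc n) // e ∈ IsManifold.maximalAtlas (𝓡 n) ∞ M}

/-- The image of a chart, an open subset of `ℝⁿ`. -/
def Chart.range (e : Chart n M) : Opens (Euc n) := ⟨e.1.target, e.1.open_target⟩

variable (n M) in
/-- Smooth real vector fields on `M`. -/
abbrev SmoothVF [IsManifold (𝓡 n) ∞ M] : Type _ :=
  Cₛ^∞⟮𝓡 n; Euc n, (TangentSpace (𝓡 n) : M → Type _)⟯

/-- The coordinate representation `e_* W` of the vector field `W` in the chart `e`. -/
def vfCoord [IsManifold (𝓡 n) ∞ M] (e : OpenPartialHomeomorph M (Euc n)) (W : SmoothVF n M)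
    (y : Euc n) : Euc n :=
  mfderiv (𝓡 n) (𝓡 n) e (e.symm y) (W (e.symm y))

theorem vfCoord_contDiffOn [IsManifold (𝓡 n) ∞ M] (e : Chart n M) (W : SmoothVF n M) :
    ContDiffOn ℝ ∞ (vfCoord e.1 W) e.1.target := by
  have h1 := (contMDiffOn_of_mem_maximalAtlas e.2).contMDiffOn_tangentMapWithin (m := ∞) (by simp) e.1.open_source.uniqueMDiffOn
  have h2 : ContMDiffOn (𝓡 n) (𝓡 n).tangent ∞ (fun y => (⟨e.1.symm y, W (e.1.symm y)⟩ : TangentBundle (𝓡 n) M)) e.1.target :=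
    W.contMDiff.comp_contMDiffOn (contMDiffOn_symm_of_mem_maximalAtlas e.2)
  have h3 := h1.comp h2 (fun y hy => e.1.map_target hy)
  have h4 := (contMDiff_snd_tangentBundle_modelSpace (Euc n) (𝓡 n) (n := ∞)).comp_contMDiffOn h3
  refine (h4.contDiffOn).congr fun y hy => ?_
  simp only [vfCoord, Function.comp, tangentMapWithin]
  rw [mfderivWithin_of_isOpen e.1.open_source (e.1.map_target hy)]

theorem vfCoord_apply_contDiffOn [IsManifold (𝓡 n) ∞ M] (e : Chart n M) (W : SmoothVF n M)
    (i : Fin n) : ContDiffOn ℝ ∞ (fun y => vfCoord e.1 W y i) e.range :=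
  contDiffOn_euclidean.1 (vfCoord_contDiffOn e W) i

/-- The derivative `W g` of a function `g` along a smooth vector field `W`. -/
def vfApply [IsManifold (𝓡 n) ∞ M] (W : SmoothVF n M) (g : M → ℝ) (p : M) : ℝ :=
  mfderiv (𝓡 n) 𝓘(ℝ, ℝ) g p (W p)

/-- The derivative `W g` of a smooth function, as a smooth function. -/
def vfDeriv [IsManifold (𝓡 n) ∞ M] (W : SmoothVF n M) (g : C^∞⟮𝓡 n, M; ℝ⟯) : C^∞⟮𝓡 n, M; ℝ⟯ :=
  ⟨vfApply W g, by
    have h1 := g.contMDiff.contMDiff_tangentMap (m := ∞) (by simp)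
    have h2 : ContMDiff (𝓡 n) (𝓡 n).tangent ∞ (fun p => (⟨p, W p⟩ : TangentBundle (𝓡 n) M)) :=
      W.contMDiff
    exact (contMDiff_snd_tangentBundle_modelSpace ℝ 𝓘(ℝ, ℝ) (n := ∞)).comp (h1.comp h2)⟩

/-- `ψ ↦ ∑ᵢ ∂ᵢ(Wⁱ ψ)`, the coordinate form of the Lie derivative of densities along `W`. -/
def divTest [IsManifold (𝓡 n) ∞ M] (W : SmoothVF n M) (e : Chart n M) (ψ : 𝓓(e.range, ℝ)) :
    𝓓(e.range, ℝ) :=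
  ∑ i, ∂_{EuclideanSpace.single i (1 : ℝ)} (mulTest (fun y => vfCoord e.1 W y i)
    (vfCoord_apply_contDiffOn e W i) ψ)

theorem fderiv_vfCoord [IsManifold (𝓡 n) ∞ M] (W : SmoothVF n M) (e : Chart n M)
    (g : C^∞⟮𝓡 n, M; ℝ⟯) {x : Euc n} (hx : x ∈ e.1.target) :
    fderiv ℝ (fun y => g (e.1.symm y)) x (vfCoord e.1 W x) = vfDeriv W g (e.1.symm x) := by
  set p := e.1.symm x with hp
  have hps : p ∈ e.1.source := e.1.map_target hx
  have hG : ContMDiffOn (𝓡 n) 𝓘(ℝ, ℝ) ∞ (fun y => g (e.1.symm y)) e.1.target :=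
    g.contMDiff.comp_contMDiffOn (contMDiffOn_symm_of_mem_maximalAtlas e.2)
  have hG' : MDifferentiableAt (𝓡 n) 𝓘(ℝ, ℝ) (fun y => g (e.1.symm y)) (e.1 p) := by
    rw [hp, e.1.right_inv hx]
    exact (hG.contMDiffAt (e.1.open_target.mem_nhds hx)).mdifferentiableAt (by simp)
  have he' : MDifferentiableAt (𝓡 n) (𝓡 n) e.1 p :=
    ((contMDiffOn_of_mem_maximalAtlas e.2).contMDiffAt (e.1.open_source.mem_nhds hps)).mdifferentiableAt
      (by simp)
  have hEq : (g : M → ℝ) =ᶠ[𝓝 p] (fun y => g (e.1.symm y)) ∘ e.1 := by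
    filter_upwards [e.1.open_source.mem_nhds hps] with q hq
    simp [e.1.left_inv hq]
  change _ = mfderiv (𝓡 n) 𝓘(ℝ, ℝ) g p (W p)
  rw [hEq.mfderiv_eq, mfderiv_comp p hG' he', hp, e.1.right_inv hx, ← hp, mfderiv_eq_fderiv]
  rfl

theorem integral_divTest [IsManifold (𝓡 n) ∞ M] (W : SmoothVF n M) (e : Chart n M)
    (g : C^∞⟮𝓡 n, M; ℝ⟯) (ψ : 𝓓(e.range, ℝ)) :
    ∫ x, g (e.1.symm x) * divTest W e ψ x = - ∫ x, vfDeriv W g (e.1.symm x) * ψ x := by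
  set G : Euc n → ℝ := fun y => g (e.1.symm y) with hGdef
  have hG : ContDiffOn ℝ ∞ G e.1.target := by
    have : ContMDiffOn (𝓡 n) 𝓘(ℝ, ℝ) ∞ G e.1.target :=
      g.contMDiff.comp_contMDiffOn (contMDiffOn_symm_of_mem_maximalAtlas e.2)
    exact this.contDiffOn
  have hint : ∀ (f : Euc n → ℝ) (φ : 𝓓(e.range, ℝ)), ContDiffOn ℝ ∞ f e.1.target →
      Integrable (fun x => f x * φ x) := fun f φ hf => by
    have h := contDiff_mul_of_tsupport_subset e.1.open_target φ.contDiff φ.tsupport_subset hf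
    have := h.continuous.integrable_of_hasCompactSupport (μ := volume) φ.hasCompactSupport.mul_right
    simpa only [mul_comm] using this
  have hdiff : ∀ φ : 𝓓(e.range, ℝ), ∀ x ∈ tsupport φ, DifferentiableAt ℝ G x := fun φ x hx =>
    (hG.contDiffAt (e.1.open_target.mem_nhds (φ.tsupport_subset hx))).differentiableAt (by simp)
  have hfd : ∀ v : Euc n, ContDiffOn ℝ ∞ (fun x => fderiv ℝ G x v) e.1.target := fun v =>
    (hG.fderiv_of_isOpen e.1.open_target (m := ∞) (by simp)).clm_apply contDiffOn_const
  set φ : Fin n → 𝓓(e.range, ℝ) := fun i => mulTest (fun y => vfCoord e.1 W y i)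
    (vfCoord_apply_contDiffOn e W i) ψ with hφ
  set b : Fin n → Euc n := fun i => EuclideanSpace.single i (1 : ℝ) with hb
  have hline : ∀ i x, (∂_{b i} (φ i)) x = fderiv ℝ (φ i) x (b i) := fun i x => by
    rw [TestFunction.lineDerivOp_eq_lineDerivCLM ℝ, TestFunction.lineDerivCLM_eq_fderivCLM]
    simp
  have hsum : ∀ x, divTest W e ψ x = ∑ i, fderiv ℝ (φ i) x (b i) := fun x => by
    rw [divTest, FunLike.coe_sum, Finset.sum_apply]
    exact Finset.sum_congr rfl fun i _ => hline i x
  have hi1 : ∀ i, Integrable (fun x => G x * fderiv ℝ (φ i) x (b i)) := fun i => by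
    have := hint G (∂_{b i} (φ i)) hG
    simpa only [hline] using this
  have hi2 : ∀ i, Integrable (fun x => fderiv ℝ G x (b i) * φ i x) := fun i => hint _ _ (hfd _)
  calc ∫ x, G x * divTest W e ψ x = ∑ i, ∫ x, G x * fderiv ℝ (φ i) x (b i) := by
        rw [← integral_finsetSum _ fun i _ => hi1 i]
        simp only [hsum, Finset.mul_sum]
    _ = ∑ i, - ∫ x, fderiv ℝ G x (b i) * φ i x :=
        Finset.sum_congr rfl fun i _ => integral_mul_fderiv_eq_neg_fderiv_mul_of_integrable
          (hi2 i) (hi1 i) (hint _ _ hG) (hdiff _)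
          (fun x _ => ((φ i).contDiff.differentiable (by simp)).differentiableAt)
    _ = - ∫ x, ∑ i, fderiv ℝ G x (b i) * φ i x := by
        rw [Finset.sum_neg_distrib, integral_finsetSum _ fun i _ => hi2 i]
    _ = _ := by
        congr 1
        refine integral_congr_ae (.of_forall fun x => ?_)
        by_cases hx : x ∈ e.1.target
        · have hv : vfCoord e.1 W x = ∑ i, vfCoord e.1 W x i • b i := by
            simpa using ((EuclideanSpace.basisFun (Fin n) ℝ).sum_repr (vfCoord e.1 W x)).symm
          change ∑ i, fderiv ℝ G x (b i) * (ψ x * vfCoord e.1 W x i) =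
            vfDeriv W g (e.1.symm x) * ψ x
          rw [← fderiv_vfCoord W e g hx, ← hGdef]
          conv_rhs => rw [hv, map_sum, Finset.sum_mul]
          refine Finset.sum_congr rfl fun i _ => ?_
          rw [map_smul, smul_eq_mul]; ring
        · have h0 : ψ x = 0 := image_eq_zero_of_notMem_tsupport fun h => hx (ψ.tsupport_subset h)
          change ∑ i, fderiv ℝ G x (b i) * (ψ x * vfCoord e.1 W x i) =
            vfDeriv W g (e.1.symm x) * ψ x
          simp [h0]

/-- The compactly supported smooth densities `ψ |dx|`, in the chart `e`, and `ψ' |dy|`, in the chart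
`e'`, are the same density on `M`: they assign the same integral to every smooth function on `M`.
Equivalently, both are supported over the common domain of the two charts and
`ψ = (ψ' ∘ τ) |det Dτ|` there, where `τ = e' ∘ e⁻¹`. -/
def SameDensity (e : Chart n M) (ψ : 𝓓(e.range, ℝ)) (e' : Chart n M) (ψ' : 𝓓(e'.range, ℝ)) :
    Prop :=
  ∀ g : C^∞⟮𝓡 n, M; ℝ⟯, ∫ x, g (e.1.symm x) * ψ x = ∫ y, g (e'.1.symm y) * ψ' y

variable (n M) in
/-- A distribution on `M` is given by its coordinate representatives `u_e`, which are complex-valued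
distributions on the ranges of all smooth charts `e`; they have to transform like functions under
changes of coordinates, i.e. `⟨u_e, ψ⟩` depends only on the density on `M` given by `ψ |dx|` in the
chart `e`. -/
def distSubmodule : Submodule ℂ ((e : Chart n M) → 𝓓'(e.range, ℂ)) where
  carrier := {u | ∀ (e : Chart n M) (ψ : 𝓓(e.range, ℝ)) (e' : Chart n M) (ψ' : 𝓓(e'.range, ℝ)),
    SameDensity e ψ e' ψ' → u e ψ = u e' ψ'}
  add_mem' hu hv e ψ e' ψ' h := congrArg₂ (· + ·) (hu e ψ e' ψ' h) (hv e ψ e' ψ' h)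
  zero_mem' _ _ _ _ _ := rfl
  smul_mem' c _ hu e ψ e' ψ' h := congrArg (c • ·) (hu e ψ e' ψ' h)

variable (n M) in
/-- The space `𝓓'(M)` of (complex-valued) distributions on `M`. -/
def Dist : Type _ := distSubmodule n M

instance : AddCommGroup (Dist n M) := inferInstanceAs (AddCommGroup (distSubmodule n M))

instance : Module ℂ (Dist n M) := inferInstanceAs (Module ℂ (distSubmodule n M))

variable (n M) in
/-- The family of coordinate representatives of a distribution. -/
def Dist.coord : Dist n M →ₗ[ℂ] ((e : Chart n M) → 𝓓'(e.range, ℂ)) := (distSubmodule n M).subtype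

/-- The distributional derivative `∂_v` as a complex linear map. -/
def lineDerivDistribution {Ω : Opens (Euc n)} (v : Euc n) : 𝓓'(Ω, ℂ) →ₗ[ℂ] 𝓓'(Ω, ℂ) where
  toFun T := ∂_{v} T
  map_add' T T' := map_add (Distribution.lineDerivCLM v) T T'
  map_smul' c T := by
    ext ψ
    change (∂_{v} (c • T)) ψ = c * (∂_{v} T) ψ
    rw [Distribution.lineDerivOp_apply_apply, Distribution.lineDerivOp_apply_apply]
    rfl

/-- The first order operator `∑ᵢ Wⁱ ∂ᵢ` on distributions in a chart. -/
def vfActChart [IsManifold (𝓡 n) ∞ M] (W : SmoothVF n M) (e : Chart n M) :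
    𝓓'(e.range, ℂ) →ₗ[ℂ] 𝓓'(e.range, ℂ) :=
  ∑ i, mulDistribution (fun y => vfCoord e.1 W y i)
    (vfCoord_apply_contDiffOn e W i) ∘ₗ
      lineDerivDistribution (EuclideanSpace.single i (1 : ℝ))

theorem vfActChart_apply [IsManifold (𝓡 n) ∞ M] (W : SmoothVF n M) (e : Chart n M)
    (T : 𝓓'(e.range, ℂ)) (ψ : 𝓓(e.range, ℝ)) : vfActChart W e T ψ = - T (divTest W e ψ) := by
  rw [vfActChart, LinearMap.sum_apply, FunLike.coe_sum, Finset.sum_apply, divTest, map_sum,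
    ← Finset.sum_neg_distrib]
  refine Finset.sum_congr rfl fun i _ => ?_
  rw [LinearMap.comp_apply, mulDistribution_apply]
  change (∂_{EuclideanSpace.single i (1 : ℝ)} T : 𝓓'(e.range, ℂ)) (mulTest _ _ ψ) = _
  rw [Distribution.lineDerivOp_apply_apply, map_neg]

/-- The derivative `W u` of a distribution `u` on `M` along a smooth vector field `W`; in every chart
it is `∑ᵢ Wⁱ ∂ᵢ u_e`. -/
def vfAct [IsManifold (𝓡 n) ∞ M] (W : SmoothVF n M) : Dist n M →ₗ[ℂ] Dist n M where
  toFun u := ⟨fun e => vfActChart W e (u.1 e), fun e ψ e' ψ' h => by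
    rw [vfActChart_apply, vfActChart_apply, u.2 e _ e' _ fun g => ?_]
    rw [integral_divTest, integral_divTest, h (vfDeriv W g)]⟩
  map_add' u v := Subtype.ext (funext fun e => map_add (vfActChart W e) (u.1 e) (v.1 e))
  map_smul' c u := Subtype.ext (funext fun e => map_smul (vfActChart W e) c (u.1 e))

end Manifold

section Euclidean
variable {n : ℕ}

/-- The product `χ T` of a distribution `T` on `Ω` with a real test function `χ` on `Ω`, extended by
zero to a tempered distribution on `ℝⁿ`: `ψ ↦ ⟨T, χ Re ψ⟩ + i ⟨T, χ Im ψ⟩`. -/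
def cutExtend {Ω : Opens (Euc n)} (χ : 𝓓(Ω, ℝ)) : 𝓓'(Ω, ℂ) →ₗ[ℂ] 𝓢'(Euc n, ℂ) where
  toFun T := ContinuousLinearMap.toPointwiseConvergenceCLM ℂ (RingHom.id ℂ) 𝓢(Euc n, ℂ) ℂ
    { toFun := fun ψ => T (cutSchwartz χ (SchwartzMap.postcompCLM Complex.reCLM ψ)) +
        Complex.I * T (cutSchwartz χ (SchwartzMap.postcompCLM Complex.imCLM ψ))
      map_add' := fun ψ ψ' => by simp only [map_add]; ring
      map_smul' := fun c ψ => by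
        have hre : SchwartzMap.postcompCLM Complex.reCLM (c • ψ) =
            c.re • SchwartzMap.postcompCLM Complex.reCLM ψ -
              c.im • SchwartzMap.postcompCLM Complex.imCLM ψ := by ext x; simp
        have him : SchwartzMap.postcompCLM Complex.imCLM (c • ψ) =
            c.re • SchwartzMap.postcompCLM Complex.imCLM ψ +
              c.im • SchwartzMap.postcompCLM Complex.reCLM ψ := by ext x; simp
        rw [hre, him]
        simp only [map_add, map_sub, map_smul, Complex.real_smul, RingHom.id_apply, smul_eq_mul]
        conv_rhs => rw [← Complex.re_add_im c]
        linear_combination (-(c.im : ℂ) * T (cutSchwartz χ (SchwartzMap.postcompCLM Complex.imCLM ψ))) * Complex.I_sq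
      cont := by
        have h : ∀ L : ℂ →L[ℝ] ℝ, Continuous fun ψ : 𝓢(Euc n, ℂ) =>
            T (cutSchwartz χ (SchwartzMap.postcompCLM L ψ)) := fun L =>
          T.cont.comp ((cutSchwartz χ).cont.comp (SchwartzMap.postcompCLM L).cont)
        exact (h _).add (continuous_const.mul (h _)) }
  map_add' T T' := by
    ext ψ
    change (T _ + T' _) + Complex.I * (T _ + T' _) = (T _ + _) + (T' _ + _)
    ring
  map_smul' c T := by
    ext ψ
    change c * T _ + Complex.I * (c * T _) = c * (T _ + _)
    ring

/-- The scaling map `S x = (x₁ / ρ₁, …, xₙ / ρₙ)`. -/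
def scaleMap (ρ : Fin n → ℝ) (hρ : ∀ i, 0 < ρ i) : Euc n ≃L[ℝ] Euc n :=
  LinearEquiv.toContinuousLinearEquiv
    { toFun := fun x => WithLp.toLp 2 fun i => x i / ρ i
      invFun := fun x => WithLp.toLp 2 fun i => x i * ρ i
      map_add' := fun x y => by ext i; simp [add_div]
      map_smul' := fun c x => by ext i; simp [mul_div_assoc]
      left_inv := fun x => by ext i; simp [(hρ i).ne']
      right_inv := fun x => by ext i; simp [(hρ i).ne'] }

/-- Pushforward `U ↦ S_* U = U ∘ S⁻¹` of distributions (as generalized functions) along the scaling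
map: `⟨S_* U, ψ⟩ = |det S| ⟨U, ψ ∘ S⟩` with `|det S| = (ρ₁ ⋯ ρₙ)⁻¹`. -/
def scalePush (ρ : Fin n → ℝ) (hρ : ∀ i, 0 < ρ i) : 𝓢'(Euc n, ℂ) →ₗ[ℂ] 𝓢'(Euc n, ℂ) :=
  ((∏ i, ρ i : ℝ) : ℂ)⁻¹ • (PointwiseConvergenceCLM.precomp ℂ
    (SchwartzMap.compCLMOfContinuousLinearEquiv ℂ (scaleMap ρ hρ))).toLinearMap

open Classical in
/-- The norm `‖(1 + |ξ|²)^{s/2} û‖_{L²}` on `H^s(ℝⁿ)`: by Plancherel it is the `L²` norm of the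
Bessel potential of `T`. (The value outside of `H^s(ℝⁿ)` is not used.) -/
def sobolevNorm (s : ℝ) (T : 𝓢'(Euc n, ℂ)) : ℝ :=
  if h : TemperedDistribution.MemSobolev s 2 T then ‖h.choose‖ else 0

theorem sobolevNorm_eq {s : ℝ} {T : 𝓢'(Euc n, ℂ)} {f : Lp ℂ 2 (volume : Measure (Euc n))}
    (h : TemperedDistribution.besselPotential (Euc n) ℂ s T = f) : sobolevNorm s T = ‖f‖ := by
  have hT : TemperedDistribution.MemSobolev s 2 T := ⟨f, h⟩
  rw [sobolevNorm, dif_pos hT]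
  have hinj := LinearMap.ker_eq_bot.1
    (Lp.ker_toTemperedDistributionCLM_eq_bot (F := ℂ) (μ := (volume : Measure (Euc n))) (p := 2))
  rw [show hT.choose = f from hinj (hT.choose_spec.symm.trans h)]

theorem sobolevNorm_nonneg (s : ℝ) (T : 𝓢'(Euc n, ℂ)) : 0 ≤ sobolevNorm s T := by
  rw [sobolevNorm]; split_ifs <;> simp

theorem sobolevNorm_add_le {s : ℝ} {T T' : 𝓢'(Euc n, ℂ)}
    (h : TemperedDistribution.MemSobolev s 2 T) (h' : TemperedDistribution.MemSobolev s 2 T') :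
    sobolevNorm s (T + T') ≤ sobolevNorm s T + sobolevNorm s T' := by
  obtain ⟨f, hf⟩ := h
  obtain ⟨f', hf'⟩ := h'
  have : TemperedDistribution.besselPotential (Euc n) ℂ s (T + T') = (f + f' : Lp ℂ 2 _) := by
    rw [← Lp.toTemperedDistributionCLM_apply, map_add, map_add, hf, hf',
      Lp.toTemperedDistributionCLM_apply, Lp.toTemperedDistributionCLM_apply]
  rw [sobolevNorm_eq hf, sobolevNorm_eq hf', sobolevNorm_eq this]
  exact norm_add_le _ _

theorem sobolevNorm_smul {s : ℝ} (c : ℂ) {T : 𝓢'(Euc n, ℂ)}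
    (h : TemperedDistribution.MemSobolev s 2 T) :
    sobolevNorm s (c • T) = ‖c‖ * sobolevNorm s T := by
  obtain ⟨f, hf⟩ := h
  have : TemperedDistribution.besselPotential (Euc n) ℂ s (c • T) = (c • f : Lp ℂ 2 _) := by
    rw [← Lp.toTemperedDistributionCLM_apply]; simp [hf]
  rw [sobolevNorm_eq hf, sobolevNorm_eq this, norm_smul]

/-- Minkowski's inequality in `ℓ²`. -/
theorem l2_add {ι : Type*} {a b c : ι → ℝ} (ha : Summable fun i => a i ^ 2)
    (hb : Summable fun i => b i ^ 2) (ha0 : ∀ i, 0 ≤ a i) (hb0 : ∀ i, 0 ≤ b i)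
    (hc0 : ∀ i, 0 ≤ c i) (hc : ∀ i, c i ≤ a i + b i) :
    (Summable fun i => c i ^ 2) ∧
      √(∑' i, c i ^ 2) ≤ √(∑' i, a i ^ 2) + √(∑' i, b i ^ 2) := by
  have h := Real.Lp_add_le_tsum_of_nonneg (p := 2) (by norm_num) ha0 hb0
    (by simpa using ha) (by simpa using hb)
  simp only [Real.rpow_ofNat] at h
  have hle : ∀ i, c i ^ 2 ≤ (a i + b i) ^ 2 := fun i => pow_le_pow_left₀ (hc0 i) (hc i) 2
  have hs : Summable fun i => c i ^ 2 :=
    Summable.of_nonneg_of_le (fun i => by positivity) hle h.1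
  refine ⟨hs, (Real.sqrt_le_sqrt (hs.tsum_le_tsum hle h.1)).trans ?_⟩
  simpa [Real.sqrt_eq_rpow] using h.2

end Euclidean

/-- The open cube `(-r, r)ⁿ`. -/
def cube (n : ℕ) (r : ℝ) : Opens (Euc n) :=
  ⟨{x | ∀ i, |x i| < r}, by
    simp only [ofPred_forall]
    exact isOpen_iInter_of_finite fun i => isOpen_lt (by fun_prop) continuous_const⟩

/-- A *bounded geometry structure* on the smooth `n`-manifold `M`: a countable family of smooth
charts (unit cells) onto `(-2,2)ⁿ` with uniformly finite overlaps, covering `M` already by the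
preimages of `(-1,1)ⁿ`, and with transition functions uniformly bounded in `C^∞`. -/
structure BGStructure (n : ℕ) (M : Type*) [TopologicalSpace M] [ChartedSpace (Euc n) M]
    (A : Type*) where
  /-- the index set is countable -/
  countable : Countable A
  /-- the diffeomorphisms `φ_α : U_α → (-2,2)ⁿ` -/
  chart : A → Chart n M
  chart_range : ∀ α, (chart α).range = cube n 2
  finite_overlap : ∃ N : ℕ, ∀ s : Finset A, s.card = N + 1 → ⋂ α ∈ s, (chart α).1.source = ∅
  cover : ∀ p : M, ∃ α, p ∈ (chart α).1.source ∧ (chart α).1 p ∈ cube n 1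
  transition_bdd : ∀ k : ℕ, ∃ C : ℝ, ∀ (α β : A) (j : Fin n),
    ∀ x ∈ (chart α).1.target ∩ (chart α).1.symm ⁻¹' (chart β).1.source,
      ‖iteratedFDeriv ℝ k (fun y => (chart β).1 ((chart α).1.symm y) j) x‖ ≤ C

/-- A *scaled bounded geometry structure*: a bounded geometry structure together with a scaling
`ρ_α ∈ (0,1]ⁿ` such that `|∂^γ(ρ_{α,i} ∂_i τ_{βα}^j)| ≤ C_γ ρ_{β,j}` on the domain of the transition
function `τ_{βα} = φ_β ∘ φ_α⁻¹`. -/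
structure ScaledBGStructure (n : ℕ) (M : Type*) [TopologicalSpace M] [ChartedSpace (Euc n) M]
    (A : Type*) extends BGStructure n M A where
  /-- the scaling `ρ_{α,i}` -/
  ρ : A → Fin n → ℝ
  ρ_pos : ∀ α i, 0 < ρ α i
  ρ_le_one : ∀ α i, ρ α i ≤ 1
  scaling_bdd : ∀ k : ℕ, ∃ C : ℝ, ∀ (α β : A) (i j : Fin n),
    ∀ x ∈ (chart α).1.target ∩ (chart α).1.symm ⁻¹' (chart β).1.source,
      ‖iteratedFDeriv ℝ k (fun y => ρ α i *
        fderiv ℝ (fun z => (chart β).1 ((chart α).1.symm z) j) y (EuclideanSpace.single i 1)) x‖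
        ≤ C * ρ β j

section BG
variable {n : ℕ} {M : Type*} [TopologicalSpace M] [ChartedSpace (Euc n) M] {A : Type*}

namespace BGStructure
variable (B : BGStructure n M A)

/-- `f ∈ C^∞_uni(M)`: `f` is smooth and its coordinate representatives in the unit cells are
bounded with all derivatives, uniformly in the unit cell. -/
def IsUniformFunction (f : M → ℝ) : Prop :=
  ContMDiff (𝓡 n) 𝓘(ℝ, ℝ) ∞ f ∧ ∀ k : ℕ, ∃ C : ℝ, ∀ α, ∀ x ∈ cube n 2,
    ‖iteratedFDeriv ℝ k (fun y => f ((B.chart α).1.symm y)) x‖ ≤ C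

/-- The coefficient Lie algebra `𝒲 = C^∞_uni(M; TM)`. -/
def coefficientVF [IsManifold (𝓡 n) ∞ M] : Set (SmoothVF n M) :=
  {W | ∀ k : ℕ, ∃ C : ℝ, ∀ α i, ∀ x ∈ cube n 2,
    ‖iteratedFDeriv ℝ k (fun y => vfCoord (B.chart α).1 W y i) x‖ ≤ C}

/-- A finite subset of `𝒲` which spans `𝒲` over `C^∞_uni(M)`. -/
def IsSpanning [IsManifold (𝓡 n) ∞ M] (F : Finset B.coefficientVF) : Prop :=
  ∀ Z ∈ B.coefficientVF, ∃ f : B.coefficientVF → M → ℝ,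
    (∀ W ∈ F, B.IsUniformFunction (f W)) ∧ ∀ p, Z p = ∑ W ∈ F, f W p • W.1 p

/-- A *weight*: a smooth function `w > 0` with `(W w) / w ∈ C^∞_uni(M)` for all `W ∈ 𝒲`. -/
def IsWeight [IsManifold (𝓡 n) ∞ M] (w : M → ℝ) : Prop :=
  ContMDiff (𝓡 n) 𝓘(ℝ, ℝ) ∞ w ∧ (∀ p, 0 < w p) ∧
    ∀ W ∈ B.coefficientVF,
      B.IsUniformFunction fun p => vfApply W w p / w p

/-- The smaller cell `U'_α = φ_α⁻¹((-3/2,3/2)ⁿ)`. -/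
def innerCell (α : A) : Set M :=
  {p | p ∈ (B.chart α).1.source ∧ (B.chart α).1 p ∈ cube n (3 / 2)}

/-- A *weight family*: positive numbers `w_α`, uniformly comparable whenever the cells `U'_α`
intersect. -/
structure WeightFamily where
  /-- the numbers `w_α` -/
  val : A → ℝ
  pos : ∀ α, 0 < val α
  comparable : ∃ C : ℝ, ∀ α β, (B.innerCell α ∩ B.innerCell β).Nonempty → val α ≤ C * val β

/-- The weight `w` is equivalent to the weight family `{w_α}`: `C⁻¹ w_α ≤ w ≤ C w_α` on `U'_α`
with a constant `C` independent of `α`. -/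
def WeightFamily.Equivalent {B : BGStructure n M A} (v : B.WeightFamily) (w : M → ℝ) : Prop :=
  ∃ C : ℝ, ∀ α, ∀ p ∈ B.innerCell α, w p ≤ C * v.val α ∧ v.val α ≤ C * w p

end BGStructure

namespace ScaledBGStructure
variable (B : ScaledBGStructure n M A)

/-- The cutoff `χ ∈ C_c^∞((-2,2)ⁿ)` as a test function on the range of `φ_α`. -/
def cutoff (χ : 𝓓(cube n 2, ℝ)) (α : A) : 𝓓((B.chart α).range, ℝ) :=
  ⟨χ, χ.contDiff, χ.hasCompactSupport, by rw [B.chart_range]; exact χ.tsupport_subset⟩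

/-- `u ↦ (S_α)_* (φ_α)_* (χ_α u)`, a compactly supported distribution on `ℝⁿ`. -/
def localize (χ : 𝓓(cube n 2, ℝ)) (α : A) : Dist n M →ₗ[ℂ] 𝓢'(Euc n, ℂ) :=
  scalePush (B.ρ α) (B.ρ_pos α) ∘ₗ cutExtend (B.cutoff χ α) ∘ₗ
    LinearMap.proj (B.chart α) ∘ₗ Dist.coord n M

/-- `‖w_α⁻¹ (S_α)_* (φ_α)_* (χ_α u)‖_{H^s(ℝⁿ)}` -/
def localNorm (χ : 𝓓(cube n 2, ℝ)) (v : B.WeightFamily) (s : ℝ) (u : Dist n M) (α : A) : ℝ :=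
  (v.val α)⁻¹ * sobolevNorm s (B.localize χ α u)

variable {B} in
theorem localNorm_nonneg (χ : 𝓓(cube n 2, ℝ)) (v : B.WeightFamily) (s : ℝ) (u : Dist n M) (α : A) :
    0 ≤ B.localNorm χ v s u α :=
  mul_nonneg (inv_nonneg.2 (v.pos α).le) (sobolevNorm_nonneg _ _)

variable {B} in
theorem localNorm_add_le {χ : 𝓓(cube n 2, ℝ)} {v : B.WeightFamily} {s : ℝ} {u u' : Dist n M} {α : A}
    (h : TemperedDistribution.MemSobolev s 2 (B.localize χ α u))
    (h' : TemperedDistribution.MemSobolev s 2 (B.localize χ α u')) :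
    B.localNorm χ v s (u + u') α ≤ B.localNorm χ v s u α + B.localNorm χ v s u' α := by
  rw [localNorm, localNorm, localNorm, ← mul_add, map_add]
  exact mul_le_mul_of_nonneg_left (sobolevNorm_add_le h h') (inv_nonneg.2 (v.pos α).le)

variable {B} in
theorem localNorm_smul {χ : 𝓓(cube n 2, ℝ)} {v : B.WeightFamily} {s : ℝ} (c : ℂ) {u : Dist n M}
    {α : A} (h : TemperedDistribution.MemSobolev s 2 (B.localize χ α u)) :
    B.localNorm χ v s (c • u) α = ‖c‖ * B.localNorm χ v s u α := by
  rw [localNorm, localNorm, map_smul, sobolevNorm_smul c h]; ring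

/-- The weighted `𝒱`-Sobolev space `w H^s_𝒱(M)`, for a weight `w` equivalent to the weight family
`v = {w_α}`: distributions `u` on `M` such that the localizations of `u` to all unit cells lie in
`H^s(ℝⁿ)` and `∑_α ‖w_α⁻¹ (S_α)_* (φ_α)_* (χ_α u)‖²_{H^s(ℝⁿ)} < ∞`. -/
def sobolevSpace (χ : 𝓓(cube n 2, ℝ)) (v : B.WeightFamily) (s : ℝ) : Submodule ℂ (Dist n M) where
  carrier := {u | (∀ α, TemperedDistribution.MemSobolev s 2 (B.localize χ α u)) ∧
    Summable fun α => B.localNorm χ v s u α ^ 2}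
  add_mem' {u u'} h h' := ⟨fun α => by rw [map_add]; exact (h.1 α).add (h'.1 α),
    (l2_add h.2 h'.2 (localNorm_nonneg χ v s u) (localNorm_nonneg χ v s u')
      (localNorm_nonneg χ v s (u + u')) fun α => localNorm_add_le (h.1 α) (h'.1 α)).1⟩
  zero_mem' := by
    have h0 : ∀ α, B.localNorm χ v s 0 α = 0 := fun α => by
      have h := localNorm_smul (v := v) (u := 0) (0 : ℂ) (α := α) (χ := χ) (s := s) (B := B)
        (by rw [map_zero]; exact TemperedDistribution.memSobolev_fun_zero _ _ s 2)
      simpa using h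
    exact ⟨fun α => by rw [map_zero]; exact TemperedDistribution.memSobolev_fun_zero _ _ s 2,
      by simp [h0]⟩
  smul_mem' c _ h := ⟨fun α => by rw [map_smul]; exact (h.1 α).smul c, by
    simp only [localNorm_smul c (h.1 _), mul_pow]
    exact h.2.mul_left _⟩

/-- The norm `(∑_α ‖w_α⁻¹ (S_α)_* (φ_α)_* (χ_α u)‖²_{H^s(ℝⁿ)})^{1/2}` on `w H^s_𝒱(M)`. -/
def sobolevSeminorm (χ : 𝓓(cube n 2, ℝ)) (v : B.WeightFamily) (s : ℝ) :
    Seminorm ℂ (B.sobolevSpace χ v s) :=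
  Seminorm.of (fun u => √(∑' α, B.localNorm χ v s u.1 α ^ 2))
    (fun u u' => (l2_add u.2.2 u'.2.2 (localNorm_nonneg χ v s u.1) (localNorm_nonneg χ v s u'.1)
      (localNorm_nonneg χ v s (u.1 + u'.1)) fun α => localNorm_add_le (u.2.1 α) (u'.2.1 α)).2)
    (fun c u => by
      have h : ∀ α, B.localNorm χ v s (c • u.1) α ^ 2 = ‖c‖ ^ 2 * B.localNorm χ v s u.1 α ^ 2 :=
        fun α => by rw [localNorm_smul c (u.2.1 α), mul_pow]
      change √(∑' α, B.localNorm χ v s (c • u.1) α ^ 2) = _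
      simp only [h, tsum_mul_left]
      rw [Real.sqrt_mul (by positivity), Real.sqrt_sq (norm_nonneg c)])

variable [IsManifold (𝓡 n) ∞ M]

/-- The operator `u ↦ W₁ ⋯ W_j u` on distributions, for `l = [W₁, …, W_j]`. -/
def word (l : List B.coefficientVF) : Module.End ℂ (Dist n M) :=
  (l.map fun W => vfAct W.1).prod

/-- The space `w H^{(s;k)}_{𝒱;𝒲}(M)` of all `u` with `W₁ ⋯ W_j u ∈ w H^s_𝒱(M)` for all `j ≤ k`
(including `j = 0`) and `W₁, …, W_j ∈ 𝒲`. -/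
def mixedSpace (χ : 𝓓(cube n 2, ℝ)) (v : B.WeightFamily) (s : ℝ) (k : ℕ) :
    Submodule ℂ (Dist n M) where
  carrier := {u | ∀ l : List B.coefficientVF, l.length ≤ k → B.word l u ∈ B.sobolevSpace χ v s}
  add_mem' h h' l hl := by rw [map_add]; exact add_mem (h l hl) (h' l hl)
  zero_mem' l _ := by rw [map_zero]; exact zero_mem _
  smul_mem' c _ h l hl := by rw [map_smul]; exact Submodule.smul_mem _ c (h l hl)

/-- `u ↦ W₁ ⋯ W_j u`, from `w H^{(s;k)}` to `w H^s`, for `j ≤ k`. -/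
def wordMap (χ : 𝓓(cube n 2, ℝ)) (v : B.WeightFamily) (s : ℝ) (k : ℕ)
    (l : List B.coefficientVF) (hl : l.length ≤ k) :
    B.mixedSpace χ v s k →ₗ[ℂ] B.sobolevSpace χ v s :=
  (B.word l).restrict fun u hu => hu l hl

/-- The norm `(∑_{j ≤ k} ∑_{W₁, …, W_j ∈ F} ‖W₁ ⋯ W_j u‖²_{w H^s})^{1/2}` on `w H^{(s;k)}_{𝒱;𝒲}(M)`
associated with a finite spanning set `F` of `𝒲`. -/
def mixedSeminorm (F : Finset B.coefficientVF) (χ : 𝓓(cube n 2, ℝ)) (v : B.WeightFamily) (s : ℝ)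
    (k : ℕ) : Seminorm ℂ (B.mixedSpace χ v s k) :=
  let N (u : B.mixedSpace χ v s k) (x : (j : Fin (k + 1)) × (Fin j → F)) : ℝ :=
    B.sobolevSeminorm χ v s (B.wordMap χ v s k (List.ofFn fun i => (x.2 i).1)
      (by simpa using Nat.lt_succ_iff.1 x.1.2) u)
  Seminorm.of (fun u => √(∑ x, N u x ^ 2))
    (fun u u' => by
      have h := (l2_add (a := N u) (b := N u') (c := N (u + u')) .of_finite .of_finite
        (fun _ => apply_nonneg _ _) (fun _ => apply_nonneg _ _) (fun _ => apply_nonneg _ _)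
        fun x => by
          simp only [N, map_add]
          exact map_add_le_add _ _ _).2
      simpa only [tsum_fintype] using h)
    (fun c u => by
      have h : ∀ x, N (c • u) x ^ 2 = ‖c‖ ^ 2 * N u x ^ 2 := fun x => by
        simp only [N, map_smul, map_smul_eq_mul, mul_pow]
      simp only [h, ← Finset.mul_sum]
      rw [Real.sqrt_mul (by positivity), Real.sqrt_sq (norm_nonneg c)])

end ScaledBGStructure
end BG

/-- `X` is contained in `Y`, and the inclusion map `X → Y` is a compact operator with respect to the
topologies given by `p` on `X` and by `q` on `Y`. -/
def IsCompactInclusion {V : Type*} [AddCommGroup V] [Module ℂ V] {X Y : Submodule ℂ V}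
    (p : Seminorm ℂ X) (q : Seminorm ℂ Y) : Prop :=
  ∃ h : X ≤ Y,
    letI := p.toAddGroupSeminorm.toSeminormedAddCommGroup
    letI := q.toAddGroupSeminorm.toSeminormedAddCommGroup
    IsCompactOperator (Submodule.inclusion h)

end
end ScaledBG

open Filter ScaledBG

/-! Compactness splits into a local and a global part. In one fixed unit cell it is Rellich's
theorem on `ℝⁿ`, and constants may depend on the cell. Globally, the ratio `v α / v' α` of the two
weight families tends to zero as `α` leaves finite sets. A sequence bounded for the weight `w`
therefore has uniformly small tails for the weight `w'`, and convergence in every single cell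
implies convergence in norm (`tendsto_tsum_mul_of_cofinite`, `tendsto_sobolevSeminorm`). The ratio
tends to zero because only finitely many cells are centred in a given compact set (`tendsto_center`)
and a weight family is comparable to its weight at the centres (`tendsto_weight_ratio`).

For the local part, `T ∈ H^s` with norm at most `C` means exactly `|T φ| ≤ C ‖φ‖_{H^{-s}}` for
Schwartz functions `φ` (`MemSobolev.norm_apply_le`, `memSobolev_of_bound`). Every estimate for
distributions thus becomes an estimate of the transposed operator on Schwartz functions:
multiplication, scaling, change of coordinates. Rellich's theorem is `isCompact_closure_bessel`. A
countable product of compact sets then yields one subsequence converging in all cells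
(`exists_subseq_tendsto_local`), and the local limits form a distribution on `M` because a
distribution is locally a finite sum of its localizations (`exists_coord_eq_sum`,
`exists_dist_limit`).

If `s = s'` and `k' < k`, compactness comes from `𝒲`. This space contains the coordinate fields cut
off inside a cell (`coordField_mem`), so control of all `W u` in `H^s` improves local regularity by
one order (`CutBdd.gain`). Changes of coordinates are estimated in integer orders only
(`exists_hNorm_pullSchwartz_le`); the order `⌊s⌋ + 1 > s` is reached, which is enough.

Finally, the limit must be regular under all words in `𝒲`, while the norm sees only words in a
finite spanning set. Expansion in the spanning set and the Leibniz rule bridge the gap, provided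
that multiplication by uniform functions is bounded uniformly in the cell. Here `ρ ≤ 1` enters:
`S_α⁻¹` is a contraction and does not increase the weighted `L¹` norm of a Fourier transform
(`fourierL1_compLinear_le`, `exists_sobolevNorm_mulDist_le`). -/

namespace ScaledBG
noncomputable section
open Filter
open scoped FourierTransform
open FourierTransform

/-! ### Sobolev norms of Schwartz functions -/

section SchwartzSobolev
variable {n : ℕ}

/-- The weight `⟨x⟩ˢ = (1 + |x|²)^{s/2}`. -/
def bracket (s : ℝ) (x : Euc n) : ℝ := (1 + ‖x‖ ^ 2) ^ (s / 2)

theorem bracket_pos (s : ℝ) (x : Euc n) : 0 < bracket s x := by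
  unfold bracket; positivity

theorem bracket_add (s t : ℝ) (x : Euc n) : bracket (s + t) x = bracket s x * bracket t x := by
  rw [bracket, bracket, bracket, ← Real.rpow_add (by positivity)]; ring_nf

@[simp] theorem bracket_zero (x : Euc n) : bracket 0 x = 1 := by simp [bracket]

theorem bracket_neg (s : ℝ) (x : Euc n) : bracket (-s) x = (bracket s x)⁻¹ := by
  rw [bracket, bracket, ← Real.rpow_neg (by positivity)]; ring_nf

theorem bracket_mono {s t : ℝ} (h : s ≤ t) (x : Euc n) : bracket s x ≤ bracket t x := by
  apply Real.rpow_le_rpow_of_exponent_le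
  · nlinarith [norm_nonneg x]
  · linarith

theorem bracket_sq_one (x : Euc n) : bracket 1 x ^ 2 = 1 + ‖x‖ ^ 2 := by
  rw [bracket, ← Real.rpow_natCast, ← Real.rpow_mul (by positivity)]; norm_num

theorem bracket_two (x : Euc n) : bracket 2 x = 1 + ‖x‖ ^ 2 := by
  simp [bracket]

theorem hasTemperateGrowth_bracket (s : ℝ) :
    (fun x : Euc n => ((bracket s x : ℝ) : ℂ)).HasTemperateGrowth := by
  unfold bracket; fun_prop

theorem continuous_bracket (s : ℝ) : Continuous (bracket s : Euc n → ℝ) := by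
  unfold bracket
  exact Continuous.rpow_const (by fun_prop) fun x => Or.inl (by positivity)

/-- The Bessel potential on Schwartz functions, as the transpose of the one on tempered
distributions. -/
def besselSchwartz (s : ℝ) : 𝓢(Euc n, ℂ) →L[ℂ] 𝓢(Euc n, ℂ) :=
  fourierCLM ℂ 𝓢(Euc n, ℂ) ∘L
    SchwartzMap.smulLeftCLM ℂ (fun x : Euc n => ((bracket s x : ℝ) : ℂ)) ∘L
      fourierInvCLM ℂ 𝓢(Euc n, ℂ)

/-- The transpose of `𝓕⁻ ⟨ξ⟩ˢ 𝓕` is `𝓕 ⟨ξ⟩ˢ 𝓕⁻`, so it is `𝓕⁻` that diagonalizes it. For this reason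
the norms below are expressed through `𝓕⁻ φ`. -/
theorem fourierInv_besselSchwartz (s : ℝ) (φ : 𝓢(Euc n, ℂ)) (ξ : Euc n) :
    ((𝓕⁻ (besselSchwartz s φ) : 𝓢(Euc n, ℂ)) ξ : ℂ) = ((bracket s ξ : ℝ) : ℂ) * (𝓕⁻ φ : 𝓢(Euc n, ℂ)) ξ := by
  change (𝓕⁻ (𝓕 (SchwartzMap.smulLeftCLM ℂ (fun x : Euc n => ((bracket s x : ℝ) : ℂ)) (𝓕⁻ φ : 𝓢(Euc n, ℂ)))) : 𝓢(Euc n, ℂ)) ξ = _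
  rw [FourierTransform.fourierInv_fourier_eq,
    SchwartzMap.smulLeftCLM_apply_apply (hasTemperateGrowth_bracket s), smul_eq_mul]

theorem besselPotential_apply_apply (s : ℝ) (T : 𝓢'(Euc n, ℂ)) (φ : 𝓢(Euc n, ℂ)) :
    TemperedDistribution.besselPotential (Euc n) ℂ s T φ = T (besselSchwartz s φ) := rfl

theorem fourierInv_injective : Function.Injective (fun φ : 𝓢(Euc n, ℂ) => 𝓕⁻ φ) := fun φ ψ h => by
  have := congrArg (fun χ : 𝓢(Euc n, ℂ) => 𝓕 χ) h
  simpa using this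

theorem besselSchwartz_besselSchwartz (s t : ℝ) (φ : 𝓢(Euc n, ℂ)) :
    besselSchwartz s (besselSchwartz t φ) = besselSchwartz (s + t) φ := by
  apply fourierInv_injective
  ext ξ
  simp only [fourierInv_besselSchwartz, bracket_add]
  push_cast; ring

@[simp] theorem besselSchwartz_zero (φ : 𝓢(Euc n, ℂ)) : besselSchwartz 0 φ = φ := by
  apply fourierInv_injective
  ext ξ
  simp [fourierInv_besselSchwartz]

@[simp] theorem besselSchwartz_neg_cancel (s : ℝ) (φ : 𝓢(Euc n, ℂ)) :
    besselSchwartz s (besselSchwartz (-s) φ) = φ := by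
  rw [besselSchwartz_besselSchwartz]; simp

/-- The `H^s` norm of a Schwartz function. -/
def hNorm (s : ℝ) (φ : 𝓢(Euc n, ℂ)) : ℝ := ‖(besselSchwartz s φ).toLp 2 (volume : Measure (Euc n))‖

theorem hNorm_nonneg (s : ℝ) (φ : 𝓢(Euc n, ℂ)) : 0 ≤ hNorm s φ := norm_nonneg _

theorem hNorm_besselSchwartz (s t : ℝ) (φ : 𝓢(Euc n, ℂ)) :
    hNorm s (besselSchwartz t φ) = hNorm (s + t) φ := by
  rw [hNorm, besselSchwartz_besselSchwartz, hNorm]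

theorem norm_toLp_sq (φ : 𝓢(Euc n, ℂ)) :
    ‖φ.toLp 2 (volume : Measure (Euc n))‖ ^ 2 = ∫ x, ‖φ x‖ ^ 2 := by
  have h := SchwartzMap.norm_toLp' (f := φ) (μ := (volume : Measure (Euc n))) (p := 2)
    (by norm_num) (by norm_num)
  rw [h]
  simp only [ENNReal.toReal_ofNat, Real.rpow_ofNat]
  rw [← Real.rpow_natCast, ← Real.rpow_mul (integral_nonneg fun x => by positivity)]
  norm_num

theorem norm_fourierInv_toLp (φ : 𝓢(Euc n, ℂ)) :
    ‖(𝓕⁻ φ).toLp 2 (volume : Measure (Euc n))‖ = ‖φ.toLp 2 (volume : Measure (Euc n))‖ := by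
  rw [← SchwartzMap.norm_fourier_toL2_eq (𝓕⁻ φ), FourierTransform.fourier_fourierInv_eq]

theorem integrable_norm_sq (φ : 𝓢(Euc n, ℂ)) : Integrable fun x => ‖φ x‖ ^ 2 :=
  (φ.memLp 2 volume).integrable_norm_pow (by norm_num)

theorem hNorm_sq (s : ℝ) (φ : 𝓢(Euc n, ℂ)) :
    hNorm s φ ^ 2 = ∫ ξ, (bracket s ξ * ‖(𝓕⁻ φ : 𝓢(Euc n, ℂ)) ξ‖) ^ 2 := by
  rw [hNorm, ← norm_fourierInv_toLp, norm_toLp_sq]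
  refine integral_congr_ae (.of_forall fun ξ => ?_)
  simp only [fourierInv_besselSchwartz, norm_mul, Complex.norm_real, Real.norm_eq_abs,
    abs_of_pos (bracket_pos s ξ)]

theorem integrable_hNorm (s : ℝ) (φ : 𝓢(Euc n, ℂ)) :
    Integrable fun ξ => (bracket s ξ * ‖(𝓕⁻ φ : 𝓢(Euc n, ℂ)) ξ‖) ^ 2 := by
  refine (integrable_norm_sq (𝓕⁻ (besselSchwartz s φ))).congr (.of_forall fun ξ => ?_)
  simp only [fourierInv_besselSchwartz, norm_mul, Complex.norm_real, Real.norm_eq_abs,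
    abs_of_pos (bracket_pos s ξ)]

/-- Pointwise comparison of Fourier transforms gives a comparison of Sobolev norms. -/
theorem hNorm_le_of_bound {s t C : ℝ} (hC : 0 ≤ C) {φ ψ : 𝓢(Euc n, ℂ)}
    (h : ∀ ξ, bracket s ξ * ‖(𝓕⁻ φ : 𝓢(Euc n, ℂ)) ξ‖ ≤ C * (bracket t ξ * ‖(𝓕⁻ ψ : 𝓢(Euc n, ℂ)) ξ‖)) :
    hNorm s φ ≤ C * hNorm t ψ := by
  have h2 : hNorm s φ ^ 2 ≤ (C * hNorm t ψ) ^ 2 := by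
    rw [mul_pow, hNorm_sq, hNorm_sq, ← integral_const_mul]
    refine integral_mono (integrable_hNorm s φ) ((integrable_hNorm t ψ).const_mul _) fun ξ => ?_
    have := pow_le_pow_left₀ (mul_nonneg (bracket_pos s ξ).le (norm_nonneg _)) (h ξ) 2
    simpa only [mul_pow] using this
  exact le_of_sq_le_sq h2 (mul_nonneg hC (hNorm_nonneg _ _))

theorem hNorm_mono {s t : ℝ} (h : s ≤ t) (φ : 𝓢(Euc n, ℂ)) : hNorm s φ ≤ hNorm t φ := by
  have := hNorm_le_of_bound (s := s) (t := t) (φ := φ) (ψ := φ) zero_le_one fun ξ => by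
    rw [one_mul]; exact mul_le_mul_of_nonneg_right (bracket_mono h ξ) (norm_nonneg _)
  simpa using this

theorem hNorm_eq_seminorm (s : ℝ) (φ : 𝓢(Euc n, ℂ)) :
    hNorm s φ = ‖(SchwartzMap.toLpCLM ℂ ℂ 2 (volume : Measure (Euc n)) ∘L besselSchwartz s) φ‖ := rfl

theorem hNorm_add_le (s : ℝ) (φ ψ : 𝓢(Euc n, ℂ)) : hNorm s (φ + ψ) ≤ hNorm s φ + hNorm s ψ := by
  simp only [hNorm_eq_seminorm, map_add]; exact norm_add_le _ _

theorem hNorm_sum_le (s : ℝ) {ι : Type*} (S : Finset ι) (φ : ι → 𝓢(Euc n, ℂ)) :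
    hNorm s (∑ i ∈ S, φ i) ≤ ∑ i ∈ S, hNorm s (φ i) := by
  simp only [hNorm_eq_seminorm, map_sum]; exact norm_sum_le _ _

theorem fourierInv_lineDeriv (φ : 𝓢(Euc n, ℂ)) (m ξ : Euc n) :
    (𝓕⁻ (∂_{m} φ) : 𝓢(Euc n, ℂ)) ξ = -(2 * Real.pi * Complex.I) * (inner ℝ ξ m * (𝓕⁻ φ : 𝓢(Euc n, ℂ)) ξ) := by
  rw [SchwartzMap.fourierInv_lineDerivOp_eq]
  rw [smul_apply, SchwartzMap.smulLeftCLM_apply_apply (by fun_prop)]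
  simp

theorem hNorm_lineDeriv_le (s : ℝ) (φ : 𝓢(Euc n, ℂ)) (m : Euc n) :
    hNorm s (∂_{m} φ) ≤ 2 * Real.pi * ‖m‖ * hNorm (s + 1) φ := by
  refine hNorm_le_of_bound (by positivity) fun ξ => ?_
  rw [fourierInv_lineDeriv, bracket_add]
  simp only [norm_mul, norm_neg, Complex.norm_I, Complex.norm_real, Complex.norm_ofNat, mul_one,
    Real.norm_eq_abs, abs_of_pos Real.pi_pos]
  have h1 : |inner ℝ ξ m| ≤ bracket 1 ξ * ‖m‖ := by
    refine (abs_real_inner_le_norm ξ m).trans ?_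
    gcongr
    refine le_of_sq_le_sq ?_ (bracket_pos _ _).le
    rw [bracket_sq_one]; linarith
  calc _ = (bracket s ξ * (2 * Real.pi) * ‖(𝓕⁻ φ : 𝓢(Euc n, ℂ)) ξ‖) * |inner ℝ ξ m| := by ring
    _ ≤ (bracket s ξ * (2 * Real.pi) * ‖(𝓕⁻ φ : 𝓢(Euc n, ℂ)) ξ‖) * (bracket 1 ξ * ‖m‖) := by
      have := bracket_pos s ξ
      have := Real.pi_pos
      gcongr
    _ = _ := by ring

/-- The `i`-th unit vector. -/
abbrev unitVec (i : Fin n) : Euc n := EuclideanSpace.single i (1 : ℝ)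

/-- Follows from `1 + |ξ|² ≤ 1 + 4π²|ξ|²` on the Fourier side. It reduces order `m + 1` to order `m`
in `hNorm_pullSchwartz_nat_le`. -/
theorem hNorm_succ_le (s : ℝ) (φ : 𝓢(Euc n, ℂ)) :
    hNorm (s + 1) φ ≤ hNorm s φ + ∑ i : Fin n, hNorm s (∂_{unitVec i} φ) := by
  have h0 : hNorm (s + 1) φ ^ 2 ≤ hNorm s φ ^ 2 + ∑ i : Fin n, hNorm s (∂_{unitVec i} φ) ^ 2 := by
    simp only [hNorm_sq]
    rw [← integral_finsetSum _ fun i _ => integrable_hNorm _ _,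
      ← integral_add (integrable_hNorm _ _) (integrable_finsetSum _ fun i _ => integrable_hNorm _ _)]
    refine integral_mono (integrable_hNorm _ _) ((integrable_hNorm _ _).add
      (integrable_finsetSum _ fun i _ => integrable_hNorm _ _)) fun ξ => ?_
    have h2 : ∀ i : Fin n, ‖(𝓕⁻ (∂_{unitVec i} φ) : 𝓢(Euc n, ℂ)) ξ‖ ^ 2 = (2 * Real.pi) ^ 2 * ξ i ^ 2 * ‖(𝓕⁻ φ : 𝓢(Euc n, ℂ)) ξ‖ ^ 2 :=
      fun i => by
        rw [fourierInv_lineDeriv]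
        have : inner ℝ ξ (unitVec i) = ξ i := by
          simp [unitVec, EuclideanSpace.inner_single_right]
        rw [this]
        simp only [norm_mul, norm_neg, Complex.norm_I, Complex.norm_real, Complex.norm_ofNat,
          mul_one, Real.norm_eq_abs, abs_of_pos Real.pi_pos, mul_pow, sq_abs]
        ring
    simp only [mul_pow, h2]
    rw [bracket_add, mul_pow, bracket_sq_one, EuclideanSpace.norm_sq_eq ξ]
    simp only [Real.norm_eq_abs, sq_abs]
    have h3 : ∑ i, bracket s ξ ^ 2 * ((2 ^ 2 * Real.pi ^ 2) * ξ i ^ 2 * ‖(𝓕⁻ φ : 𝓢(Euc n, ℂ)) ξ‖ ^ 2) =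
        (2 ^ 2 * Real.pi ^ 2) * (bracket s ξ ^ 2 * (∑ i, ξ i ^ 2) * ‖(𝓕⁻ φ : 𝓢(Euc n, ℂ)) ξ‖ ^ 2) := by
      rw [Finset.mul_sum, Finset.sum_mul, Finset.mul_sum]
      exact Finset.sum_congr rfl fun i _ => by ring
    simp only [h3]
    have h4 : 1 ≤ (2 ^ 2 * Real.pi ^ 2) := by nlinarith [Real.pi_gt_three]
    have h5 : 0 ≤ bracket s ξ ^ 2 * (∑ i, ξ i ^ 2) * ‖(𝓕⁻ φ : 𝓢(Euc n, ℂ)) ξ‖ ^ 2 := by positivity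
    nlinarith
  have hs : ∀ i : Fin n, 0 ≤ hNorm s (∂_{unitVec i} φ) := fun i => hNorm_nonneg _ _
  refine le_of_sq_le_sq (h0.trans ?_) (add_nonneg (hNorm_nonneg _ _) (Finset.sum_nonneg fun i _ => hs i))
  have h6 : ∑ i : Fin n, hNorm s (∂_{unitVec i} φ) ^ 2 ≤ (∑ i : Fin n, hNorm s (∂_{unitVec i} φ)) ^ 2 :=
    Finset.sum_sq_le_sq_sum_of_nonneg fun i _ => hs i
  have h7 : 0 ≤ ∑ i : Fin n, hNorm s (∂_{unitVec i} φ) := Finset.sum_nonneg fun i _ => hs i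
  nlinarith [hNorm_nonneg s φ]

/-- In this normalization `∂ⱼ` becomes multiplication of `𝓕⁻ φ` by `-2πi ξⱼ`, so `⟨ξ⟩²` is the
symbol of `1 - Δ/(4π²)`. -/
theorem besselSchwartz_two (φ : 𝓢(Euc n, ℂ)) :
    besselSchwartz 2 φ = φ - ((4 * Real.pi ^ 2)⁻¹ : ℝ) • ∑ i : Fin n, ∂_{unitVec i} (∂_{unitVec i} φ) := by
  have h1 : φ = besselSchwartz 2 φ + ((4 * Real.pi ^ 2)⁻¹ : ℂ) • ∑ i : Fin n, ∂_{unitVec i} (∂_{unitVec i} φ) := by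
    apply fourierInv_injective
    ext ξ
    have h3 : ∀ i : Fin n, inner ℝ ξ (unitVec i) = ξ i := fun i => by
      simp [unitVec, EuclideanSpace.inner_single_right]
    have h2 : (𝓕⁻ (∑ i : Fin n, ∂_{unitVec i} (∂_{unitVec i} φ)) : 𝓢(Euc n, ℂ)) ξ =
        ∑ i, -(4 * Real.pi ^ 2 : ℂ) * ((ξ i : ℂ) ^ 2 * (𝓕⁻ φ : 𝓢(Euc n, ℂ)) ξ) := by
      rw [show (𝓕⁻ (∑ i : Fin n, ∂_{unitVec i} (∂_{unitVec i} φ)) : 𝓢(Euc n, ℂ)) = ∑ i : Fin n, 𝓕⁻ (∂_{unitVec i} (∂_{unitVec i} φ))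
        from map_sum (fourierInvCLM ℂ 𝓢(Euc n, ℂ)) _ _, FunLike.coe_sum, Finset.sum_apply]
      refine Finset.sum_congr rfl fun i _ => ?_
      rw [fourierInv_lineDeriv, fourierInv_lineDeriv, h3]
      linear_combination (4 * Real.pi ^ 2 * (ξ i : ℂ) ^ 2 * (𝓕⁻ φ : 𝓢(Euc n, ℂ)) ξ) * Complex.I_sq
    simp only [FourierTransform.fourierInv_add, FourierTransform.fourierInv_smul]
    rw [add_apply, smul_apply, h2, fourierInv_besselSchwartz, bracket_two, EuclideanSpace.norm_sq_eq,
      ← Finset.mul_sum, ← Finset.sum_mul]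
    have hpi : (Real.pi : ℂ) ≠ 0 := by exact_mod_cast Real.pi_ne_zero
    simp only [Real.norm_eq_abs, sq_abs, smul_eq_mul]
    push_cast
    field_simp
    ring
  have h4 : ((4 * Real.pi ^ 2)⁻¹ : ℝ) • ∑ i : Fin n, ∂_{unitVec i} (∂_{unitVec i} φ) = ((4 * Real.pi ^ 2)⁻¹ : ℂ) • ∑ i : Fin n, ∂_{unitVec i} (∂_{unitVec i} φ) := by
    ext x
    simp
  rw [h4]
  exact eq_sub_of_add_eq h1.symm

end SchwartzSobolev
end
end ScaledBG

namespace ScaledBG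
noncomputable section
open Filter
open scoped FourierTransform
open FourierTransform

/-! ### Duality between `H^s` and `H^{-s}` -/

section Duality
variable {n : ℕ}

theorem Lp_norm_star (f : Lp ℂ 2 (volume : Measure (Euc n))) : ‖star f‖ = ‖f‖ := by
  rw [Lp.norm_def, Lp.norm_def]
  congr 1
  refine eLpNorm_congr_norm_ae ?_
  filter_upwards [Lp.coeFn_star f] with x hx
  rw [hx]; simp

/-- The pairing with distributions is bilinear and the inner product sesquilinear; `star` mediates
between them. -/
theorem integral_mul_eq_inner (f : Lp ℂ 2 (volume : Measure (Euc n))) (φ : 𝓢(Euc n, ℂ)) :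
    ∫ x, φ x • f x = inner ℂ (star f) (φ.toLp 2 (volume : Measure (Euc n))) := by
  rw [L2.inner_def]
  refine integral_congr_ae ?_
  filter_upwards [Lp.coeFn_star f, φ.coeFn_toLp 2 volume] with x hx hx'
  rw [hx, hx']
  simp

/-- `T φ` is the `L²` pairing of the Bessel potential of `T` with `besselSchwartz (-s) φ`, and
Cauchy–Schwarz applies. -/
theorem MemSobolev.norm_apply_le {s : ℝ} {T : 𝓢'(Euc n, ℂ)}
    (h : TemperedDistribution.MemSobolev s 2 T) (φ : 𝓢(Euc n, ℂ)) :
    ‖T φ‖ ≤ sobolevNorm s T * hNorm (-s) φ := by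
  obtain ⟨f, hf⟩ := h
  rw [sobolevNorm_eq hf]
  have h1 : T φ = ∫ x, (besselSchwartz (-s) φ) x • f x := by
    rw [← Lp.toTemperedDistribution_apply, ← hf, besselPotential_apply_apply,
      besselSchwartz_neg_cancel]
  rw [h1, integral_mul_eq_inner, ← Lp_norm_star f]
  exact norm_inner_le_norm _ _

/-- The functional `φ ↦ T (besselSchwartz s φ)` is bounded in the `L²` norm on the dense space of
Schwartz functions. It extends to `L²`, and Riesz representation produces the Bessel potential of
`T`. -/
theorem memSobolev_of_bound {s C : ℝ} (hC : 0 ≤ C) {T : 𝓢'(Euc n, ℂ)}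
    (h : ∀ φ, ‖T φ‖ ≤ C * hNorm (-s) φ) :
    TemperedDistribution.MemSobolev s 2 T ∧ sobolevNorm s T ≤ C := by
  let e : 𝓢(Euc n, ℂ) →ₗ[ℂ] Lp ℂ 2 (volume : Measure (Euc n)) :=
    (SchwartzMap.toLpCLM ℂ ℂ 2 (volume : Measure (Euc n))).toLinearMap
  let F : 𝓢(Euc n, ℂ) →ₗ[ℂ] ℂ :=
    (T : 𝓢(Euc n, ℂ) →L[ℂ] ℂ).toLinearMap ∘ₗ (besselSchwartz s).toLinearMap
  have hd : DenseRange e := by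
    exact SchwartzMap.denseRange_toLpCLM (E := Euc n) (F := ℂ) (p := 2) (by norm_num)
  have hb : ∀ φ, ‖F φ‖ ≤ C * ‖e φ‖ := fun φ => by
    have := h (besselSchwartz s φ)
    rw [hNorm_besselSchwartz, neg_add_cancel, hNorm, besselSchwartz_zero] at this
    exact this
  set Λ := F.extendOfNorm e
  have hΛ : ∀ φ, Λ (e φ) = F φ := LinearMap.extendOfNorm_eq hd ⟨C, hb⟩
  have hΛn : ‖Λ‖ ≤ C := LinearMap.opNorm_extendOfNorm_le hd hC hb
  set y := (InnerProductSpace.toDual ℂ (Lp ℂ 2 (volume : Measure (Euc n)))).symm Λ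
  have hy : TemperedDistribution.besselPotential (Euc n) ℂ s T = (star y : Lp ℂ 2 _) := by
    ext φ
    rw [Lp.toTemperedDistribution_apply, integral_mul_eq_inner, star_star,
      InnerProductSpace.toDual_symm_apply]
    exact (hΛ φ).symm
  refine ⟨⟨_, hy⟩, ?_⟩
  rw [sobolevNorm_eq hy, Lp_norm_star]
  simpa [y] using hΛn

theorem hNorm_eq_fourier (s : ℝ) (φ : 𝓢(Euc n, ℂ)) :
    hNorm s φ ^ 2 = ∫ ξ, (bracket s ξ * ‖(𝓕 φ : 𝓢(Euc n, ℂ)) ξ‖) ^ 2 := by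
  rw [hNorm_sq, ← integral_neg_eq_self]
  refine integral_congr_ae (.of_forall fun ξ => ?_)
  simp only [SchwartzMap.fourierInv_apply_eq]
  simp [bracket]

/-- Duality of `H^s` and `H^{-s}` for Schwartz functions. -/
theorem hNorm_le_of_pairing {s C : ℝ} (hC : 0 ≤ C) {φ : 𝓢(Euc n, ℂ)}
    (h : ∀ θ : 𝓢(Euc n, ℂ), ‖∫ x, θ x * φ x‖ ≤ C * hNorm (-s) θ) : hNorm s φ ≤ C := by
  have h1 := memSobolev_of_bound (T := (φ : 𝓢'(Euc n, ℂ))) (s := s) hC fun θ => by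
    simpa using h θ
  -- The Bessel potential of `φ` as a distribution is `𝓕⁻ ⟨ξ⟩ˢ 𝓕 φ`, whereas `hNorm` is defined by
  -- `𝓕 ⟨ξ⟩ˢ 𝓕⁻ φ`. The norms agree because the bracket is even.
  set ψ : 𝓢(Euc n, ℂ) := SchwartzMap.fourierMultiplierCLM ℂ
    (fun x : Euc n => ((bracket s x : ℝ) : ℂ)) φ with hψ
  have h2 : TemperedDistribution.besselPotential (Euc n) ℂ s (φ : 𝓢'(Euc n, ℂ)) =
      (ψ.toLp 2 (volume : Measure (Euc n)) : Lp ℂ 2 _) := by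
    rw [TemperedDistribution.besselPotential, Lp.toTemperedDistribution_toLp_eq,
      TemperedDistribution.fourierMultiplierCLM_toTemperedDistributionCLM_eq (by fun_prop)]
    rfl
  rw [sobolevNorm_eq h2] at h1
  refine le_trans (le_of_eq ?_) h1.2
  have h3 : hNorm s φ ^ 2 = ‖ψ.toLp 2 (volume : Measure (Euc n))‖ ^ 2 := by
    rw [hNorm_eq_fourier, ← SchwartzMap.norm_fourier_toL2_eq, norm_toLp_sq]
    refine integral_congr_ae (.of_forall fun ξ => ?_)
    simp only [hψ, SchwartzMap.fourierMultiplierCLM_apply, FourierTransform.fourier_fourierInv_eq,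
      SchwartzMap.smulLeftCLM_apply_apply (hasTemperateGrowth_bracket s), norm_smul,
      Complex.norm_real, Real.norm_eq_abs, abs_of_pos (bracket_pos s ξ)]
  exact (sq_eq_sq₀ (hNorm_nonneg _ _) (norm_nonneg _)).1 h3

/-- Parseval's formula and Cauchy–Schwarz, after inserting `⟨ξ⟩ˢ ⟨ξ⟩⁻ˢ = 1`. -/
theorem norm_integral_mul_le (s : ℝ) (θ φ : 𝓢(Euc n, ℂ)) :
    ‖∫ x, θ x * φ x‖ ≤ hNorm s θ * hNorm (-s) φ := by
  have h1 : ∫ x, θ x * φ x = ∫ ξ, (𝓕 θ : 𝓢(Euc n, ℂ)) ξ * (𝓕⁻ φ : 𝓢(Euc n, ℂ)) ξ := by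
    rw [SchwartzMap.integral_fourier_mul_eq, FourierTransform.fourier_fourierInv_eq]
  have hA : MemLp (fun ξ => bracket s ξ * ‖(𝓕 θ : 𝓢(Euc n, ℂ)) ξ‖) 2 := by
    rw [memLp_two_iff_integrable_sq]
    · have := integrable_norm_sq (SchwartzMap.smulLeftCLM ℂ (fun x : Euc n => ((bracket s x : ℝ) : ℂ)) (𝓕 θ : 𝓢(Euc n, ℂ)))
      refine this.congr (.of_forall fun ξ => ?_)
      simp only [SchwartzMap.smulLeftCLM_apply_apply (hasTemperateGrowth_bracket s), norm_smul,
        Complex.norm_real, Real.norm_eq_abs, abs_of_pos (bracket_pos s ξ)]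
    · exact ((continuous_bracket s).mul (𝓕 θ : 𝓢(Euc n, ℂ)).continuous.norm).aestronglyMeasurable
  have hB : MemLp (fun ξ => bracket (-s) ξ * ‖(𝓕⁻ φ : 𝓢(Euc n, ℂ)) ξ‖) 2 := by
    rw [memLp_two_iff_integrable_sq]
    · exact integrable_hNorm _ _
    · exact ((continuous_bracket _).mul (𝓕⁻ φ : 𝓢(Euc n, ℂ)).continuous.norm).aestronglyMeasurable
  have hAB := integral_mul_le_Lp_mul_Lq_of_nonneg (μ := (volume : Measure (Euc n)))
    (p := 2) (q := 2) (Real.holderConjugate_iff.2 (by norm_num))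
    (f := fun ξ => bracket s ξ * ‖(𝓕 θ : 𝓢(Euc n, ℂ)) ξ‖)
    (g := fun ξ => bracket (-s) ξ * ‖(𝓕⁻ φ : 𝓢(Euc n, ℂ)) ξ‖)
    (.of_forall fun ξ => mul_nonneg (bracket_pos _ _).le (norm_nonneg _))
    (.of_forall fun ξ => mul_nonneg (bracket_pos _ _).le (norm_nonneg _))
    (by simpa using hA) (by simpa using hB)
  simp only [Real.rpow_ofNat, ← hNorm_sq, ← hNorm_eq_fourier, ← Real.sqrt_eq_rpow,
    Real.sqrt_sq (hNorm_nonneg _ _)] at hAB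
  refine le_trans ?_ hAB
  rw [h1]
  refine (norm_integral_le_integral_norm _).trans (le_of_eq ?_)
  refine integral_congr_ae (.of_forall fun ξ => ?_)
  have := (bracket_pos s ξ).ne'
  simp only [norm_mul, bracket_neg]
  field_simp

end Duality
end
end ScaledBG

namespace ScaledBG
noncomputable section
open Filter
open scoped FourierTransform
open FourierTransform

/-! ### Multiplication by Schwartz functions -/

section Multiplication
variable {n : ℕ}

theorem one_add_norm_sq_add_le (x y : Euc n) :
    1 + ‖x + y‖ ^ 2 ≤ 2 * (1 + ‖x‖ ^ 2) * (1 + ‖y‖ ^ 2) := by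
  have h := pow_le_pow_left₀ (norm_nonneg _) (norm_add_le x y) 2
  nlinarith [sq_nonneg (‖x‖ - ‖y‖), mul_nonneg (sq_nonneg ‖x‖) (sq_nonneg ‖y‖)]

/-- Peetre's inequality. -/
theorem bracket_add_le (s : ℝ) (x y : Euc n) :
    bracket s (x + y) ≤ 2 ^ (|s| / 2) * bracket |s| x * bracket s y := by
  rcases le_total 0 s with hs | hs
  · rw [abs_of_nonneg hs, bracket, bracket, bracket, ← Real.mul_rpow (by norm_num) (by positivity),
      ← Real.mul_rpow (by positivity) (by positivity)]
    exact Real.rpow_le_rpow (by positivity) (one_add_norm_sq_add_le x y) (by positivity)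
  -- For `s ≤ 0`, the inequality with exponent `-s` is applied to `y = -x + (x + y)` and solved for
  -- `bracket s (x + y)`.
  · have h1 : bracket (-s) y ≤ 2 ^ (-s / 2) * bracket (-s) x * bracket (-s) (x + y) := by
      rw [bracket, bracket, bracket, ← Real.mul_rpow (by norm_num) (by positivity),
        ← Real.mul_rpow (by positivity) (by positivity)]
      refine Real.rpow_le_rpow (by positivity) ?_ (by linarith)
      have := one_add_norm_sq_add_le (-x) (x + y)
      simpa using this
    rw [abs_of_nonpos hs]
    rw [bracket_neg s y, bracket_neg s (x + y)] at h1
    have ha := bracket_pos s y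
    have hb := bracket_pos s (x + y)
    have h2 := mul_le_mul_of_nonneg_right h1 (mul_pos ha hb).le
    have e1 : (bracket s y)⁻¹ * (bracket s y * bracket s (x + y)) = bracket s (x + y) := by
      field_simp
    have e2 : 2 ^ (-s / 2) * bracket (-s) x * (bracket s (x + y))⁻¹ * (bracket s y * bracket s (x + y))
        = 2 ^ (-s / 2) * bracket (-s) x * bracket s y := by
      field_simp
    rwa [e1, e2] at h2

open scoped ENNReal in
/-- Young's inequality `‖A ⋆ B‖_{L²} ≤ ‖A‖_{L¹} ‖B‖_{L²}`. -/
theorem lintegral_convolution_sq_le {A B : Euc n → ℝ≥0∞} (hA : Measurable A) (hB : Measurable B) :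
    ∫⁻ ξ, (∫⁻ t, A t * B (ξ - t)) ^ 2 ≤ (∫⁻ t, A t) ^ 2 * ∫⁻ ξ, B ξ ^ 2 := by
  -- Cauchy–Schwarz with `A = A^{1/2} A^{1/2}`, so that only one factor carries `B`. Tonelli and
  -- translation invariance do the rest.
  have h1 : ∀ ξ, (∫⁻ t, A t * B (ξ - t)) ^ 2 ≤ (∫⁻ t, A t) * ∫⁻ t, A t * B (ξ - t) ^ 2 := fun ξ => by
    have hBm : Measurable fun t => B (ξ - t) := hB.comp (measurable_const.sub measurable_id)
    have h := ENNReal.lintegral_mul_le_Lp_mul_Lq volume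
      (p := 2) (q := 2) (Real.holderConjugate_iff.2 (by norm_num))
      (f := fun t => A t ^ (1 / 2 : ℝ)) (g := fun t => A t ^ (1 / 2 : ℝ) * B (ξ - t))
      (hA.pow_const _).aemeasurable ((hA.pow_const _).mul hBm).aemeasurable
    have e1 : ∀ t, (A t ^ (1 / 2 : ℝ)) ^ (2 : ℝ) = A t := fun t => by
      rw [← ENNReal.rpow_mul]; norm_num
    have e2 : ∀ t, A t ^ (1 / 2 : ℝ) * (A t ^ (1 / 2 : ℝ) * B (ξ - t)) = A t * B (ξ - t) := fun t => by
      rw [← mul_assoc, ← ENNReal.rpow_add_of_nonneg _ _ (by norm_num) (by norm_num)]; norm_num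
    simp only [Pi.mul_apply, e2, ENNReal.mul_rpow_of_nonneg _ _ (zero_le_two (α := ℝ)), e1] at h
    simp only [ENNReal.rpow_ofNat] at h
    refine (pow_le_pow_left₀ zero_le h 2).trans (le_of_eq ?_)
    rw [mul_pow, ← ENNReal.rpow_natCast, ← ENNReal.rpow_natCast, ← ENNReal.rpow_mul,
      ← ENNReal.rpow_mul]
    norm_num
  calc _ ≤ ∫⁻ ξ, (∫⁻ t, A t) * ∫⁻ t, A t * B (ξ - t) ^ 2 := lintegral_mono h1
    _ = (∫⁻ t, A t) * ∫⁻ ξ, ∫⁻ t, A t * B (ξ - t) ^ 2 := by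
      refine lintegral_const_mul _ (Measurable.lintegral_prod_right' (f := fun p : Euc n × Euc n => A p.2 * B (p.1 - p.2) ^ 2) ?_)
      fun_prop
    _ = (∫⁻ t, A t) * ∫⁻ t, ∫⁻ ξ, A t * B (ξ - t) ^ 2 := by
      rw [lintegral_lintegral_swap]
      have : Measurable fun p : Euc n × Euc n => A p.2 * B (p.1 - p.2) ^ 2 := by fun_prop
      exact this.aemeasurable
    _ = (∫⁻ t, A t) * ∫⁻ t, A t * ∫⁻ ξ, B ξ ^ 2 := by
      congr 1
      refine lintegral_congr fun t => ?_
      rw [lintegral_const_mul _ (by fun_prop), lintegral_sub_right_eq_self (fun ξ => B ξ ^ 2) t]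
    _ = _ := by
      rw [lintegral_mul_const _ hA, sq, mul_assoc]

/-- The product of two Schwartz functions. -/
def mulSchwartz (g : 𝓢(Euc n, ℂ)) : 𝓢(Euc n, ℂ) →L[ℂ] 𝓢(Euc n, ℂ) :=
  SchwartzMap.pairing (ContinuousLinearMap.mul ℂ ℂ) g

@[simp] theorem mulSchwartz_apply (g φ : 𝓢(Euc n, ℂ)) (x : Euc n) :
    mulSchwartz g φ x = g x * φ x := rfl

theorem fourierInv_mulSchwartz (g φ : 𝓢(Euc n, ℂ)) (ξ : Euc n) :
    (𝓕⁻ (mulSchwartz g φ) : 𝓢(Euc n, ℂ)) ξ =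
      ∫ t, (𝓕⁻ g : 𝓢(Euc n, ℂ)) t * (𝓕⁻ φ : 𝓢(Euc n, ℂ)) (ξ - t) := by
  have h := SchwartzMap.convolution_apply (ContinuousLinearMap.mul ℂ ℂ) (𝓕⁻ g : 𝓢(Euc n, ℂ)) (𝓕⁻ φ) ξ
  rw [convolution_def] at h
  simp only [ContinuousLinearMap.mul_apply'] at h
  rw [← h]
  change _ = (𝓕⁻ (SchwartzMap.pairing (ContinuousLinearMap.mul ℂ ℂ) (𝓕 (𝓕⁻ g : 𝓢(Euc n, ℂ)) : 𝓢(Euc n, ℂ)) (𝓕 (𝓕⁻ φ : 𝓢(Euc n, ℂ)) : 𝓢(Euc n, ℂ))) : 𝓢(Euc n, ℂ)) ξ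
  rw [FourierTransform.fourier_fourierInv_eq, FourierTransform.fourier_fourierInv_eq]
  rfl

/-- The weighted `L¹` norm `∫ ⟨ξ⟩ᵃ |ĝ(ξ)| dξ`. -/
def fourierL1 (a : ℝ) (g : 𝓢(Euc n, ℂ)) : ℝ := ∫ ξ, bracket a ξ * ‖(𝓕⁻ g : 𝓢(Euc n, ℂ)) ξ‖

theorem integrable_bracket_mul_norm (a : ℝ) (g : 𝓢(Euc n, ℂ)) :
    Integrable fun ξ => bracket a ξ * ‖g ξ‖ := by
  have := (SchwartzMap.smulLeftCLM ℂ (fun x : Euc n => ((bracket a x : ℝ) : ℂ)) g).integrable (μ := volume)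
  refine this.norm.congr (.of_forall fun ξ => ?_)
  simp only [SchwartzMap.smulLeftCLM_apply_apply (hasTemperateGrowth_bracket a), norm_smul,
    Complex.norm_real, Real.norm_eq_abs, abs_of_pos (bracket_pos a ξ)]

theorem fourierL1_nonneg (a : ℝ) (g : 𝓢(Euc n, ℂ)) : 0 ≤ fourierL1 a g :=
  integral_nonneg fun ξ => mul_nonneg (bracket_pos a ξ).le (norm_nonneg _)

/-- Multiplication by a Schwartz function is bounded on `H^s`. -/
theorem hNorm_mulSchwartz_le (s : ℝ) (g φ : 𝓢(Euc n, ℂ)) :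
    hNorm s (mulSchwartz g φ) ≤ 2 ^ (|s| / 2) * fourierL1 |s| g * hNorm s φ := by
  set a : Euc n → ℝ := fun t => bracket |s| t * ‖(𝓕⁻ g : 𝓢(Euc n, ℂ)) t‖ with ha
  set b : Euc n → ℝ := fun t => bracket s t * ‖(𝓕⁻ φ : 𝓢(Euc n, ℂ)) t‖ with hb
  have ha0 : ∀ t, 0 ≤ a t := fun t => mul_nonneg (bracket_pos _ t).le (norm_nonneg _)
  have hb0 : ∀ t, 0 ≤ b t := fun t => mul_nonneg (bracket_pos _ t).le (norm_nonneg _)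
  have hac : Continuous a := (continuous_bracket _).mul (𝓕⁻ g : 𝓢(Euc n, ℂ)).continuous.norm
  have hbc : Continuous b := (continuous_bracket _).mul (𝓕⁻ φ : 𝓢(Euc n, ℂ)).continuous.norm
  set K : ℝ := 2 ^ (|s| / 2) with hK
  have hK0 : 0 ≤ K := by positivity
  -- Peetre's inequality distributes the weight over the convolution as `⟨ξ⟩ˢ ≤ K ⟨t⟩^{|s|} ⟨ξ -
  -- t⟩ˢ`. Young's inequality then leaves `g` only in a weighted `L¹` norm, which behaves well under
  -- scaling.
  have h1 : ∀ ξ, ENNReal.ofReal (bracket s ξ * ‖(𝓕⁻ (mulSchwartz g φ) : 𝓢(Euc n, ℂ)) ξ‖) ≤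
      ENNReal.ofReal K * ∫⁻ t, ENNReal.ofReal (a t) * ENNReal.ofReal (b (ξ - t)) := fun ξ => by
    have h2 : ENNReal.ofReal ‖(𝓕⁻ (mulSchwartz g φ) : 𝓢(Euc n, ℂ)) ξ‖ ≤
        ∫⁻ t, ENNReal.ofReal (‖(𝓕⁻ g : 𝓢(Euc n, ℂ)) t‖ * ‖(𝓕⁻ φ : 𝓢(Euc n, ℂ)) (ξ - t)‖) := by
      rw [fourierInv_mulSchwartz, ofReal_norm]
      refine (enorm_integral_le_lintegral_enorm _).trans (le_of_eq ?_)
      refine lintegral_congr fun t => ?_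
      rw [← ofReal_norm, norm_mul]
    rw [ENNReal.ofReal_mul (bracket_pos _ _).le]
    refine (mul_le_mul_right h2 _).trans ?_
    rw [← lintegral_const_mul' _ _ ENNReal.ofReal_ne_top,
      ← lintegral_const_mul' _ _ ENNReal.ofReal_ne_top]
    refine lintegral_mono fun t => ?_
    rw [← ENNReal.ofReal_mul (bracket_pos _ _).le, ← ENNReal.ofReal_mul (ha0 t),
      ← ENNReal.ofReal_mul hK0]
    refine ENNReal.ofReal_le_ofReal ?_
    have := bracket_add_le s t (ξ - t)
    rw [add_sub_cancel] at this
    calc bracket s ξ * (‖(𝓕⁻ g : 𝓢(Euc n, ℂ)) t‖ * ‖(𝓕⁻ φ : 𝓢(Euc n, ℂ)) (ξ - t)‖)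
        ≤ (K * bracket |s| t * bracket s (ξ - t)) *
          (‖(𝓕⁻ g : 𝓢(Euc n, ℂ)) t‖ * ‖(𝓕⁻ φ : 𝓢(Euc n, ℂ)) (ξ - t)‖) := by gcongr
      _ = K * (a t * b (ξ - t)) := by simp only [ha, hb]; ring
  have h3 : ENNReal.ofReal (hNorm s (mulSchwartz g φ) ^ 2) ≤
      ENNReal.ofReal ((K * fourierL1 |s| g * hNorm s φ) ^ 2) := by
    rw [hNorm_sq, ofReal_integral_eq_lintegral_ofReal (integrable_hNorm _ _)
      (.of_forall fun ξ => sq_nonneg _)]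
    calc _ ≤ ∫⁻ ξ, ENNReal.ofReal K ^ 2 *
          (∫⁻ t, ENNReal.ofReal (a t) * ENNReal.ofReal (b (ξ - t))) ^ 2 := by
          refine lintegral_mono fun ξ => ?_
          rw [ENNReal.ofReal_pow (mul_nonneg (bracket_pos _ _).le (norm_nonneg _)), ← mul_pow]
          exact pow_le_pow_left₀ zero_le (h1 ξ) 2
      _ = ENNReal.ofReal K ^ 2 *
          ∫⁻ ξ, (∫⁻ t, ENNReal.ofReal (a t) * ENNReal.ofReal (b (ξ - t))) ^ 2 :=
          lintegral_const_mul' _ _ (ENNReal.pow_ne_top ENNReal.ofReal_ne_top)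
      _ ≤ ENNReal.ofReal K ^ 2 * ((∫⁻ t, ENNReal.ofReal (a t)) ^ 2 *
          ∫⁻ ξ, ENNReal.ofReal (b ξ) ^ 2) := by
          gcongr
          exact lintegral_convolution_sq_le hac.measurable.ennreal_ofReal hbc.measurable.ennreal_ofReal
      _ = _ := by
          rw [← ofReal_integral_eq_lintegral_ofReal (integrable_bracket_mul_norm _ _)
            (.of_forall ha0)]
          have : ∫⁻ ξ, ENNReal.ofReal (b ξ) ^ 2 = ENNReal.ofReal (hNorm s φ ^ 2) := by
            rw [hNorm_sq, ofReal_integral_eq_lintegral_ofReal (integrable_hNorm _ _)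
              (.of_forall fun ξ => sq_nonneg _)]
            exact lintegral_congr fun ξ => (ENNReal.ofReal_pow (hb0 ξ) 2).symm
          rw [this, mul_pow, mul_pow, ENNReal.ofReal_mul (by positivity), ENNReal.ofReal_mul (by positivity),
            ENNReal.ofReal_pow hK0, ENNReal.ofReal_pow (fourierL1_nonneg _ _), mul_assoc]
          rfl
  have h4 := (ENNReal.ofReal_le_ofReal_iff (sq_nonneg _)).1 h3
  exact le_of_sq_le_sq h4 (mul_nonneg (mul_nonneg hK0 (fourierL1_nonneg _ _)) (hNorm_nonneg _ _))

/-- A continuous seminorm is bounded on families of Schwartz functions with bounded seminorms. -/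
theorem exists_bound_of_seminorms {ι : Type*} {g : ι → 𝓢(Euc n, ℂ)}
    (hg : ∀ k l : ℕ, ∃ C, ∀ i, SchwartzMap.seminorm ℂ k l (g i) ≤ C)
    {F : Type*} [NormedAddCommGroup F] [NormedSpace ℂ F] (L : 𝓢(Euc n, ℂ) →L[ℂ] F) :
    ∃ C, 0 ≤ C ∧ ∀ i, ‖L (g i)‖ ≤ C := by
  obtain ⟨S, C, -, hC⟩ := Seminorm.bound_of_continuous (schwartz_withSeminorms ℂ (Euc n) ℂ)
    ((normSeminorm ℂ F).comp L.toLinearMap) (continuous_norm.comp L.continuous)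
  choose D hD using hg
  refine ⟨∑ p ∈ S, C * |D p.1 p.2|, Finset.sum_nonneg fun _ _ => by positivity, fun i => ?_⟩
  have h1 := hC (g i)
  refine h1.trans ?_
  rw [smul_apply, ← Finset.mul_sum]
  refine mul_le_mul_of_nonneg_left ?_ C.2
  refine Seminorm.finset_sup_apply_le (Finset.sum_nonneg fun _ _ => abs_nonneg _) fun p hp => ?_
  exact ((hD p.1 p.2 i).trans (le_abs_self _)).trans
    (Finset.single_le_sum (f := fun p : ℕ × ℕ => |D p.1 p.2|) (fun _ _ => abs_nonneg _) hp)

/-- `fourierL1 a` is the norm of a continuous linear map into `L¹`, hence controlled by finitely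
many Schwartz seminorms. This makes multiplier bounds uniform over families of cutoffs. -/
theorem exists_fourierL1_bound {ι : Type*} {g : ι → 𝓢(Euc n, ℂ)}
    (hg : ∀ k l : ℕ, ∃ C, ∀ i, SchwartzMap.seminorm ℂ k l (g i) ≤ C) (a : ℝ) :
    ∃ C, 0 ≤ C ∧ ∀ i, fourierL1 a (g i) ≤ C := by
  obtain ⟨C, hC0, hC⟩ := exists_bound_of_seminorms hg
    (SchwartzMap.toLpCLM ℂ ℂ 1 (volume : Measure (Euc n)) ∘L
      SchwartzMap.smulLeftCLM ℂ (fun x : Euc n => ((bracket a x : ℝ) : ℂ)) ∘L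
      fourierInvCLM ℂ 𝓢(Euc n, ℂ))
  refine ⟨C, hC0, fun i => le_trans (le_of_eq ?_) (hC i)⟩
  change _ = ‖(SchwartzMap.smulLeftCLM ℂ (fun x : Euc n => ((bracket a x : ℝ) : ℂ))
    (𝓕⁻ (g i) : 𝓢(Euc n, ℂ))).toLp 1 (volume : Measure (Euc n))‖
  rw [SchwartzMap.norm_toLp_one, fourierL1]
  refine integral_congr_ae (.of_forall fun ξ => ?_)
  simp only [SchwartzMap.smulLeftCLM_apply_apply (hasTemperateGrowth_bracket a), norm_smul,
    Complex.norm_real, Real.norm_eq_abs, abs_of_pos (bracket_pos a ξ)]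

end Multiplication

/-! ### Linear changes of variables -/

section Scaling
variable {n : ℕ}

theorem integral_comp_continuousLinearEquiv {F : Type*} [NormedAddCommGroup F] [NormedSpace ℝ F]
    (L : Euc n ≃L[ℝ] Euc n) (f : Euc n → F) :
    ∫ x, f (L x) = |LinearMap.det (L : Euc n →ₗ[ℝ] Euc n)|⁻¹ • ∫ x, f x := by
  have hdet : LinearMap.det (L : Euc n →ₗ[ℝ] Euc n) ≠ 0 := L.toLinearEquiv.isUnit_det'.ne_zero
  have h := Measure.map_linearMap_addHaar_eq_smul_addHaar (volume : Measure (Euc n)) hdet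
  have h2 := L.toHomeomorph.measurableEmbedding.integral_map (μ := (volume : Measure (Euc n))) f
  change ∫ y, f y ∂(Measure.map (L : Euc n →ₗ[ℝ] Euc n) volume) = _ at h2
  rw [h, integral_smul_measure, ENNReal.toReal_ofReal (abs_nonneg _), abs_inv] at h2
  exact h2.symm

theorem abs_det_pos (L : Euc n ≃L[ℝ] Euc n) : 0 < |LinearMap.det (L : Euc n →ₗ[ℝ] Euc n)| :=
  abs_pos.2 L.toLinearEquiv.isUnit_det'.ne_zero

theorem abs_det_symm_inv (L : Euc n ≃L[ℝ] Euc n) :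
    |LinearMap.det (L.symm : Euc n →ₗ[ℝ] Euc n)|⁻¹ = |LinearMap.det (L : Euc n →ₗ[ℝ] Euc n)| := by
  have : LinearMap.det (L : Euc n →ₗ[ℝ] Euc n) * LinearMap.det (L.symm : Euc n →ₗ[ℝ] Euc n) = 1 := by
    rw [← LinearMap.det_comp]
    convert LinearMap.det_id
    ext x; simp
  rw [eq_comm, ← mul_eq_one_iff_eq_inv₀ (abs_det_pos L.symm).ne', ← abs_mul, this, abs_one]

/-- Composition of a Schwartz function with a linear isomorphism. -/
abbrev compLinear (L : Euc n ≃L[ℝ] Euc n) : 𝓢(Euc n, ℂ) →L[ℂ] 𝓢(Euc n, ℂ) :=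
  SchwartzMap.compCLMOfContinuousLinearEquiv ℂ L

/-- The Fourier side sees the inverse transpose of `L`; symmetry, which holds for diagonal scalings,
makes it `L⁻¹`. -/
theorem fourierInv_compLinear (L : Euc n ≃L[ℝ] Euc n)
    (hL : ∀ x y, inner ℝ (L x) y = inner ℝ x (L y)) (φ : 𝓢(Euc n, ℂ)) (ξ : Euc n) :
    (𝓕⁻ (compLinear L φ) : 𝓢(Euc n, ℂ)) ξ =
      |LinearMap.det (L : Euc n →ₗ[ℝ] Euc n)|⁻¹ • (𝓕⁻ φ : 𝓢(Euc n, ℂ)) (L.symm ξ) := by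
  rw [SchwartzMap.fourierInv_coe, SchwartzMap.fourierInv_coe, Real.fourierInv_eq, Real.fourierInv_eq,
    ← integral_comp_continuousLinearEquiv L]
  refine integral_congr_ae (.of_forall fun x => ?_)
  simp only
  rw [hL, L.apply_symm_apply]
  rfl

theorem hNorm_compLinear_le (s : ℝ) (L : Euc n ≃L[ℝ] Euc n)
    (hL : ∀ x y, inner ℝ (L x) y = inner ℝ x (L y)) :
    ∃ C, 0 ≤ C ∧ ∀ φ, hNorm s (compLinear L φ) ≤ C * hNorm s φ := by
  obtain ⟨K, hK0, hK⟩ : ∃ K : ℝ, 0 ≤ K ∧ ∀ x, bracket s (L x) ≤ K * bracket s x := by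
    -- The factor `bracket t 0` equals one. For `s ≤ 0` the estimate is used for `L⁻¹`, with
    -- exponent `-s`, at the point `L x`.
    have key : ∀ (t : ℝ), 0 ≤ t → ∀ (L' : Euc n →L[ℝ] Euc n) x,
        bracket t (L' x) ≤ bracket t (0 : Euc n) * (1 + ‖L'‖ ^ 2) ^ (t / 2) * bracket t x := by
      intro t ht L' x
      rw [bracket, bracket, bracket]
      simp only [norm_zero]
      rw [← Real.mul_rpow (by positivity) (by positivity), ← Real.mul_rpow (by positivity) (by positivity)]
      refine Real.rpow_le_rpow (by positivity) ?_ (by positivity)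
      have := pow_le_pow_left₀ (norm_nonneg _) (L'.le_opNorm x) 2
      nlinarith [sq_nonneg ‖x‖, sq_nonneg ‖L'‖]
    rcases le_total 0 s with hs | hs
    · exact ⟨_, by have := bracket_pos s (0 : Euc n); positivity, key s hs (L : Euc n →L[ℝ] Euc n)⟩
    · refine ⟨bracket (-s) (0 : Euc n) * (1 + ‖(L.symm : Euc n →L[ℝ] Euc n)‖ ^ 2) ^ (-s / 2), ?_,
        fun x => ?_⟩
      · have := bracket_pos (-s) (0 : Euc n); positivity
      · have h := key (-s) (by linarith) (L.symm : Euc n →L[ℝ] Euc n) (L x)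
        simp only [ContinuousLinearEquiv.coe_coe, L.symm_apply_apply] at h
        rw [bracket_neg s x, bracket_neg s (L x)] at h
        have h1 := bracket_pos s x
        have h2 := bracket_pos s (L x)
        have h3 := mul_le_mul_of_nonneg_right h (mul_pos h1 h2).le
        calc bracket s (L x) = (bracket s x)⁻¹ * (bracket s x * bracket s (L x)) := by field_simp
          _ ≤ _ := h3
          _ = _ := by field_simp
  set d := |LinearMap.det (L : Euc n →ₗ[ℝ] Euc n)| with hd
  have hd0 : 0 < d := abs_det_pos L
  refine ⟨√(d⁻¹) * K, by positivity, fun φ => ?_⟩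
  have h : hNorm s (compLinear L φ) ^ 2 ≤ (√(d⁻¹) * K * hNorm s φ) ^ 2 := by
    have e1 : hNorm s (compLinear L φ) ^ 2 =
        ∫ ξ, (fun η => (bracket s (L η) * (d⁻¹ * ‖(𝓕⁻ φ : 𝓢(Euc n, ℂ)) η‖)) ^ 2) (L.symm ξ) := by
      rw [hNorm_sq]
      refine integral_congr_ae (.of_forall fun ξ => ?_)
      simp only [fourierInv_compLinear L hL, L.apply_symm_apply, norm_smul, norm_inv, ← hd,
        Real.norm_of_nonneg hd0.le]
    have e2 : ∫ η, (bracket s (L η) * (d⁻¹ * ‖(𝓕⁻ φ : 𝓢(Euc n, ℂ)) η‖)) ^ 2 ≤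
        (d⁻¹ * K) ^ 2 * hNorm s φ ^ 2 := by
      rw [hNorm_sq, ← integral_const_mul]
      refine integral_mono_of_nonneg (.of_forall fun η => sq_nonneg _)
        ((integrable_hNorm s φ).const_mul _) (.of_forall fun η => ?_)
      simp only
      rw [← mul_pow]
      refine pow_le_pow_left₀ (mul_nonneg (bracket_pos _ _).le (by positivity)) ?_ 2
      calc _ = d⁻¹ * bracket s (L η) * ‖(𝓕⁻ φ : 𝓢(Euc n, ℂ)) η‖ := by ring
        _ ≤ d⁻¹ * (K * bracket s η) * ‖(𝓕⁻ φ : 𝓢(Euc n, ℂ)) η‖ := by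
          gcongr; exact hK η
        _ = _ := by ring
    rw [e1, integral_comp_continuousLinearEquiv L.symm
      (fun η => (bracket s (L η) * (d⁻¹ * ‖(𝓕⁻ φ : 𝓢(Euc n, ℂ)) η‖)) ^ 2), abs_det_symm_inv, ← hd, smul_eq_mul]
    refine (mul_le_mul_of_nonneg_left e2 hd0.le).trans (le_of_eq ?_)
    rw [mul_pow, mul_pow, mul_pow, Real.sq_sqrt (by positivity)]
    field_simp
  exact le_of_sq_le_sq h (mul_nonneg (by positivity) (hNorm_nonneg _ _))

/-- The Jacobian cancels in an `L¹` norm, and the substitution moves the weight to `L η`, where it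
is no larger because `L` contracts and `a ≥ 0`. The constant is one for every such `L`, so the bound
is uniform over all scalings with `ρ ≤ 1`. -/
theorem fourierL1_compLinear_le {a : ℝ} (ha : 0 ≤ a) (L : Euc n ≃L[ℝ] Euc n)
    (hL : ∀ x y, inner ℝ (L x) y = inner ℝ x (L y)) (hL1 : ∀ x, ‖L x‖ ≤ ‖x‖) (g : 𝓢(Euc n, ℂ)) :
    fourierL1 a (compLinear L g) ≤ fourierL1 a g := by
  set d := |LinearMap.det (L : Euc n →ₗ[ℝ] Euc n)| with hd
  have hd0 : 0 < d := abs_det_pos L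
  have e1 : fourierL1 a (compLinear L g) =
      ∫ ξ, (fun η => (bracket a (L η) * (d⁻¹ * ‖(𝓕⁻ g : 𝓢(Euc n, ℂ)) η‖))) (L.symm ξ) := by
    rw [fourierL1]
    refine integral_congr_ae (.of_forall fun ξ => ?_)
    simp only [fourierInv_compLinear L hL, L.apply_symm_apply, norm_smul, norm_inv, ← hd,
      Real.norm_of_nonneg hd0.le]
  rw [e1, integral_comp_continuousLinearEquiv L.symm
    (fun η => bracket a (L η) * (d⁻¹ * ‖(𝓕⁻ g : 𝓢(Euc n, ℂ)) η‖)), abs_det_symm_inv, ← hd, ← integral_smul]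
  refine integral_mono_of_nonneg (.of_forall fun η => ?_) (integrable_bracket_mul_norm _ _)
    (.of_forall fun η => ?_)
  · exact mul_nonneg hd0.le (mul_nonneg (bracket_pos _ _).le (by positivity))
  · simp only [smul_eq_mul]
    have h1 : bracket a (L η) ≤ bracket a η := by
      refine Real.rpow_le_rpow (by positivity) ?_ (by positivity)
      have := pow_le_pow_left₀ (norm_nonneg _) (hL1 η) 2
      linarith
    calc d * (bracket a (L η) * (d⁻¹ * ‖(𝓕⁻ g : 𝓢(Euc n, ℂ)) η‖))
        = bracket a (L η) * ‖(𝓕⁻ g : 𝓢(Euc n, ℂ)) η‖ := by field_simp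
      _ ≤ _ := by gcongr

end Scaling
end
end ScaledBG

namespace ScaledBG
noncomputable section
open Filter
open scoped FourierTransform
open FourierTransform

/-! ### Rellich's theorem on `ℝⁿ` -/

section Rellich
variable {n : ℕ}

/-- A set all of whose sequences have convergent subsequences is relatively compact. -/
theorem isCompact_closure_of_subseq {X : Type*} [PseudoMetricSpace X] {S : Set X}
    (h : ∀ x : ℕ → X, (∀ j, x j ∈ S) → ∃ a, ∃ φ : ℕ → ℕ, StrictMono φ ∧ Tendsto (x ∘ φ) atTop (𝓝 a)) :
    IsCompact (closure S) := by
  refine IsSeqCompact.isCompact fun y hy => ?_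
  -- Points of the closure are replaced by points of `S` at distance tending to zero, which does not
  -- affect convergence of subsequences.
  have h1 : ∀ j : ℕ, ∃ z ∈ S, dist (y j) z < 1 / ((j : ℝ) + 1) := fun j =>
    Metric.mem_closure_iff.1 (hy j) _ (by positivity)
  choose z hz hyz using h1
  obtain ⟨a, φ, hφ, ha⟩ := h z hz
  refine ⟨a, mem_closure_of_tendsto ha (.of_forall fun j => hz _), φ, hφ, ?_⟩
  rw [tendsto_iff_dist_tendsto_zero] at ha ⊢
  have h2 : Tendsto (fun j => 1 / ((φ j : ℝ) + 1) + dist (z (φ j)) a) atTop (𝓝 (0 + 0)) :=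
    ((tendsto_one_div_add_atTop_nhds_zero_nat (𝕜 := ℝ)).comp hφ.tendsto_atTop).add ha
  rw [add_zero] at h2
  refine squeeze_zero (fun _ => dist_nonneg) (fun j => ?_) h2
  exact (dist_triangle _ (z (φ j)) _).trans (by gcongr; exact (hyz _).le)

theorem Lp_norm_sq (f : Lp ℂ 2 (volume : Measure (Euc n))) : ‖f‖ ^ 2 = ∫ x, ‖f x‖ ^ 2 := by
  rw [Lp.norm_def, (Lp.memLp f).eLpNorm_eq_integral_rpow_norm (by norm_num) (by norm_num)]
  simp only [ENNReal.toReal_ofNat, Real.rpow_ofNat]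
  rw [ENNReal.toReal_ofReal (by positivity), ← Real.rpow_natCast,
    ← Real.rpow_mul (integral_nonneg fun x => by positivity)]
  norm_num

theorem integrable_norm_sq_Lp (f : Lp ℂ 2 (volume : Measure (Euc n))) :
    Integrable fun x => ‖f x‖ ^ 2 :=
  (Lp.memLp f).integrable_norm_pow (by norm_num)

theorem integrable_smul_Lp (φ : 𝓢(Euc n, ℂ)) (f : Lp ℂ 2 (volume : Measure (Euc n))) :
    Integrable fun x => φ x • f x :=
  (φ.memLp 2 volume).integrable_mul (Lp.memLp f)

theorem norm_integral_smul_Lp_le (φ : 𝓢(Euc n, ℂ)) (f : Lp ℂ 2 (volume : Measure (Euc n))) :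
    ∫ x, ‖φ x • f x‖ ≤ ‖φ.toLp 2 (volume : Measure (Euc n))‖ * ‖f‖ := by
  have h := integral_mul_norm_le_Lp_mul_Lq (μ := (volume : Measure (Euc n)))
    (p := 2) (q := 2) (f := φ) (g := f)
    Real.HolderConjugate.two_two (by simpa using φ.memLp 2 volume) (by simpa using Lp.memLp f)
  simp only [Real.rpow_ofNat, ← norm_toLp_sq, ← Lp_norm_sq] at h
  simp only [norm_smul]
  refine h.trans (le_of_eq ?_)
  rw [← Real.sqrt_eq_rpow, ← Real.sqrt_eq_rpow, Real.sqrt_sq (norm_nonneg _),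
    Real.sqrt_sq (norm_nonneg _)]

/-- The tempered distribution `T` is given on the Fourier side by `⟨ξ⟩⁻ˢ H` with `H ∈ L²`. -/
def FourierRep (s : ℝ) (T : 𝓢'(Euc n, ℂ)) (H : Lp ℂ 2 (volume : Measure (Euc n))) : Prop :=
  ∀ φ : 𝓢(Euc n, ℂ), T φ = ∫ ξ, (𝓕⁻ (besselSchwartz (-s) φ) : 𝓢(Euc n, ℂ)) ξ • H ξ

theorem FourierRep.of_bessel {s : ℝ} {T : 𝓢'(Euc n, ℂ)} {h : Lp ℂ 2 (volume : Measure (Euc n))}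
    (hT : TemperedDistribution.besselPotential (Euc n) ℂ s T = h) :
    FourierRep s T (𝓕 h : Lp ℂ 2 (volume : Measure (Euc n))) := fun φ => by
  rw [← Lp.toTemperedDistribution_apply, ← Lp.fourier_toTemperedDistribution_eq, ← hT]
  rw [TemperedDistribution.fourier_apply, FourierTransform.fourier_fourierInv_eq,
    besselPotential_apply_apply, besselSchwartz_neg_cancel]

theorem exists_fourierRep (s : ℝ) (H : Lp ℂ 2 (volume : Measure (Euc n))) :
    ∃ T, FourierRep s T H := by
  refine ⟨TemperedDistribution.besselPotential (Euc n) ℂ (-s)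
    ((𝓕⁻ H : Lp ℂ 2 (volume : Measure (Euc n))) : 𝓢'(Euc n, ℂ)), fun φ => ?_⟩
  rw [← Lp.toTemperedDistribution_apply, besselPotential_apply_apply,
    ← Lp.fourierInv_toTemperedDistribution_eq, TemperedDistribution.fourierInv_apply]

theorem FourierRep.norm_apply_le {s : ℝ} {T : 𝓢'(Euc n, ℂ)}
    {H : Lp ℂ 2 (volume : Measure (Euc n))} (h : FourierRep s T H) (φ : 𝓢(Euc n, ℂ)) :
    ‖T φ‖ ≤ ‖H‖ * hNorm (-s) φ := by
  rw [h φ, integral_mul_eq_inner, ← Lp_norm_star H, hNorm, ← norm_fourierInv_toLp]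
  exact norm_inner_le_norm _ _

theorem FourierRep.sub {s : ℝ} {T T' : 𝓢'(Euc n, ℂ)}
    {H H' : Lp ℂ 2 (volume : Measure (Euc n))} (h : FourierRep s T H) (h' : FourierRep s T' H') :
    FourierRep s (T - T') (H - H') := fun φ => by
  rw [show (T - T') φ = T φ - T' φ from rfl, h φ, h' φ]
  rw [← integral_sub (integrable_smul_Lp _ _) (integrable_smul_Lp _ _)]
  refine integral_congr_ae ?_
  filter_upwards [Lp.coeFn_sub H H'] with ξ hξ
  rw [hξ, Pi.sub_apply, smul_sub]

/-- Lowering the order multiplies the density `H` by `⟨ξ⟩^{s'-s} ≤ 1`. The norm formula displays the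
decay that controls high frequencies. -/
theorem FourierRep.of_le {s s' : ℝ} (hs : s' ≤ s) {T : 𝓢'(Euc n, ℂ)}
    {H : Lp ℂ 2 (volume : Measure (Euc n))} (h : FourierRep s T H) :
    ∃ G : Lp ℂ 2 (volume : Measure (Euc n)), FourierRep s' T G ∧
      ‖G‖ ^ 2 = ∫ ξ, (bracket (s' - s) ξ * ‖H ξ‖) ^ 2 := by
  have hm : MemLp (fun ξ => ((bracket (s' - s) ξ : ℝ) : ℂ) * H ξ) 2 (volume : Measure (Euc n)) := by
    refine (Lp.memLp H).of_le ((Complex.continuous_ofReal.comp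
      (continuous_bracket _)).aestronglyMeasurable.mul (Lp.aestronglyMeasurable H)) (.of_forall fun ξ => ?_)
    rw [norm_mul, Complex.norm_real, Real.norm_of_nonneg (bracket_pos _ _).le]
    have := bracket_mono (show s' - s ≤ 0 by linarith) ξ
    rw [bracket_zero] at this
    exact mul_le_of_le_one_left (norm_nonneg _) this
  refine ⟨hm.toLp, fun φ => ?_, ?_⟩
  · rw [h φ]
    refine integral_congr_ae ?_
    filter_upwards [hm.coeFn_toLp] with ξ hξ
    rw [hξ, fourierInv_besselSchwartz, fourierInv_besselSchwartz,
      show -s = -s' + (s' - s) by ring, bracket_add]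
    simp only [smul_eq_mul]
    push_cast; ring
  · rw [Lp_norm_sq]
    refine integral_congr_ae ?_
    filter_upwards [hm.coeFn_toLp] with ξ hξ
    rw [hξ, norm_mul, Complex.norm_real, Real.norm_of_nonneg (bracket_pos _ _).le]

/-- The kernel `ζ ↦ ⟨ζ⟩⁻ˢ ĝ(ζ - η)` of multiplication by `g` on the Fourier side. -/
def mulKernel (s : ℝ) (g : 𝓢(Euc n, ℂ)) (η : Euc n) : 𝓢(Euc n, ℂ) :=
  SchwartzMap.smulLeftCLM ℂ (fun x : Euc n => ((bracket (-s) x : ℝ) : ℂ))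
    (SchwartzMap.compSubConstCLM ℂ η (𝓕⁻ g : 𝓢(Euc n, ℂ)))

theorem mulKernel_apply (s : ℝ) (g : 𝓢(Euc n, ℂ)) (η ζ : Euc n) :
    mulKernel s g η ζ = (bracket (-s) ζ : ℂ) * (𝓕⁻ g : 𝓢(Euc n, ℂ)) (ζ - η) := by
  rw [mulKernel, SchwartzMap.smulLeftCLM_apply_apply (hasTemperateGrowth_bracket (-s)),
    SchwartzMap.compSubConstCLM_apply, smul_eq_mul]

/-- Peetre's inequality moves the weight from `ζ` to `η` at the price of `⟨ζ - η⟩^{|s|}`, which the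
rapidly decreasing `𝓕⁻ g` absorbs. The kernels are thus bounded in `L²` locally uniformly in `η`. -/
theorem norm_mulKernel_le (s : ℝ) (g : 𝓢(Euc n, ℂ)) (η : Euc n) :
    ‖(mulKernel s g η).toLp 2 (volume : Measure (Euc n))‖ ≤
      2 ^ (|s| / 2) * hNorm |s| g * bracket (-s) η := by
  have hb := bracket_pos (-s) η
  refine le_of_sq_le_sq ?_ (by have := hNorm_nonneg |s| g; positivity)
  rw [norm_toLp_sq, mul_pow, mul_pow, hNorm_sq,
    ← integral_sub_right_eq_self (fun ξ => (bracket |s| ξ * ‖(𝓕⁻ g : 𝓢(Euc n, ℂ)) ξ‖) ^ 2) η,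
    ← integral_const_mul, ← integral_mul_const]
  refine integral_mono_of_nonneg (.of_forall fun ζ => by positivity)
    ((((integrable_hNorm |s| g).comp_sub_right η).const_mul _).mul_const _) (.of_forall fun ζ => ?_)
  simp only
  rw [← mul_pow, ← mul_pow, mulKernel_apply, norm_mul, Complex.norm_real,
    Real.norm_of_nonneg (bracket_pos _ _).le]
  refine pow_le_pow_left₀ (mul_nonneg (bracket_pos _ _).le (norm_nonneg _)) ?_ 2
  have := bracket_add_le (-s) (ζ - η) η
  rw [sub_add_cancel, abs_neg] at this
  calc _ ≤ (2 ^ (|s| / 2) * bracket |s| (ζ - η) * bracket (-s) η) *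
        ‖(𝓕⁻ g : 𝓢(Euc n, ℂ)) (ζ - η)‖ := by gcongr
    _ = _ := by ring

/-- On the Fourier side `g T = T` is a reproducing identity: `H` is almost everywhere given by
pairings of `H` with Schwartz functions. It turns weak convergence into pointwise convergence, and
this is the only way in which compact support enters Rellich's theorem. -/
theorem FourierRep.ae_eq {s : ℝ} {g : 𝓢(Euc n, ℂ)} {T : 𝓢'(Euc n, ℂ)}
    (hg : ∀ φ, T (mulSchwartz g φ) = T φ)
    {H : Lp ℂ 2 (volume : Measure (Euc n))} (h : FourierRep s T H) :
    ∀ᵐ η, (bracket (-s) η : ℂ) * H η = ∫ ζ, mulKernel s g η ζ • H ζ := by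
  have hmeas : AEStronglyMeasurable (fun p : Euc n × Euc n => mulKernel s g p.1 p.2 • H p.2)
      ((volume : Measure (Euc n)).prod volume) := by
    refine AEStronglyMeasurable.smul (f := fun p : Euc n × Euc n => mulKernel s g p.1 p.2)
      (g := fun p : Euc n × Euc n => H p.2) (Continuous.aestronglyMeasurable ?_)
      (Lp.aestronglyMeasurable H).comp_snd
    simp only [mulKernel_apply]
    exact (Complex.continuous_ofReal.comp ((continuous_bracket _).comp continuous_snd)).mul
      ((𝓕⁻ g : 𝓢(Euc n, ℂ)).continuous.comp (continuous_snd.sub continuous_fst))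
  have hD : AEStronglyMeasurable (fun η => ∫ ζ, mulKernel s g η ζ • H ζ) (volume : Measure (Euc n)) :=
    hmeas.integral_prod_right'
  have hbound : ∀ η, ∫ ζ, ‖mulKernel s g η ζ • H ζ‖ ≤
      2 ^ (|s| / 2) * hNorm |s| g * bracket (-s) η * ‖H‖ := fun η =>
    (norm_integral_smul_Lp_le _ _).trans
      (mul_le_mul_of_nonneg_right (norm_mulKernel_le s g η) (norm_nonneg _))
  have hcont : Continuous fun η : Euc n => 2 ^ (|s| / 2) * hNorm |s| g * bracket (-s) η * ‖H‖ := by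
    have := continuous_bracket (n := n) (-s); fun_prop
  -- Both sides are locally integrable, so it suffices to integrate against a test function `ψ`. The
  -- left side gives `T (𝓕 ψ)`; the right side gives `T (g 𝓕 ψ)` after Fubini.
  refine ae_eq_of_integral_contDiff_smul_eq ?_ ?_ fun ψ hψ hψc => ?_
  · have h1 : LocallyIntegrable (H : Euc n → ℂ) :=
      (Lp.memLp H).locallyIntegrable (by norm_num)
    rw [← locallyIntegrableOn_univ] at h1 ⊢
    exact h1.continuousOn_mul (g := fun η => ((bracket (-s) η : ℝ) : ℂ))
      (Complex.continuous_ofReal.comp (continuous_bracket _)).continuousOn isOpen_univ.isLocallyClosed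
  · refine LocallyIntegrable.mono hcont.locallyIntegrable hD (.of_forall fun η => ?_)
    rw [Real.norm_of_nonneg (by have := hNorm_nonneg |s| g; have := bracket_pos (-s) η; positivity)]
    exact (norm_integral_le_integral_norm _).trans (hbound η)
  · set ψ' : 𝓢(Euc n, ℂ) := (hψc.comp_left (g := Complex.ofReal) rfl).toSchwartzMap (Complex.ofRealCLM.contDiff.comp hψ) with hψ'
    have hψa : ∀ x, ψ' x = (ψ x : ℂ) := fun x => rfl
    have e1 : ∫ x, ψ x • ((bracket (-s) x : ℂ) * H x) = T (𝓕 ψ' : 𝓢(Euc n, ℂ)) := by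
      rw [h]
      refine integral_congr_ae (.of_forall fun ξ => ?_)
      simp only [fourierInv_besselSchwartz, FourierTransform.fourierInv_fourier_eq, hψa,
        Complex.real_smul, smul_eq_mul]
      ring
    have hint : Integrable (fun p : Euc n × Euc n => ψ p.1 • mulKernel s g p.1 p.2 • H p.2)
        ((volume : Measure (Euc n)).prod volume) := by
      have hm2 : AEStronglyMeasurable
          (fun p : Euc n × Euc n => ψ p.1 • mulKernel s g p.1 p.2 • H p.2)
          ((volume : Measure (Euc n)).prod volume) :=
        (hψ.continuous.comp continuous_fst).aestronglyMeasurable.smul hmeas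
      rw [integrable_prod_iff hm2]
      refine ⟨.of_forall fun η => (integrable_smul_Lp (mulKernel s g η) H).smul (ψ η), ?_⟩
      have h3 : Integrable fun η : Euc n => ψ η * (2 ^ (|s| / 2) * hNorm |s| g * bracket (-s) η * ‖H‖) :=
        (hψ.continuous.mul hcont).integrable_of_hasCompactSupport hψc.mul_right
      refine h3.norm.mono ?_ (.of_forall fun η => ?_)
      · exact hm2.norm.integral_prod_right'
      · rw [norm_norm, Real.norm_of_nonneg (integral_nonneg fun _ => norm_nonneg _), norm_mul,
          Real.norm_of_nonneg (r := _ * ‖H‖) (by have := hNorm_nonneg |s| g; have := bracket_pos (-s) η; positivity)]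
        simp only [norm_smul (ψ η), integral_const_mul]
        exact mul_le_mul_of_nonneg_left (hbound η) (norm_nonneg _)
    calc _ = T (𝓕 ψ' : 𝓢(Euc n, ℂ)) := e1
      _ = ∫ ζ, (∫ η, ψ η • mulKernel s g η ζ • H ζ) := by
        rw [← hg, h]
        refine integral_congr_ae (.of_forall fun ζ => ?_)
        simp only [fourierInv_besselSchwartz, fourierInv_mulSchwartz, FourierTransform.fourierInv_fourier_eq]
        rw [← integral_sub_left_eq_self _ _ ζ, ← integral_const_mul, ← integral_smul_const]
        refine integral_congr_ae (.of_forall fun η => ?_)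
        simp only [mulKernel_apply, hψa, smul_eq_mul, Complex.real_smul, sub_sub_cancel]
        ring
      _ = ∫ η, (∫ ζ, ψ η • mulKernel s g η ζ • H ζ) := (integral_integral_swap hint).symm
      _ = _ := by simp only [integral_smul]

/-- On a ball, `hae` makes the `H j` converge to zero pointwise with a uniform bound, so dominated
convergence applies. Outside a large ball `⟨ξ⟩^{s'-s}` is small, since `s' < s`, and `‖H j‖ ≤ C`. -/
theorem tendsto_integral_of_weak {s s' C : ℝ} (hs : s' < s) {g : 𝓢(Euc n, ℂ)}
    {H : ℕ → Lp ℂ 2 (volume : Measure (Euc n))} (hC : ∀ j, ‖H j‖ ≤ C)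
    (hae : ∀ j, ∀ᵐ η, (bracket (-s) η : ℂ) * H j η = ∫ ζ, mulKernel s g η ζ • H j ζ)
    (hw : ∀ ψ : 𝓢(Euc n, ℂ), Tendsto (fun j => ∫ ζ, ψ ζ • H j ζ) atTop (𝓝 0)) :
    Tendsto (fun j => ∫ ξ, (bracket (s' - s) ξ * ‖H j ξ‖) ^ 2) atTop (𝓝 0) := by
  have hC0 : 0 ≤ C := (norm_nonneg _).trans (hC 0)
  have hg0 := hNorm_nonneg |s| g
  have hmeas : ∀ j, AEStronglyMeasurable (fun ξ => (bracket (s' - s) ξ * ‖H j ξ‖) ^ 2)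
      (volume : Measure (Euc n)) := fun j =>
    ((continuous_bracket _).aestronglyMeasurable.mul (Lp.aestronglyMeasurable (H j)).norm).pow 2
  have hle1 : ∀ ξ : Euc n, bracket (s' - s) ξ ≤ 1 := fun ξ => by
    simpa using bracket_mono (show s' - s ≤ 0 by linarith) ξ
  have hint : ∀ j, Integrable (fun ξ => (bracket (s' - s) ξ * ‖H j ξ‖) ^ 2) := fun j => by
    refine (integrable_norm_sq_Lp (H j)).mono (hmeas j) (.of_forall fun ξ => ?_)
    rw [Real.norm_of_nonneg (sq_nonneg _), Real.norm_of_nonneg (sq_nonneg _), mul_pow]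
    exact mul_le_of_le_one_left (sq_nonneg _) (pow_le_one₀ (bracket_pos _ _).le (hle1 ξ))
  -- convergence on balls
  have hball : ∀ R : ℝ, Tendsto (fun j => ∫ ξ in Metric.closedBall (0 : Euc n) R,
      (bracket (s' - s) ξ * ‖H j ξ‖) ^ 2) atTop (𝓝 0) := fun R => by
    have hz : (0 : ℝ) = ∫ ξ in Metric.closedBall (0 : Euc n) R, (0 : ℝ) := by simp
    rw [hz]
    refine tendsto_integral_of_dominated_convergence
      (fun η => (bracket s' η * (2 ^ (|s| / 2) * hNorm |s| g * bracket (-s) η * C)) ^ 2)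
      (fun j => (hmeas j).restrict) ?_ (fun j => ?_) ?_
    · refine ContinuousOn.integrableOn_compact (isCompact_closedBall _ _) (Continuous.continuousOn ?_)
      have h1 := continuous_bracket (n := n) (-s)
      have h2 := continuous_bracket (n := n) s'
      fun_prop
    · filter_upwards [ae_restrict_of_ae (hae j)] with η hη
      have hb1 := bracket_pos s' η
      have hb2 := bracket_pos (-s) η
      rw [Real.norm_of_nonneg (sq_nonneg _)]
      refine pow_le_pow_left₀ (mul_nonneg (bracket_pos _ _).le (norm_nonneg _)) ?_ 2
      have h1 : bracket (-s) η * ‖H j η‖ ≤ 2 ^ (|s| / 2) * hNorm |s| g * bracket (-s) η * C := by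
        have : bracket (-s) η * ‖H j η‖ = ‖(bracket (-s) η : ℂ) * H j η‖ := by
          rw [norm_mul, Complex.norm_real, Real.norm_of_nonneg hb2.le]
        rw [this, hη]
        refine (norm_integral_le_integral_norm _).trans ((norm_integral_smul_Lp_le _ _).trans ?_)
        exact mul_le_mul (norm_mulKernel_le s g η) (hC j) (norm_nonneg _) (by positivity)
      rw [sub_eq_add_neg, bracket_add, mul_assoc]
      exact mul_le_mul_of_nonneg_left h1 hb1.le
    · filter_upwards [ae_restrict_of_ae (ae_all_iff.2 hae)] with η hη
      have h1 := (hw (mulKernel s g η)).norm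
      rw [norm_zero] at h1
      have h2 := (h1.const_mul (bracket s' η)).pow 2
      rw [mul_zero, zero_pow two_ne_zero] at h2
      refine h2.congr fun j => ?_
      rw [← hη j, norm_mul, Complex.norm_real, Real.norm_of_nonneg (bracket_pos _ _).le,
        ← mul_assoc, ← bracket_add, sub_eq_add_neg]
  rw [Metric.tendsto_atTop]
  intro ε hε
  obtain ⟨R, hR⟩ : ∃ R : ℝ, ∀ ξ : Euc n, R < ‖ξ‖ → bracket (s' - s) ξ ^ 2 * C ^ 2 ≤ ε / 2 := by
    have h1 : Tendsto (fun r : ℝ => (r ^ (-(s - s') / 2)) ^ 2 * C ^ 2) atTop (𝓝 (0 ^ 2 * C ^ 2)) := by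
      refine Tendsto.mul_const _ (Tendsto.pow ?_ 2)
      simpa only [neg_div] using tendsto_rpow_neg_atTop (show 0 < (s - s') / 2 by linarith)
    rw [zero_pow two_ne_zero, zero_mul] at h1
    obtain ⟨R, hR⟩ := (h1.eventually (gt_mem_nhds (show 0 < ε / 2 by linarith))).exists_forall_of_atTop
    -- The maximum with one ensures `‖ξ‖² ≥ ‖ξ‖ > R`.
    refine ⟨max R 1, fun ξ hξ => ?_⟩
    have hx : R ≤ 1 + ‖ξ‖ ^ 2 := by
      nlinarith [le_max_left R 1, le_max_right R 1]
    have := (hR _ hx).le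
    rwa [neg_sub] at this
  obtain ⟨N, hN⟩ := (Metric.tendsto_atTop.1 (hball R)) (ε / 2) (by linarith)
  refine ⟨N, fun j hj => ?_⟩
  have h1 := hN j hj
  rw [Real.dist_0_eq_abs, abs_of_nonneg (integral_nonneg fun _ => sq_nonneg _)] at h1 ⊢
  rw [← integral_add_compl (Metric.isClosed_closedBall (x := (0 : Euc n)) (ε := R)).measurableSet (hint j)]
  have h2 : ∫ ξ in (Metric.closedBall (0 : Euc n) R)ᶜ, (bracket (s' - s) ξ * ‖H j ξ‖) ^ 2 ≤ ε / 2 := by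
    -- The estimate below divides by `C ^ 2`.
    by_cases hC1 : C = 0
    · have hH : H j = 0 := norm_le_zero_iff.1 ((hC j).trans hC1.le)
      rw [hH]
      refine le_trans (le_of_eq ?_) (show (0 : ℝ) ≤ ε / 2 by linarith)
      refine integral_eq_zero_of_ae (ae_restrict_of_ae ?_)
      filter_upwards [Lp.coeFn_zero ℂ 2 (volume : Measure (Euc n))] with x hx
      simp
    have hCp : 0 < C := lt_of_le_of_ne hC0 (Ne.symm hC1)
    calc _ ≤ ∫ ξ in (Metric.closedBall (0 : Euc n) R)ᶜ, ε / 2 / C ^ 2 * ‖H j ξ‖ ^ 2 := by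
          refine setIntegral_mono_on (hint j).integrableOn
            ((integrable_norm_sq_Lp (H j)).const_mul _).integrableOn
            Metric.isClosed_closedBall.measurableSet.compl fun ξ hξ => ?_
          rw [mul_pow]
          refine mul_le_mul_of_nonneg_right ?_ (sq_nonneg _)
          rw [le_div_iff₀ (by positivity)]
          exact hR ξ (by simpa using hξ)
      _ ≤ ∫ ξ, ε / 2 / C ^ 2 * ‖H j ξ‖ ^ 2 :=
          setIntegral_le_integral ((integrable_norm_sq_Lp (H j)).const_mul _)
            (.of_forall fun ξ => by positivity)
      _ = ε / 2 / C ^ 2 * ‖H j‖ ^ 2 := by rw [integral_const_mul, Lp_norm_sq]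
      _ ≤ ε / 2 / C ^ 2 * C ^ 2 := by
          gcongr; exact hC j
      _ = ε / 2 := by field_simp
  linarith

/-- Sequential Banach–Alaoglu in the dual of the separable space `L²`, transported by Riesz
representation. -/
theorem exists_weak_subseq {C : ℝ} {H : ℕ → Lp ℂ 2 (volume : Measure (Euc n))}
    (hC : ∀ j, ‖H j‖ ≤ C) : ∃ H' : Lp ℂ 2 (volume : Measure (Euc n)), ∃ φ : ℕ → ℕ, StrictMono φ ∧
      ‖H'‖ ≤ C ∧
      ∀ ψ : 𝓢(Euc n, ℂ), Tendsto (fun j => ∫ ζ, ψ ζ • H (φ j) ζ) atTop (𝓝 (∫ ζ, ψ ζ • H' ζ)) := by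
  have : Fact ((2 : ENNReal) ≠ ⊤) := ⟨by norm_num⟩
  let D := InnerProductSpace.toDual ℂ (Lp ℂ 2 (volume : Measure (Euc n)))
  have hK := WeakDual.isSeqCompact_closedBall ℂ (Lp ℂ 2 (volume : Measure (Euc n))) 0 C
  obtain ⟨Λ, hΛ, φ, hφ, hlim⟩ := hK (x := fun j => StrongDual.toWeakDual (D (star (H j)))) fun j => by
    have : ‖D (star (H j))‖ ≤ C := by
      rw [LinearIsometryEquiv.norm_map, Lp_norm_star]; exact hC j
    simpa using this
  have hΛ' : ‖WeakDual.toStrongDual Λ‖ ≤ C := by simpa using hΛ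
  refine ⟨star (D.symm (WeakDual.toStrongDual Λ)), φ, hφ, ?_, fun ψ => ?_⟩
  · rw [Lp_norm_star, LinearIsometryEquiv.norm_map]; exact hΛ'
  · have h1 := ((WeakDual.eval_continuous (𝕜 := ℂ) (ψ.toLp 2 (volume : Measure (Euc n)))).tendsto Λ).comp hlim
    simp only [integral_mul_eq_inner, star_star]
    rw [InnerProductSpace.toDual_symm_apply]
    exact h1

/-- **Rellich's theorem** on `ℝⁿ`, for distributions with `g T = T` for a Schwartz function `g`. -/
theorem isCompact_closure_bessel {s s' : ℝ} (hs : s' < s) (g : 𝓢(Euc n, ℂ)) (C : ℝ) :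
    IsCompact (closure {f : Lp ℂ 2 (volume : Measure (Euc n)) | ∃ T : 𝓢'(Euc n, ℂ),
      (∀ φ, T (mulSchwartz g φ) = T φ) ∧ TemperedDistribution.MemSobolev s 2 T ∧
      sobolevNorm s T ≤ C ∧ TemperedDistribution.besselPotential (Euc n) ℂ s' T = f}) := by
  refine isCompact_closure_of_subseq fun f hf => ?_
  choose T hgT hmem hC hfT using hf
  choose h hh using hmem
  have hH : ∀ j, FourierRep s (T j) (𝓕 (h j) : Lp ℂ 2 (volume : Measure (Euc n))) := fun j =>
    .of_bessel (hh j)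
  have hHC : ∀ j, ‖(𝓕 (h j) : Lp ℂ 2 (volume : Measure (Euc n)))‖ ≤ C := fun j => by
    rw [Lp.norm_fourier_eq, ← sobolevNorm_eq (hh j)]; exact hC j
  obtain ⟨H', φ, hφ, hH'C, hlim⟩ := exists_weak_subseq hHC
  obtain ⟨T', hT'⟩ := exists_fourierRep s H'
  have hlimT : ∀ ψ, Tendsto (fun j => T (φ j) ψ) atTop (𝓝 (T' ψ)) := fun ψ => by
    simp only [hH _ ψ, hT' ψ]
    exact hlim _
  -- The identity `g T = T` survives the weak limit, so the reproducing identity holds for the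
  -- differences `T (φ j) - T'`.
  have hgT' : ∀ ψ, T' (mulSchwartz g ψ) = T' ψ := fun ψ => by
    refine tendsto_nhds_unique (hlimT _) ?_
    simp only [hgT]
    exact hlimT ψ
  have hrep : ∀ j, FourierRep s (T (φ j) - T') (𝓕 (h (φ j)) - H' : Lp ℂ 2 (volume : Measure (Euc n))) :=
    fun j => (hH _).sub hT'
  have hzero := tendsto_integral_of_weak (C := C + C) hs (g := g)
    (H := fun j => (𝓕 (h (φ j)) - H' : Lp ℂ 2 (volume : Measure (Euc n))))
    (fun j => (norm_sub_le _ _).trans (add_le_add (hHC _) hH'C))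
    (fun j => (hrep j).ae_eq fun ψ => by
      change T (φ j) _ - T' _ = T (φ j) _ - T' _
      rw [hgT, hgT'])
    (fun ψ => by
      have h1 := (hlim ψ).sub_const (∫ ζ, ψ ζ • H' ζ)
      rw [sub_self] at h1
      refine h1.congr fun j => ?_
      rw [← integral_sub (integrable_smul_Lp _ _) (integrable_smul_Lp _ _)]
      refine integral_congr_ae ?_
      filter_upwards [Lp.coeFn_sub (𝓕 (h (φ j)) : Lp ℂ 2 (volume : Measure (Euc n))) H'] with ξ hξ
      rw [hξ, Pi.sub_apply, smul_sub])
  obtain ⟨G', hG', -⟩ := hT'.of_le hs.le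
  obtain ⟨f', hf'⟩ := (memSobolev_of_bound (norm_nonneg _) hG'.norm_apply_le).1
  refine ⟨f', φ, hφ, ?_⟩
  rw [tendsto_iff_norm_sub_tendsto_zero]
  have h2 := hzero.sqrt
  rw [Real.sqrt_zero] at h2
  refine squeeze_zero (fun _ => norm_nonneg _) (fun j => ?_) h2
  obtain ⟨G, hG, hGn⟩ := (hrep j).of_le hs.le
  have h3 : TemperedDistribution.besselPotential (Euc n) ℂ s' (T (φ j) - T') =
      (f (φ j) - f' : Lp ℂ 2 (volume : Measure (Euc n))) := by
    rw [← Lp.toTemperedDistributionCLM_apply, map_sub, map_sub, hfT, hf',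
      Lp.toTemperedDistributionCLM_apply, Lp.toTemperedDistributionCLM_apply]
  rw [Function.comp_apply, ← sobolevNorm_eq h3, ← hGn, Real.sqrt_sq (norm_nonneg _)]
  exact (memSobolev_of_bound (norm_nonneg _) hG.norm_apply_le).2

end Rellich
end
end ScaledBG

namespace ScaledBG
noncomputable section
open Filter
open scoped FourierTransform
open FourierTransform

/-! ### Composition with diffeomorphisms -/

section Diffeo
variable {n : ℕ}

/-- Extension by zero of smooth functions which vanish outside of a compact set. -/
theorem contDiff_indicator {F : Type*} [NormedAddCommGroup F] [NormedSpace ℝ F]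
    {Ω K : Set (Euc n)} (hΩ : IsOpen Ω) (hK : IsCompact K) (hKΩ : K ⊆ Ω) {f : Euc n → F}
    (hf : ContDiffOn ℝ ∞ f Ω) (h0 : ∀ x ∈ Ω, x ∉ K → f x = 0) :
    ContDiff ℝ ∞ (Ω.indicator f) ∧ HasCompactSupport (Ω.indicator f) ∧
      tsupport (Ω.indicator f) ⊆ K := by
  have hz : ∀ x, x ∉ K → Ω.indicator f x = 0 := fun x hx => by
    by_cases hxΩ : x ∈ Ω
    · rw [indicator_of_mem hxΩ, h0 x hxΩ hx]
    · exact indicator_of_notMem hxΩ f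
  refine ⟨contDiff_iff_contDiffAt.2 fun x => ?_, .intro hK hz,
    closure_minimal (Function.support_subset_iff'.2 hz) hK.isClosed⟩
  by_cases hx : x ∈ Ω
  · refine (hf.contDiffAt (hΩ.mem_nhds hx)).congr_of_eventuallyEq ?_
    filter_upwards [hΩ.mem_nhds hx] with y hy
    exact indicator_of_mem hy f
  · refine (contDiffAt_const (c := (0 : F))).congr_of_eventuallyEq ?_
    filter_upwards [hK.isClosed.isOpen_compl.mem_nhds fun h => hx (hKΩ h)] with y hy
    exact hz y hy

/-- The determinant is a polynomial in the matrix entries. -/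
theorem contDiff_det : ContDiff ℝ ∞ fun f : Euc n →L[ℝ] Euc n => f.det := by
  have h : ∀ f : Euc n →L[ℝ] Euc n, f.det =
      (LinearMap.toMatrix (EuclideanSpace.basisFun (Fin n) ℝ).toBasis
        (EuclideanSpace.basisFun (Fin n) ℝ).toBasis (f : Euc n →ₗ[ℝ] Euc n)).det := fun f => by
    rw [LinearMap.det_toMatrix]
  simp only [h, Matrix.det_apply, LinearMap.toMatrix_apply]
  refine ContDiff.sum fun σ _ => ContDiff.const_smul _ (contDiff_prod fun i _ => ?_)
  simp only [OrthonormalBasis.coe_toBasis, EuclideanSpace.basisFun_apply,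
    OrthonormalBasis.coe_toBasis_repr_apply, EuclideanSpace.basisFun_repr]
  have h2 : ContDiff ℝ ∞ fun f : Euc n →L[ℝ] Euc n => f (EuclideanSpace.single i 1) :=
    contDiff_id.clm_apply contDiff_const
  exact (contDiff_euclidean.1 h2) _

/-- `Ψ` is a diffeomorphism between open subsets of `ℝⁿ`. -/
def IsDiffeo (Ψ : OpenPartialHomeomorph (Euc n) (Euc n)) : Prop :=
  ContDiffOn ℝ ∞ Ψ Ψ.source ∧ ContDiffOn ℝ ∞ Ψ.symm Ψ.target

theorem IsDiffeo.symm {Ψ : OpenPartialHomeomorph (Euc n) (Euc n)} (h : IsDiffeo Ψ) :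
    IsDiffeo Ψ.symm := ⟨h.2, by simpa using h.1⟩

theorem IsDiffeo.differentiableAt {Ψ : OpenPartialHomeomorph (Euc n) (Euc n)} (h : IsDiffeo Ψ)
    {x : Euc n} (hx : x ∈ Ψ.source) : DifferentiableAt ℝ Ψ x :=
  (h.1.contDiffAt (Ψ.open_source.mem_nhds hx)).differentiableAt (by simp)

theorem IsDiffeo.det_ne_zero {Ψ : OpenPartialHomeomorph (Euc n) (Euc n)} (h : IsDiffeo Ψ)
    {x : Euc n} (hx : x ∈ Ψ.source) : (fderiv ℝ Ψ x).det ≠ 0 := by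
  have h1 : HasFDerivAt (Ψ.symm ∘ Ψ) ((fderiv ℝ Ψ.symm (Ψ x)).comp (fderiv ℝ Ψ x)) x :=
    (h.symm.differentiableAt (Ψ.map_source hx)).hasFDerivAt.comp x (h.differentiableAt hx).hasFDerivAt
  have h2 : HasFDerivAt (Ψ.symm ∘ Ψ) (ContinuousLinearMap.id ℝ (Euc n)) x := by
    refine (hasFDerivAt_id x).congr_of_eventuallyEq ?_
    filter_upwards [Ψ.open_source.mem_nhds hx] with y hy
    exact Ψ.left_inv hy
  have h3 := congrArg (fun f : Euc n →L[ℝ] Euc n => LinearMap.det (f : Euc n →ₗ[ℝ] Euc n)) (h1.unique h2)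
  beta_reduce at h3
  rw [show (((fderiv ℝ Ψ.symm (Ψ x)).comp (fderiv ℝ Ψ x) : Euc n →L[ℝ] Euc n) : Euc n →ₗ[ℝ] Euc n) =
    (fderiv ℝ Ψ.symm (Ψ x) : Euc n →ₗ[ℝ] Euc n) ∘ₗ (fderiv ℝ Ψ x : Euc n →ₗ[ℝ] Euc n) from rfl,
    LinearMap.det_comp, ContinuousLinearMap.coe_id, LinearMap.det_id] at h3
  exact right_ne_zero_of_mul_eq_one h3

/-- The change of variables formula, for test functions. -/
theorem IsDiffeo.exists_transport {Ψ : OpenPartialHomeomorph (Euc n) (Euc n)} (h : IsDiffeo Ψ)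
    {c : Euc n → ℝ} (hc : ContDiff ℝ ∞ c) (hcs : HasCompactSupport c) (hcΨ : tsupport c ⊆ Ψ.target) :
    ∃ b : Euc n → ℝ, ContDiff ℝ ∞ b ∧ HasCompactSupport b ∧ tsupport b ⊆ Ψ.source ∧
      (∀ x ∈ tsupport b, Ψ x ∈ tsupport c) ∧
      (∀ x ∈ Ψ.source, b x = |(fderiv ℝ Ψ x).det| * c (Ψ x)) ∧
      ∀ {F : Type} [NormedAddCommGroup F] [NormedSpace ℝ F] (f : Euc n → F),
        ∫ y, c y • f y = ∫ x, b x • f (Ψ x) := by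
  have hK : IsCompact (Ψ.symm '' tsupport c) :=
    hcs.image_of_continuousOn (Ψ.continuousOn_symm.mono hcΨ)
  have hKΨ : Ψ.symm '' tsupport c ⊆ Ψ.source := by
    rintro _ ⟨y, hy, rfl⟩; exact Ψ.map_target (hcΨ hy)
  -- The transported density is `|det DΨ| (c ∘ Ψ)`, extended by zero. The absolute value stays
  -- smooth because the Jacobian does not vanish.
  have h1 := contDiff_indicator (f := fun x => |(fderiv ℝ Ψ x).det| * c (Ψ x)) Ψ.open_source hK hKΨ
    (by
      refine ContDiffOn.mul (fun x hx => ?_) (hc.comp_contDiffOn h.1)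
      exact ((contDiff_det.comp_contDiffOn (h.1.fderiv_of_isOpen Ψ.open_source (m := ∞) (by simp)) x hx).abs
        (h.det_ne_zero hx)))
    (fun x hx hxK => by
      rw [image_eq_zero_of_notMem_tsupport (f := c), mul_zero]
      exact fun hy => hxK ⟨_, hy, Ψ.left_inv hx⟩)
  refine ⟨_, h1.1, h1.2.1, h1.2.2.trans hKΨ, fun x hx => ?_, fun x hx => indicator_of_mem hx _,
    fun {F} _ _ f => ?_⟩
  · obtain ⟨y, hy, rfl⟩ := h1.2.2 hx
    rwa [Ψ.right_inv (hcΨ hy)]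
  · have e1 : ∫ y, c y • f y = ∫ y in Ψ '' Ψ.source, c y • f y := by
      rw [setIntegral_eq_integral_of_forall_compl_eq_zero]
      intro y hy
      rw [Ψ.image_source_eq_target] at hy
      rw [image_eq_zero_of_notMem_tsupport fun h => hy (hcΨ h), zero_smul]
    rw [e1, integral_image_eq_integral_abs_det_fderiv_smul volume Ψ.open_source.measurableSet
      (fun x hx => (h.differentiableAt hx).hasFDerivAt.hasFDerivWithinAt) Ψ.injOn,
      ← integral_indicator Ψ.open_source.measurableSet]
    refine integral_congr_ae (.of_forall fun x => ?_)
    by_cases hx : x ∈ Ψ.source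
    · simp only [indicator_of_mem hx, mul_smul]
    · simp only [indicator_of_notMem hx, zero_smul]

/-- `a` is a test function on `Ω`. -/
def IsTest (Ω : Set (Euc n)) (a : Euc n → ℝ) : Prop :=
  ContDiff ℝ ∞ a ∧ HasCompactSupport a ∧ tsupport a ⊆ Ω

theorem IsTest.mul_contDiffOn {Ω : Set (Euc n)} (hΩ : IsOpen Ω) {a : Euc n → ℝ} (ha : IsTest Ω a)
    {g : Euc n → ℝ} (hg : ContDiffOn ℝ ∞ g Ω) : IsTest Ω fun x => a x * g x :=
  ⟨contDiff_mul_of_tsupport_subset hΩ ha.1 ha.2.2 hg, ha.2.1.mul_right,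
    (closure_mono (Function.support_mul_subset_left _ _)).trans ha.2.2⟩

theorem IsTest.fderiv_apply {Ω : Set (Euc n)} {a : Euc n → ℝ} (ha : IsTest Ω a) (v : Euc n) :
    IsTest Ω fun x => fderiv ℝ a x v :=
  ⟨(ha.1.fderiv_right (m := ∞) (by simp)).clm_apply contDiff_const, ha.2.1.fderiv_apply (𝕜 := ℝ) v,
    (tsupport_fderiv_apply_subset ℝ v).trans ha.2.2⟩

theorem IsTest.contDiff_smul_comp {Ψ : OpenPartialHomeomorph (Euc n) (Euc n)} (h : IsDiffeo Ψ)
    {a : Euc n → ℝ} (ha : IsTest Ψ.source a) {F : Type*} [NormedAddCommGroup F] [NormedSpace ℝ F]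
    {f : Euc n → F} (hf : ContDiff ℝ ∞ f) : ContDiff ℝ ∞ fun x => a x • f (Ψ x) := by
  have h1 := (contDiff_indicator (f := fun x => a x • f (Ψ x)) Ψ.open_source ha.2.1 ha.2.2
    (ha.1.contDiffOn.smul (hf.comp_contDiffOn h.1))
    (fun x _ hx => by rw [image_eq_zero_of_notMem_tsupport hx, zero_smul])).1
  convert h1 using 1
  ext x
  by_cases hx : x ∈ Ψ.source
  · rw [indicator_of_mem hx]
  · rw [indicator_of_notMem hx, image_eq_zero_of_notMem_tsupport fun h => hx (ha.2.2 h), zero_smul]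

/-- `φ ↦ a (φ ∘ Ψ)` on Schwartz functions, for a diffeomorphism `Ψ` and a cutoff `a`. -/
def pullSchwartz {Ψ : OpenPartialHomeomorph (Euc n) (Euc n)} (h : IsDiffeo Ψ)
    {a : Euc n → ℝ} (ha : IsTest Ψ.source a) (φ : 𝓢(Euc n, ℂ)) : 𝓢(Euc n, ℂ) :=
  HasCompactSupport.toSchwartzMap (f := fun x => a x • φ (Ψ x)) ha.2.1.smul_right
    (ha.contDiff_smul_comp h (φ.smooth ⊤))

@[simp] theorem pullSchwartz_apply {Ψ : OpenPartialHomeomorph (Euc n) (Euc n)} (h : IsDiffeo Ψ)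
    {a : Euc n → ℝ} (ha : IsTest Ψ.source a) (φ : 𝓢(Euc n, ℂ)) (x : Euc n) :
    pullSchwartz h ha φ x = a x • φ (Ψ x) := rfl

theorem IsDiffeo.contDiffOn_fderiv_apply {Ψ : OpenPartialHomeomorph (Euc n) (Euc n)} (h : IsDiffeo Ψ)
    (v : Euc n) (j : Fin n) : ContDiffOn ℝ ∞ (fun x => fderiv ℝ Ψ x v j) Ψ.source :=
  contDiffOn_euclidean.1 ((h.1.fderiv_of_isOpen Ψ.open_source (m := ∞) (by simp)).clm_apply
    contDiffOn_const) j

/-- The derivative is again a sum of operators of the form `φ ↦ a (φ ∘ Ψ)`, with new cutoffs,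
applied to `φ` and its first derivatives. This makes an induction on the order possible. -/
theorem lineDeriv_pullSchwartz {Ψ : OpenPartialHomeomorph (Euc n) (Euc n)} (h : IsDiffeo Ψ)
    {a : Euc n → ℝ} (ha : IsTest Ψ.source a) (φ : 𝓢(Euc n, ℂ)) (v : Euc n) :
    ∂_{v} (pullSchwartz h ha φ) = pullSchwartz h (ha.fderiv_apply v) φ +
      ∑ j : Fin n, pullSchwartz h (ha.mul_contDiffOn Ψ.open_source (h.contDiffOn_fderiv_apply v j))
        (∂_{unitVec j} φ) := by
  ext x
  rw [add_apply, FunLike.coe_sum, Finset.sum_apply]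
  simp only [pullSchwartz_apply, SchwartzMap.lineDerivOp_apply_eq_fderiv]
  by_cases hx : x ∈ Ψ.source
  · have h1 : HasFDerivAt (fun x => φ (Ψ x)) ((fderiv ℝ φ (Ψ x)).comp (fderiv ℝ Ψ x)) x :=
      (φ.differentiableAt (x := Ψ x)).hasFDerivAt.comp x (h.differentiableAt hx).hasFDerivAt
    have h2 := (ha.1.differentiable (by simp) x).hasFDerivAt.smul h1
    have h3 : (pullSchwartz h ha φ : Euc n → ℂ) = a • fun x => φ (Ψ x) := rfl
    have hv : fderiv ℝ Ψ x v = ∑ j, fderiv ℝ Ψ x v j • unitVec j := by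
      simpa using ((EuclideanSpace.basisFun (Fin n) ℝ).sum_repr (fderiv ℝ Ψ x v)).symm
    rw [h3, h2.fderiv]
    simp only [add_apply, smul_apply, ContinuousLinearMap.comp_apply, ContinuousLinearMap.smulRight_apply]
    rw [add_comm]
    congr 1
    conv_lhs => rw [hv, map_sum, Finset.smul_sum]
    refine Finset.sum_congr rfl fun j _ => ?_
    rw [map_smul, smul_smul]
  · have hx' : x ∉ tsupport a := fun h => hx (ha.2.2 h)
    have h0 : a x = 0 := image_eq_zero_of_notMem_tsupport hx'
    have h1 : fderiv ℝ a x = 0 := fderiv_of_notMem_tsupport (𝕜 := ℝ) hx'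
    have h2 : fderiv ℝ (pullSchwartz h ha φ) x = 0 := fderiv_of_notMem_tsupport (𝕜 := ℝ) fun hx2 =>
      hx' (closure_mono (Function.support_smul_subset_left _ _) hx2)
    simp [h0, h1, h2]

theorem hNorm_zero_sq (φ : 𝓢(Euc n, ℂ)) : hNorm 0 φ ^ 2 = ∫ x, ‖φ x‖ ^ 2 := by
  rw [hNorm, besselSchwartz_zero, norm_toLp_sq]

/-- The squared norm integrates `|φ ∘ Ψ|²` against the density `a²`. The change of variables turns
`a²` into a bounded density `b` for `|φ|²`. -/
theorem hNorm_pullSchwartz_zero_le {Ψ : OpenPartialHomeomorph (Euc n) (Euc n)} (h : IsDiffeo Ψ)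
    {a : Euc n → ℝ} (ha : IsTest Ψ.source a) :
    ∃ C, 0 ≤ C ∧ ∀ φ, hNorm 0 (pullSchwartz h ha φ) ≤ C * hNorm 0 φ := by
  have ha2 : IsTest Ψ.source fun x => a x * a x := ha.mul_contDiffOn Ψ.open_source ha.1.contDiffOn
  obtain ⟨b, hb, hbs, hbΨ, -, -, hint⟩ := h.symm.exists_transport ha2.1 ha2.2.1 ha2.2.2
  obtain ⟨C, hC⟩ := hb.continuous.bounded_above_of_compact_support hbs
  have hC0 : 0 ≤ C := (norm_nonneg _).trans (hC 0)
  refine ⟨√C, by positivity, fun φ => le_of_sq_le_sq ?_ (mul_nonneg (by positivity) (hNorm_nonneg _ _))⟩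
  rw [mul_pow, Real.sq_sqrt hC0, hNorm_zero_sq, hNorm_zero_sq, ← integral_const_mul]
  have e1 : ∫ x, ‖pullSchwartz h ha φ x‖ ^ 2 = ∫ y, b y • ‖φ y‖ ^ 2 := by
    have e2 := hint fun x => ‖φ (Ψ x)‖ ^ 2
    have e3 : ∫ x, ‖pullSchwartz h ha φ x‖ ^ 2 = ∫ y, (a y * a y) • ‖φ (Ψ y)‖ ^ 2 := by
      refine integral_congr_ae (.of_forall fun x => ?_)
      simp only [pullSchwartz_apply, norm_smul, mul_pow, Real.norm_eq_abs, sq_abs, smul_eq_mul]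
      ring
    rw [e3, e2]
    refine integral_congr_ae (.of_forall fun y => ?_)
    by_cases hy : y ∈ Ψ.target
    · simp only [Ψ.right_inv hy]
    · have : b y = 0 := image_eq_zero_of_notMem_tsupport fun h => hy (hbΨ h)
      simp [this]
  rw [e1]
  have hi : Integrable fun y => b y • ‖φ y‖ ^ 2 :=
    (hb.continuous.smul (φ.continuous.norm.pow 2)).integrable_of_hasCompactSupport hbs.smul_right
  refine integral_mono hi ((integrable_norm_sq φ).const_mul _) fun y => ?_
  exact mul_le_mul_of_nonneg_right ((le_abs_self _).trans (hC y)) (sq_nonneg _)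

/-- The induction treats all cutoffs at once, since differentiation replaces `a` by `∂ᵢ a` and `a ∂ᵢ
Ψʲ`. -/
theorem hNorm_pullSchwartz_nat_le {Ψ : OpenPartialHomeomorph (Euc n) (Euc n)} (h : IsDiffeo Ψ)
    (m : ℕ) : ∀ {a : Euc n → ℝ} (ha : IsTest Ψ.source a),
    ∃ C, 0 ≤ C ∧ ∀ φ, hNorm m (pullSchwartz h ha φ) ≤ C * hNorm m φ := by
  induction m with
  | zero => intro a ha; simpa using hNorm_pullSchwartz_zero_le h ha
  | succ m ih =>
    intro a ha
    obtain ⟨C0, hC0, h0⟩ := ih ha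
    choose C1 hC1 h1 using fun i : Fin n => ih (ha.fderiv_apply (unitVec i))
    choose C2 hC2 h2 using fun i j : Fin n =>
      ih (ha.mul_contDiffOn Ψ.open_source (h.contDiffOn_fderiv_apply (unitVec i) j))
    refine ⟨C0 + ∑ i, (C1 i + ∑ j, C2 i j * (2 * Real.pi)), ?_, fun φ => ?_⟩
    · have := Real.pi_pos
      exact add_nonneg hC0 (Finset.sum_nonneg fun i _ => add_nonneg (hC1 i)
        (Finset.sum_nonneg fun j _ => mul_nonneg (hC2 i j) (by positivity)))
    · push_cast
      have hm : hNorm m φ ≤ hNorm (m + 1) φ := hNorm_mono (by linarith) φ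
      refine (hNorm_succ_le _ _).trans ?_
      rw [add_mul, Finset.sum_mul]
      refine add_le_add ((h0 φ).trans (mul_le_mul_of_nonneg_left hm hC0))
        (Finset.sum_le_sum fun i _ => ?_)
      rw [lineDeriv_pullSchwartz, add_mul, Finset.sum_mul]
      refine (hNorm_add_le _ _ _).trans (add_le_add ((h1 i φ).trans
        (mul_le_mul_of_nonneg_left hm (hC1 i))) ((hNorm_sum_le _ _ _).trans
          (Finset.sum_le_sum fun j _ => ?_)))
      refine (h2 i j _).trans ?_
      rw [mul_assoc]
      refine mul_le_mul_of_nonneg_left ?_ (hC2 i j)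
      have := hNorm_lineDeriv_le m φ (unitVec j)
      simpa using this

/-- Composition with a diffeomorphism is locally bounded on Sobolev spaces of integer order. -/
theorem exists_hNorm_pullSchwartz_le {Ψ : OpenPartialHomeomorph (Euc n) (Euc n)} (h : IsDiffeo Ψ)
    (m : ℤ) {a : Euc n → ℝ} (ha : IsTest Ψ.source a) :
    ∃ C, 0 ≤ C ∧ ∀ φ, hNorm m (pullSchwartz h ha φ) ≤ C * hNorm m φ := by
  obtain ⟨m, rfl | rfl⟩ := m.eq_nat_or_neg
  · simpa using hNorm_pullSchwartz_nat_le h m ha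
  -- For negative order, duality: the transpose of `φ ↦ a (φ ∘ Ψ)` is `θ ↦ b (θ ∘ Ψ⁻¹)`, an operator
  -- of the same kind, needed in the opposite order.
  obtain ⟨b, hb, hbs, hbΨ, -, -, hint⟩ := h.symm.exists_transport ha.1 ha.2.1 ha.2.2
  have hb' : IsTest Ψ.symm.source b := ⟨hb, hbs, hbΨ⟩
  obtain ⟨C, hC0, hC⟩ := hNorm_pullSchwartz_nat_le h.symm m hb'
  refine ⟨C, hC0, fun φ => hNorm_le_of_pairing (mul_nonneg hC0 (hNorm_nonneg _ _)) fun θ => ?_⟩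
  have e1 : ∫ x, θ x * pullSchwartz h ha φ x = ∫ y, pullSchwartz h.symm hb' θ y * φ y := by
    have e2 := hint fun x => θ x * φ (Ψ x)
    have e3 : ∫ x, θ x * pullSchwartz h ha φ x = ∫ y, a y • (θ y * φ (Ψ y)) := by
      refine integral_congr_ae (.of_forall fun x => ?_)
      simp only [pullSchwartz_apply, mul_smul_comm]
    rw [e3, e2]
    refine integral_congr_ae (.of_forall fun y => ?_)
    by_cases hy : y ∈ Ψ.target
    · simp only [pullSchwartz_apply, Ψ.right_inv hy, smul_mul_assoc]
    · have : b y = 0 := image_eq_zero_of_notMem_tsupport fun h => hy (hbΨ h)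
      simp [this]
  rw [e1]
  refine (norm_integral_mul_le m _ _).trans ?_
  push_cast
  rw [neg_neg]
  calc _ ≤ C * hNorm m θ * hNorm (-m) φ := mul_le_mul_of_nonneg_right (hC θ) (hNorm_nonneg _ _)
    _ = _ := by ring

end Diffeo
end
end ScaledBG

namespace ScaledBG
noncomputable section
open Filter
open scoped FourierTransform
open FourierTransform

/-! ### Real test functions and complex Schwartz functions -/

section Complexify
variable {n : ℕ}

/-- A real-valued test function, as a complex-valued Schwartz function. -/
def IsTest.toSchwartz {Ω : Set (Euc n)} {a : Euc n → ℝ} (ha : IsTest Ω a) : 𝓢(Euc n, ℂ) :=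
  (ha.2.1.comp_left (g := Complex.ofReal) rfl).toSchwartzMap (Complex.ofRealCLM.contDiff.comp ha.1)

@[simp] theorem IsTest.toSchwartz_apply {Ω : Set (Euc n)} {a : Euc n → ℝ} (ha : IsTest Ω a)
    (x : Euc n) : ha.toSchwartz x = (a x : ℂ) := rfl

/-- A function which satisfies `IsTest`, as an element of the space of test functions. -/
def IsTest.toTest {Ω : Opens (Euc n)} {a : Euc n → ℝ} (ha : IsTest (Ω : Set (Euc n)) a) : 𝓓(Ω, ℝ) :=
  ⟨a, ha.1, ha.2.1, ha.2.2⟩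

@[simp] theorem IsTest.toTest_apply {Ω : Opens (Euc n)} {a : Euc n → ℝ}
    (ha : IsTest (Ω : Set (Euc n)) a) (x : Euc n) : ha.toTest x = a x := rfl

theorem isTest {Ω : Opens (Euc n)} (ψ : 𝓓(Ω, ℝ)) : IsTest (Ω : Set (Euc n)) ψ :=
  ⟨ψ.contDiff, ψ.hasCompactSupport, ψ.tsupport_subset⟩

theorem IsTest.mul_contDiff {Ω : Set (Euc n)} {a g : Euc n → ℝ} (ha : IsTest Ω a)
    (hg : ContDiff ℝ ∞ g) : IsTest Ω fun x => a x * g x :=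
  ⟨ha.1.mul hg, ha.2.1.mul_right, (closure_mono (Function.support_mul_subset_left _ _)).trans ha.2.2⟩

theorem cutExtend_apply {Ω : Opens (Euc n)} (χ : 𝓓(Ω, ℝ)) (T : 𝓓'(Ω, ℂ)) (φ : 𝓢(Euc n, ℂ)) :
    cutExtend χ T φ = T (cutSchwartz χ (SchwartzMap.postcompCLM Complex.reCLM φ)) +
      Complex.I * T (cutSchwartz χ (SchwartzMap.postcompCLM Complex.imCLM φ)) := rfl

/-- Distributions act on real test functions only, so `cutExtend` splits `φ` into real and imaginary
parts. Here any pair of test functions representing the two parts of `χ φ` may be used. -/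
theorem cutExtend_eq {Ω : Opens (Euc n)} (χ : 𝓓(Ω, ℝ)) (T : 𝓓'(Ω, ℂ)) {φ : 𝓢(Euc n, ℂ)}
    {ψ₁ ψ₂ : 𝓓(Ω, ℝ)} (h : ∀ x, (χ x : ℂ) * φ x = ψ₁ x + ψ₂ x * Complex.I) :
    cutExtend χ T φ = T ψ₁ + Complex.I * T ψ₂ := by
  rw [cutExtend_apply]
  congr 3
  · ext x; simpa using congrArg Complex.re (h x)
  · ext x; simpa using congrArg Complex.im (h x)

theorem cutExtend_eq_real {Ω : Opens (Euc n)} (χ : 𝓓(Ω, ℝ)) (T : 𝓓'(Ω, ℂ)) {φ : 𝓢(Euc n, ℂ)}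
    {ψ : 𝓓(Ω, ℝ)} (h : ∀ x, (χ x : ℂ) * φ x = ψ x) : cutExtend χ T φ = T ψ := by
  rw [cutExtend_eq χ T (ψ₁ := ψ) (ψ₂ := 0) (fun x => by simp [h]), map_zero, mul_zero, add_zero]

/-- `cutExtend χ T` only depends on the values of Schwartz functions on the support of `χ`. -/
theorem cutExtend_congr {Ω : Opens (Euc n)} (χ : 𝓓(Ω, ℝ)) (T : 𝓓'(Ω, ℂ)) {φ φ' : 𝓢(Euc n, ℂ)}
    (h : ∀ x, χ x ≠ 0 → φ x = φ' x) : cutExtend χ T φ = cutExtend χ T φ' := by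
  rw [cutExtend_apply χ T φ']
  refine cutExtend_eq χ T fun x => ?_
  by_cases hx : χ x = 0
  · simp [hx]
  · rw [h x hx]
    apply Complex.ext <;> simp

theorem exists_isTest_eq_one {Ω K : Set (Euc n)} (hΩ : IsOpen Ω) (hK : IsCompact K) (hKΩ : K ⊆ Ω) :
    ∃ θ : Euc n → ℝ, IsTest Ω θ ∧ ∀ x ∈ K, θ x = 1 := by
  obtain ⟨V, hVo, hKV, hVΩ, hVc⟩ := exists_open_between_and_isCompact_closure hK hΩ hKΩ
  obtain ⟨η, hη, -, hηs, hη1⟩ := exists_contMDiff_support_eq_eq_one_iff (𝓡 n) (n := ⊤)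
    hVo hK.isClosed hKV
  have hts : tsupport η = closure V := by rw [tsupport, hηs]
  refine ⟨η, ⟨hη.contDiff.of_le (by simp), ?_, hts ▸ hVΩ⟩, fun x hx => (hη1 x).1 hx⟩
  rw [HasCompactSupport, hts]; exact hVc

/-- A smooth partition of unity by test functions on a compact set. -/
theorem exists_isTest_partition {ι : Type*} {K : Set (Euc n)} (hK : IsCompact K)
    {O : ι → Set (Euc n)} (hO : ∀ i, IsOpen (O i)) (hKO : K ⊆ ⋃ i, O i) :
    ∃ (t : Finset ι) (c : ι → Euc n → ℝ), (∀ i, IsTest (O i) (c i)) ∧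
      ∀ x ∈ K, ∑ i ∈ t, c i x = 1 := by
  classical
  obtain ⟨t, ht⟩ := hK.elim_finite_subcover O hO hKO
  obtain ⟨f, hf⟩ := SmoothPartitionOfUnity.exists_isSubordinate (𝓡 n) hK.isClosed
    (fun i : t => O i) (fun i => hO i) (by simpa [iUnion_subtype] using ht)
  -- Members of the partition of unity need not have compact support; the factor `θ`, equal to one
  -- on `K`, provides it.
  obtain ⟨θ, hθ, hθ1⟩ := exists_isTest_eq_one isOpen_univ hK (subset_univ _)
  refine ⟨t, fun i x => if h : i ∈ t then θ x * f ⟨i, h⟩ x else 0, fun i => ?_, fun x hx => ?_⟩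
  · by_cases h : i ∈ t
    · simp only [h, dif_pos]
      refine ⟨hθ.1.mul ((f ⟨i, h⟩).contMDiff.contDiff), hθ.2.1.mul_right,
        (closure_mono (Function.support_mul_subset_right _ _)).trans (hf ⟨i, h⟩)⟩
    · simp only [h]
      exact ⟨contDiff_const, HasCompactSupport.zero, by simp [tsupport]⟩
  · have h1 := f.sum_eq_one hx
    rw [finsum_eq_sum_of_fintype] at h1
    rw [← Finset.sum_attach, ← h1]
    exact Finset.sum_congr rfl fun i _ => by simp [i.2, hθ1 x hx]

/-- The inclusion `𝓓_K → 𝓢`, as a linear map. -/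
def supportedToSchwartzLM (K : Compacts (Euc n)) : 𝓓_{K}(Euc n, ℝ) →ₗ[ℝ] 𝓢(Euc n, ℂ) where
  toFun ψ := IsTest.toSchwartz (Ω := univ) ⟨ψ.contDiff, ψ.hasCompactSupport, subset_univ _⟩
  map_add' ψ ψ' := by
    ext x
    change ((ψ x + ψ' x : ℝ) : ℂ) = (ψ x : ℂ) + ψ' x
    push_cast; rfl
  map_smul' c ψ := by
    ext x
    change ((c * ψ x : ℝ) : ℂ) = c • (ψ x : ℂ)
    simp

/-- The inclusion `𝓓_K → 𝓢`. -/
def supportedToSchwartz (K : Compacts (Euc n)) : 𝓓_{K}(Euc n, ℝ) →L[ℝ] 𝓢(Euc n, ℂ) where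
  toLinearMap := supportedToSchwartzLM K
  cont := by
    refine WithSeminorms.continuous_of_isBounded (ContDiffMapSupportedIn.withSeminorms ℝ (Euc n) ℝ ⊤ K)
      (schwartz_withSeminorms ℝ (Euc n) ℂ) (supportedToSchwartzLM K) (.of_real fun p => ?_)
    obtain ⟨R, hR⟩ := K.isCompact.isBounded.exists_norm_le
    refine ⟨{p.2}, |R| ^ p.1, fun ψ => ?_⟩
    have h0 : 0 ≤ ContDiffMapSupportedIn.seminorm ℝ (Euc n) ℝ ⊤ K p.2 ψ := apply_nonneg _ _
    refine SchwartzMap.seminorm_le_bound ℝ p.1 p.2 _ (by positivity) fun x => ?_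
    simp only [Finset.sup_singleton]
    have h2 : ‖iteratedFDeriv ℝ p.2 (fun x => (ψ x : ℂ)) x‖ = ‖iteratedFDeriv ℝ p.2 ψ x‖ :=
      Complex.ofRealLI.norm_iteratedFDeriv_comp_left (ψ.contDiff.contDiffAt) (by exact_mod_cast le_top)
    change ‖x‖ ^ p.1 * ‖iteratedFDeriv ℝ p.2 (fun x => (ψ x : ℂ)) x‖ ≤ _
    rw [h2]
    by_cases hx : x ∈ K
    · exact mul_le_mul (pow_le_pow_left₀ (norm_nonneg _) ((hR x hx).trans (le_abs_self _)) _)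
        (ContDiffMapSupportedIn.norm_iteratedFDeriv_apply_le_seminorm_top ℝ) (norm_nonneg _) (by positivity)
    · have h3 : iteratedFDeriv ℝ p.2 ψ x = 0 := ψ.iteratedFDeriv_zero_on_compl hx
      rw [h3, norm_zero, mul_zero]
      positivity

end Complexify

/-! ### Distributions on `M` and their localizations to the unit cells -/

section Charts
variable {n : ℕ} {M : Type*} [TopologicalSpace M] [ChartedSpace (Euc n) M]

/-- The change of coordinates `e' ∘ e⁻¹`. -/
abbrev chartChange (e e' : Chart n M) : OpenPartialHomeomorph (Euc n) (Euc n) := e.1.symm.trans e'.1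

theorem chartChange_source (e e' : Chart n M) :
    (chartChange e e').source = e.1.target ∩ e.1.symm ⁻¹' e'.1.source := by
  simp [chartChange]

theorem Dist.coord_eq (u : Dist n M) {e : Chart n M} {ψ : 𝓓(e.range, ℝ)} {e' : Chart n M}
    {ψ' : 𝓓(e'.range, ℝ)} (h : SameDensity e ψ e' ψ') : u.1 e ψ = u.1 e' ψ' := u.2 e ψ e' ψ' h

theorem chartChange_contDiffOn (e e' : Chart n M) :
    ContDiffOn ℝ ∞ (chartChange e e') (chartChange e e').source := by
  rw [chartChange_source]
  refine ContMDiffOn.contDiffOn ?_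
  exact (contMDiffOn_of_mem_maximalAtlas e'.2).comp
    ((contMDiffOn_symm_of_mem_maximalAtlas e.2).mono inter_subset_left) fun x hx => hx.2

theorem isDiffeo_chartChange (e e' : Chart n M) : IsDiffeo (chartChange e e') := by
  refine ⟨chartChange_contDiffOn e e', ?_⟩
  have h := chartChange_contDiffOn e' e
  simpa [chartChange, OpenPartialHomeomorph.trans_symm_eq_symm_trans_symm] using h

end Charts

namespace ScaledBGStructure
variable {n : ℕ} {M : Type*} [TopologicalSpace M] [ChartedSpace (Euc n) M] {A : Type*}
variable (B : ScaledBGStructure n M A)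

/-- The distribution `(φ_α)_* (χ_α u)`. -/
def cut (χ : 𝓓(cube n 2, ℝ)) (α : A) : Dist n M →ₗ[ℂ] 𝓢'(Euc n, ℂ) :=
  cutExtend (B.cutoff χ α) ∘ₗ LinearMap.proj (B.chart α) ∘ₗ Dist.coord n M

theorem cut_apply (χ : 𝓓(cube n 2, ℝ)) (α : A) (u : Dist n M) :
    B.cut χ α u = cutExtend (B.cutoff χ α) (u.1 (B.chart α)) := rfl

theorem cutoff_apply (χ : 𝓓(cube n 2, ℝ)) (α : A) (x : Euc n) : B.cutoff χ α x = χ x := rfl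

theorem range_chart (α : A) : ((B.chart α).range : Set (Euc n)) = cube n 2 := by
  rw [B.chart_range]

theorem target_chart (α : A) : (B.chart α).1.target = cube n 2 := B.range_chart α

/-- In every chart, a distribution is locally determined by its localizations to the unit cells. -/
theorem exists_coord_eq_sum {χ : 𝓓(cube n 2, ℝ)} (hχ : ∀ x : Euc n, (∀ i, |x i| ≤ 1) → χ x = 1)
    (e : Chart n M) {K : Set (Euc n)} (hK : IsCompact K) (hKe : K ⊆ e.1.target) :
    ∃ (t : Finset A) (a : A → Euc n → ℝ)
      (ha : ∀ α, IsTest (chartChange (B.chart α) e).source (a α)),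
      (∀ α, tsupport (a α) ⊆ cube n 1) ∧ ∀ (u : Dist n M) (ψ : 𝓓(e.range, ℝ)), tsupport ψ ⊆ K →
        u.1 e ψ = ∑ α ∈ t, B.cut χ α u
          (pullSchwartz (isDiffeo_chartChange (B.chart α) e) (ha α) (isTest ψ).toSchwartz) := by
  -- The preimages of `(-1,1)ⁿ` already cover `M`, so `K` can be partitioned by their images in `e`.
  -- On these cubes `χ = 1`, and the localization coincides with the distribution.
  have hOe : ∀ α, IsOpen ((chartChange (B.chart α) e).target ∩
      (chartChange (B.chart α) e).symm ⁻¹' (cube n 1)) := fun α =>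
    (chartChange (B.chart α) e).isOpen_inter_preimage_symm (cube n 1).isOpen
  obtain ⟨t, c, hc, hc1⟩ := exists_isTest_partition hK hOe (fun y hy => by
    obtain ⟨α, hα, hα1⟩ := B.cover (e.1.symm y)
    refine mem_iUnion.2 ⟨α, ?_, ?_⟩
    · simp [chartChange, hKe hy, hα]
    · simpa [chartChange] using hα1)
  have hcT : ∀ α, tsupport (c α) ⊆ (chartChange (B.chart α) e).target := fun α =>
    (hc α).2.2.trans inter_subset_left
  choose a ha has haΨ hac hav hint using fun α =>
    (isDiffeo_chartChange (B.chart α) e).exists_transport (hc α).1 (hc α).2.1 (hcT α)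
  have haT : ∀ α, IsTest (chartChange (B.chart α) e).source (a α) := fun α => ⟨ha α, has α, haΨ α⟩
  have ha1 : ∀ α, tsupport (a α) ⊆ cube n 1 := fun α x hx => by
    have h1 := ((hc α).2.2 (hac α x hx)).2
    rwa [mem_preimage, OpenPartialHomeomorph.left_inv _ (haΨ α hx)] at h1
  refine ⟨t, a, haT, ha1, fun u ψ hψ => ?_⟩
  have hcψ : ∀ α, IsTest (e.range : Set (Euc n)) fun x => ψ x * c α x := fun α =>
    (isTest ψ).mul_contDiff (hc α).1
  have e1 : ψ = ∑ α ∈ t, (hcψ α).toTest := by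
    ext x
    rw [FunLike.coe_sum, Finset.sum_apply]
    simp only [IsTest.toTest_apply, ← Finset.mul_sum]
    by_cases hx : x ∈ K
    · rw [hc1 x hx, mul_one]
    · rw [image_eq_zero_of_notMem_tsupport fun h => hx (hψ h), zero_mul]
  conv_lhs => rw [e1, map_sum]
  refine Finset.sum_congr rfl fun α _ => ?_
  have hsub : (chartChange (B.chart α) e).source ⊆ (B.chart α).range := by
    rw [chartChange_source]; exact inter_subset_left
  have hψ' : IsTest ((B.chart α).range : Set (Euc n)) fun x => a α x * ψ (chartChange (B.chart α) e x) :=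
    ⟨(haT α).contDiff_smul_comp (isDiffeo_chartChange (B.chart α) e) ψ.contDiff, (has α).mul_right,
      (closure_mono (Function.support_mul_subset_left _ _)).trans ((haΨ α).trans hsub)⟩
  rw [u.coord_eq (e' := B.chart α) (ψ' := hψ'.toTest) fun g => ?_]
  · refine (cutExtend_eq_real _ _ fun x => ?_).symm
    rw [cutoff_apply, pullSchwartz_apply, IsTest.toSchwartz_apply, IsTest.toTest_apply]
    by_cases hx : x ∈ tsupport (a α)
    · rw [hχ x fun i => (ha1 α hx i).le]
      simp
    · simp [image_eq_zero_of_notMem_tsupport hx]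
  · have h1 := hint α fun y => g (e.1.symm y) * ψ y
    calc _ = ∫ y, c α y • (g (e.1.symm y) * ψ y) := by
          refine integral_congr_ae (.of_forall fun y => ?_)
          simp only [IsTest.toTest_apply, smul_eq_mul]; ring
      _ = _ := h1
      _ = _ := by
          refine integral_congr_ae (.of_forall fun x => ?_)
          simp only [IsTest.toTest_apply, smul_eq_mul]
          by_cases hx : x ∈ (chartChange (B.chart α) e).source
          · have h2 : e.1.symm (chartChange (B.chart α) e x) = (B.chart α).1.symm x := by
              rw [chartChange_source] at hx
              exact e.1.left_inv hx.2
            rw [h2]; ring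
          · have h0 : a α x = 0 := image_eq_zero_of_notMem_tsupport fun h => hx (haΨ α h)
            simp [h0]

/-- Pointwise limits of bounded sequences of distributions are distributions. -/
theorem exists_dist_limit {χ : 𝓓(cube n 2, ℝ)} (hχ : ∀ x : Euc n, (∀ i, |x i| ≤ 1) → χ x = 1)
    {u : ℕ → Dist n M} (m : ℤ)
    (hb : ∀ α, ∃ C, ∀ j φ, ‖B.cut χ α (u j) φ‖ ≤ C * hNorm m φ)
    (hl : ∀ α φ, ∃ z, Tendsto (fun j => B.cut χ α (u j) φ) atTop (𝓝 z)) :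
    ∃ u' : Dist n M, ∀ (e : Chart n M) (ψ : 𝓓(e.range, ℝ)),
      Tendsto (fun j => (u j).1 e ψ) atTop (𝓝 (u'.1 e ψ)) := by
  have h1 : ∀ (e : Chart n M) (ψ : 𝓓(e.range, ℝ)), ∃ z, Tendsto (fun j => (u j).1 e ψ) atTop (𝓝 z) := by
    intro e ψ
    obtain ⟨t, a, ha, -, h⟩ := B.exists_coord_eq_sum hχ e ψ.hasCompactSupport ψ.tsupport_subset
    choose z hz using hl
    refine ⟨∑ α ∈ t, z α (pullSchwartz (isDiffeo_chartChange (B.chart α) e) (ha α)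
      (isTest ψ).toSchwartz), ?_⟩
    simp only [h _ ψ subset_rfl]
    exact tendsto_finsetSum _ fun α _ => hz α _
  choose z hz using h1
  -- On test functions supported in a fixed compact set, the sequence is bounded by one Sobolev norm
  -- of integer order, uniformly in `j`. The bound passes to the limit and makes `z e` continuous on
  -- each `𝓓_K`.
  have h2 : ∀ (e : Chart n M) (K : Compacts (Euc n)), (K : Set (Euc n)) ⊆ e.1.target →
      ∃ C, ∀ (j : ℕ) (ψ : 𝓓(e.range, ℝ)), tsupport ψ ⊆ K →
        ‖(u j).1 e ψ‖ ≤ C * hNorm m (isTest ψ).toSchwartz := by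
    intro e K hKe
    obtain ⟨t, a, ha, -, h⟩ := B.exists_coord_eq_sum hχ e K.isCompact hKe
    choose C hC using hb
    choose D hD0 hD using fun α => exists_hNorm_pullSchwartz_le (isDiffeo_chartChange (B.chart α) e) m (ha α)
    refine ⟨∑ α ∈ t, |C α| * D α, fun j ψ hψ => ?_⟩
    rw [h _ ψ hψ, Finset.sum_mul]
    refine (norm_sum_le _ _).trans (Finset.sum_le_sum fun α _ => (hC α j _).trans ?_)
    calc _ ≤ |C α| * (D α * hNorm m (isTest ψ).toSchwartz) :=
          mul_le_mul (le_abs_self _) (hD α _) (hNorm_nonneg _ _) (abs_nonneg _)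
      _ = _ := by ring
  have hadd : ∀ (e : Chart n M) (ψ ψ' : 𝓓(e.range, ℝ)), z e (ψ + ψ') = z e ψ + z e ψ' :=
    fun e ψ ψ' => by
      refine tendsto_nhds_unique (hz e _) ?_
      simp only [map_add]
      exact (hz e ψ).add (hz e ψ')
  have hsmul : ∀ (e : Chart n M) (c : ℝ) (ψ : 𝓓(e.range, ℝ)), z e (c • ψ) = c • z e ψ :=
    fun e c ψ => by
      refine tendsto_nhds_unique (hz e _) ?_
      simp only [map_smul]
      exact (hz e ψ).const_smul c
  have hcont : ∀ (e : Chart n M) (K : Compacts (Euc n)) (hK : (K : Set (Euc n)) ⊆ e.range),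
      Continuous (z e ∘ TestFunction.ofSupportedIn hK) := fun e K hK => by
    obtain ⟨C, hC⟩ := h2 e K hK
    let Φ : 𝓓_{K}(Euc n, ℝ) →+ ℂ :=
      { toFun := z e ∘ TestFunction.ofSupportedIn hK
        map_zero' := by
          have := hsmul e 0 (TestFunction.ofSupportedIn hK 0)
          rw [zero_smul, zero_smul] at this
          exact this
        map_add' := fun ψ ψ' => hadd e (TestFunction.ofSupportedIn hK ψ) (TestFunction.ofSupportedIn hK ψ') }
    have hΦ : ∀ ψ, ‖Φ ψ‖ ≤ C * hNorm m (supportedToSchwartz K ψ) := fun ψ =>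
      le_of_tendsto (hz e _).norm (.of_forall fun j => hC j _ ψ.tsupport_subset)
    change Continuous Φ
    refine continuous_of_continuousAt_zero Φ ?_
    rw [ContinuousAt, map_zero]
    have h3 : Continuous fun ψ => C * hNorm m (supportedToSchwartz K ψ) := by
      simp only [hNorm_eq_seminorm]
      exact continuous_const.mul ((ContinuousLinearMap.continuous _).comp
        (supportedToSchwartz K).continuous).norm
    have h4 := h3.tendsto 0
    simp only [map_zero, hNorm_eq_seminorm, norm_zero, mul_zero] at h4
    exact squeeze_zero_norm hΦ (by simpa only [hNorm_eq_seminorm] using h4)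
  refine ⟨⟨fun e => (TestFunction.mkCLM ℝ (z e) (hadd e) (hsmul e) (hcont e) : 𝓓(e.range, ℝ) →L[ℝ] ℂ), fun e ψ e' ψ' h => ?_⟩, fun e ψ => hz e ψ⟩
  refine tendsto_nhds_unique (hz e ψ) ?_
  simp only [(u _).2 e ψ e' ψ' h]
  exact hz e' ψ'

end ScaledBGStructure
end
end ScaledBG

namespace ScaledBG
noncomputable section
open Filter
open scoped FourierTransform
open FourierTransform

/-! ### Uniformly bounded families of smooth functions -/

section UnifBdd
variable {n : ℕ} {ι : Type*} {F G : Type*} [NormedAddCommGroup F] [NormedSpace ℝ F]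
  [NormedAddCommGroup G] [NormedSpace ℝ G]

/-- A family of smooth functions on open sets, which is bounded together with all derivatives. -/
structure UnifBdd (Ω : ι → Set (Euc n)) (f : ι → Euc n → F) : Prop where
  isOpen : ∀ i, IsOpen (Ω i)
  contDiffOn : ∀ i, ContDiffOn ℝ ∞ (f i) (Ω i)
  bound : ∀ k : ℕ, ∃ C : ℝ, ∀ i, ∀ x ∈ Ω i, ‖iteratedFDeriv ℝ k (f i) x‖ ≤ C

theorem UnifBdd.contDiffAt {Ω : ι → Set (Euc n)} {f : ι → Euc n → F} (hf : UnifBdd Ω f) {i : ι}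
    {x : Euc n} (hx : x ∈ Ω i) : ContDiffAt ℝ ∞ (f i) x :=
  (hf.contDiffOn i).contDiffAt ((hf.isOpen i).mem_nhds hx)

theorem UnifBdd.exists_bound {Ω : ι → Set (Euc n)} {f : ι → Euc n → F} (hf : UnifBdd Ω f) (k : ℕ) :
    ∃ C : ℝ, 0 ≤ C ∧ ∀ l ≤ k, ∀ i, ∀ x ∈ Ω i, ‖iteratedFDeriv ℝ l (f i) x‖ ≤ C := by
  choose C hC using hf.bound
  refine ⟨∑ l ∈ Finset.range (k + 1), |C l|, by positivity, fun l hl i x hx => (hC l i x hx).trans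
    ((le_abs_self _).trans (Finset.single_le_sum (f := fun l => |C l|) (fun _ _ => abs_nonneg _)
      (Finset.mem_range.2 (by omega))))⟩

theorem UnifBdd.congr {Ω : ι → Set (Euc n)} {f g : ι → Euc n → F} (hf : UnifBdd Ω f)
    (h : ∀ i, EqOn (g i) (f i) (Ω i)) : UnifBdd Ω g :=
  ⟨hf.isOpen, fun i => (hf.contDiffOn i).congr (h i), fun k => by
    obtain ⟨C, hC⟩ := hf.bound k
    refine ⟨C, fun i x hx => ?_⟩
    have h1 : g i =ᶠ[𝓝 x] f i := (h i).eventuallyEq_of_mem ((hf.isOpen i).mem_nhds hx)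
    rw [(h1.iteratedFDeriv ℝ k).eq_of_nhds]
    exact hC i x hx⟩

theorem UnifBdd.mul {Ω : ι → Set (Euc n)} {f g : ι → Euc n → ℝ} (hf : UnifBdd Ω f)
    (hg : UnifBdd Ω g) : UnifBdd Ω fun i x => f i x * g i x := by
  refine ⟨hf.isOpen, fun i => (hf.contDiffOn i).mul (hg.contDiffOn i), fun k => ?_⟩
  obtain ⟨C, hC0, hC⟩ := hf.exists_bound k
  obtain ⟨D, hD0, hD⟩ := hg.exists_bound k
  refine ⟨∑ l ∈ Finset.range (k + 1), (k.choose l : ℝ) * C * D, fun i x hx => ?_⟩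
  have h := norm_iteratedFDerivWithin_mul_le (hf.contDiffOn i) (hg.contDiffOn i)
    (hf.isOpen i).uniqueDiffOn hx (n := k) (by exact_mod_cast le_top)
  simp only [iteratedFDerivWithin_of_isOpen _ (hf.isOpen i) hx] at h
  refine h.trans (Finset.sum_le_sum fun l hl => ?_)
  have hl' := Finset.mem_range.1 hl
  gcongr
  · exact hC l (by omega) i x hx
  · exact hD (k - l) (by omega) i x hx

theorem UnifBdd.sum {κ : Type*} {S : Finset κ} {Ω : ι → Set (Euc n)} (ho : ∀ i, IsOpen (Ω i))
    {f : κ → ι → Euc n → F} (hf : ∀ j ∈ S, UnifBdd Ω (f j)) :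
    UnifBdd Ω fun i x => ∑ j ∈ S, f j i x := by
  refine ⟨ho, fun i => ContDiffOn.sum fun j hj => (hf j hj).contDiffOn i, fun k => ?_⟩
  have h1 : ∀ j, ∃ C : ℝ, j ∈ S → ∀ i, ∀ x ∈ Ω i, ‖iteratedFDeriv ℝ k (f j i) x‖ ≤ C := fun j => by
    by_cases hj : j ∈ S
    · obtain ⟨C, hC⟩ := (hf j hj).bound k
      exact ⟨C, fun _ => hC⟩
    · exact ⟨0, fun h => absurd h hj⟩
  choose C hC using h1
  refine ⟨∑ j ∈ S, C j, fun i x hx => ?_⟩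
  rw [iteratedFDeriv_fun_sum_apply fun j hj => ((hf j hj).contDiffAt hx).of_le (by exact_mod_cast le_top)]
  exact (norm_sum_le _ _).trans (Finset.sum_le_sum fun j hj => hC j hj i x hx)

theorem UnifBdd.clm {Ω : ι → Set (Euc n)} {f : ι → Euc n → F} (hf : UnifBdd Ω f) (L : F →L[ℝ] G) :
    UnifBdd Ω fun i x => L (f i x) := by
  refine ⟨hf.isOpen, fun i => L.contDiff.comp_contDiffOn (hf.contDiffOn i), fun k => ?_⟩
  obtain ⟨C, hC⟩ := hf.bound k
  refine ⟨‖L‖ * C, fun i x hx => ?_⟩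
  refine (L.norm_iteratedFDeriv_comp_left (hf.contDiffAt hx) (by exact_mod_cast le_top)).trans ?_
  gcongr
  exact hC i x hx

theorem UnifBdd.fderiv_apply {Ω : ι → Set (Euc n)} {f : ι → Euc n → F} (hf : UnifBdd Ω f)
    (v : Euc n) : UnifBdd Ω fun i x => fderiv ℝ (f i) x v := by
  have h : UnifBdd Ω fun i => fderiv ℝ (f i) :=
    ⟨hf.isOpen, fun i => (hf.contDiffOn i).fderiv_of_isOpen (hf.isOpen i) (by simp), fun k => by
      obtain ⟨C, hC⟩ := hf.bound (k + 1)
      exact ⟨C, fun i x hx => by rw [norm_iteratedFDeriv_fderiv]; exact hC i x hx⟩⟩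
  exact h.clm (ContinuousLinearMap.apply ℝ F v)

theorem UnifBdd.of_components {Ω : ι → Set (Euc n)} {f : ι → Euc n → Euc n}
    (hf : ∀ j, UnifBdd Ω fun i x => f i x j) (ho : ∀ i, IsOpen (Ω i)) : UnifBdd Ω f := by
  refine (UnifBdd.sum (S := Finset.univ) ho fun j _ =>
    (hf j).clm ((ContinuousLinearMap.id ℝ ℝ).smulRight (unitVec j))).congr fun i x _ => ?_
  simpa using ((EuclideanSpace.basisFun (Fin n) ℝ).sum_repr (f i x)).symm

theorem UnifBdd.comp {Ω Ω' : ι → Set (Euc n)} {g : ι → Euc n → F} {f : ι → Euc n → Euc n}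
    (hg : UnifBdd Ω' g) (hf : UnifBdd Ω f) (h : ∀ i, MapsTo (f i) (Ω i) (Ω' i)) :
    UnifBdd Ω fun i x => g i (f i x) := by
  refine ⟨hf.isOpen, fun i => (hg.contDiffOn i).comp (hf.contDiffOn i) (h i), fun k => ?_⟩
  obtain ⟨C, hC0, hC⟩ := hg.exists_bound k
  obtain ⟨D, hD0, hD⟩ := hf.exists_bound k
  -- The estimate for compositions wants the `l`-th derivative of `f i` bounded by the `l`-th power
  -- of one constant for `l ≥ 1`; `D + 1 ≥ 1` serves.
  refine ⟨k.factorial * C * (D + 1) ^ k, fun i x hx => ?_⟩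
  have h1 := norm_iteratedFDerivWithin_comp_le (hg.contDiffOn i) (hf.contDiffOn i) (n := k)
    (by exact_mod_cast le_top) (hg.isOpen i).uniqueDiffOn (hf.isOpen i).uniqueDiffOn (h i) hx
    (C := C) (D := D + 1)
    (fun l hl => by
      rw [iteratedFDerivWithin_of_isOpen _ (hg.isOpen i) (h i hx)]; exact hC l hl i _ (h i hx))
    (fun l hl1 hl => by
      rw [iteratedFDerivWithin_of_isOpen _ (hf.isOpen i) hx]
      exact (hD l hl i x hx).trans ((by linarith : D ≤ D + 1).trans
        (le_self_pow₀ (by linarith) (by omega))))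
  rwa [iteratedFDerivWithin_of_isOpen _ (hf.isOpen i) hx] at h1

theorem UnifBdd.of_isTest {Ω : ι → Set (Euc n)} (ho : ∀ i, IsOpen (Ω i)) {Ω' : Set (Euc n)}
    {a : Euc n → ℝ} (ha : IsTest Ω' a) : UnifBdd Ω fun _ => a := by
  refine ⟨ho, fun _ => ha.1.contDiffOn, fun k => ?_⟩
  obtain ⟨C, hC⟩ := (ha.1.continuous_iteratedFDeriv (m := k)
    (by exact_mod_cast le_top)).bounded_above_of_compact_support (ha.2.1.iteratedFDeriv (𝕜 := ℝ) k)
  exact ⟨C, fun _ x _ => hC x⟩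

end UnifBdd

/-! ### Products of distributions with smooth functions -/

section MulDist
variable {n : ℕ} {M : Type*} [TopologicalSpace M] [ChartedSpace (Euc n) M]

theorem contDiffOn_comp_chart_symm (f : C^∞⟮𝓡 n, M; ℝ⟯) (e : Chart n M) :
    ContDiffOn ℝ ∞ (fun y => f (e.1.symm y)) e.range :=
  ContMDiffOn.contDiffOn (f.contMDiff.comp_contMDiffOn (contMDiffOn_symm_of_mem_maximalAtlas e.2))

/-- The product `f u` of a distribution `u` on `M` with a smooth function `f`. -/
def mulDist (f : C^∞⟮𝓡 n, M; ℝ⟯) : Dist n M →ₗ[ℂ] Dist n M where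
  toFun u := ⟨fun e => mulDistribution _ (contDiffOn_comp_chart_symm f e) (u.1 e),
    fun e ψ e' ψ' h => by
      rw [mulDistribution_apply, mulDistribution_apply]
      refine u.coord_eq fun g => ?_
      -- Testing the equality of densities with `g * f` shows that their products with `f` are again
      -- the same density.
      have h1 := h (g * f)
      simp only [ContMDiffMap.coe_mul, Pi.mul_apply] at h1
      simp only [mulTest_apply]
      calc _ = _ := integral_congr_ae (.of_forall fun x => by ring)
        _ = _ := h1
        _ = _ := integral_congr_ae (.of_forall fun x => by ring)⟩
  map_add' u v := rfl
  map_smul' c u := rfl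

theorem mulDist_coord (f : C^∞⟮𝓡 n, M; ℝ⟯) (u : Dist n M) (e : Chart n M) (ψ : 𝓓(e.range, ℝ)) :
    (mulDist f u).1 e ψ = u.1 e (mulTest _ (contDiffOn_comp_chart_symm f e) ψ) := rfl

theorem Dist.ext_coord {u v : Dist n M} (h : ∀ (e : Chart n M) (ψ : 𝓓(e.range, ℝ)), u.1 e ψ = v.1 e ψ) :
    u = v := Subtype.ext (funext fun e => by ext ψ; exact h e ψ)

theorem Dist.add_coord (u v : Dist n M) (e : Chart n M) (ψ : 𝓓(e.range, ℝ)) :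
    (u + v).1 e ψ = u.1 e ψ + v.1 e ψ := rfl

theorem Dist.sum_coord {ι : Type*} (S : Finset ι) (u : ι → Dist n M) (e : Chart n M)
    (ψ : 𝓓(e.range, ℝ)) : (∑ i ∈ S, u i).1 e ψ = ∑ i ∈ S, (u i).1 e ψ := by
  classical
  induction S using Finset.induction_on with
  | empty => simp only [Finset.sum_empty]; rfl
  | insert a S ha ih => rw [Finset.sum_insert ha, Finset.sum_insert ha, ← ih]; rfl

variable [IsManifold (𝓡 n) ∞ M]

theorem vfAct_coord (W : SmoothVF n M) (u : Dist n M) (e : Chart n M) (ψ : 𝓓(e.range, ℝ)) :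
    (vfAct W u).1 e ψ = - u.1 e (divTest W e ψ) := vfActChart_apply W e (u.1 e) ψ

theorem divTest_apply (W : SmoothVF n M) (e : Chart n M) (ψ : 𝓓(e.range, ℝ)) (x : Euc n) :
    divTest W e ψ x = ∑ i, fderiv ℝ (fun y => ψ y * vfCoord e.1 W y i) x (unitVec i) := by
  rw [divTest, FunLike.coe_sum, Finset.sum_apply]
  refine Finset.sum_congr rfl fun i _ => ?_
  rw [TestFunction.lineDerivOp_eq_lineDerivCLM ℝ, TestFunction.lineDerivCLM_eq_fderivCLM]
  simp only [TestFunction.fderivCLM_apply]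
  simp
  rfl

/-- The Leibniz rule. -/
theorem vfAct_mulDist (W : SmoothVF n M) (f : C^∞⟮𝓡 n, M; ℝ⟯) (u : Dist n M) :
    vfAct W (mulDist f u) = mulDist (vfDeriv W f) u + mulDist f (vfAct W u) := by
  refine Dist.ext_coord fun e ψ => ?_
  -- By transposition the rule becomes `div (f ψ W) - f div (ψ W) = (W f) ψ`.
  rw [Dist.add_coord, vfAct_coord, mulDist_coord, mulDist_coord, mulDist_coord, vfAct_coord,
    neg_eq_iff_eq_neg, neg_add, neg_neg, ← sub_eq_neg_add, ← map_sub]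
  congr 1
  ext x
  rw [mulTest_apply, sub_apply, mulTest_apply, divTest_apply, divTest_apply]
  by_cases hx : x ∈ e.1.target
  · have hF : DifferentiableAt ℝ (fun y => f (e.1.symm y)) x :=
      ((contDiffOn_comp_chart_symm f e).contDiffAt (e.1.open_target.mem_nhds hx)).differentiableAt
        (by simp)
    have hψW : ∀ i, DifferentiableAt ℝ (fun y => ψ y * vfCoord e.1 W y i) x := fun i =>
      (ψ.contDiff.differentiable (by simp) x).mul
        (((vfCoord_apply_contDiffOn e W i).contDiffAt
          (e.1.open_target.mem_nhds hx)).differentiableAt (by simp))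
    rw [← fderiv_vfCoord W e f hx]
    have hv : vfCoord e.1 W x = ∑ i, vfCoord e.1 W x i • unitVec i := by
      simpa using ((EuclideanSpace.basisFun (Fin n) ℝ).sum_repr (vfCoord e.1 W x)).symm
    conv_rhs => rw [hv, map_sum, Finset.mul_sum]
    rw [Finset.sum_mul, ← Finset.sum_sub_distrib]
    refine Finset.sum_congr rfl fun i _ => ?_
    simp only [mulTest_apply]
    have h1 : (fun y => ψ y * f (e.1.symm y) * vfCoord e.1 W y i) =
        (fun y => ψ y * vfCoord e.1 W y i) * fun y => f (e.1.symm y) := by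
      ext y; simp only [Pi.mul_apply]; ring
    rw [h1, fderiv_mul (hψW i) hF]
    simp only [add_apply, smul_apply, smul_eq_mul, map_smul]
    ring
  · have hx' : x ∉ tsupport ψ := fun h => hx (ψ.tsupport_subset h)
    have h0 : ψ x = 0 := image_eq_zero_of_notMem_tsupport hx'
    have hev : ∀ g : Euc n → ℝ, fderiv ℝ (fun y => ψ y * g y) x = 0 := fun g =>
      fderiv_of_notMem_tsupport (𝕜 := ℝ) fun h => hx' (closure_mono (Function.support_mul_subset_left _ _) h)
    have hev2 : ∀ i, fderiv ℝ (fun y => ψ y * f (e.1.symm y) * vfCoord e.1 W y i) x = 0 := fun i => by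
      simpa only [mul_assoc] using hev _
    simp only [mulTest_apply, hev, hev2, h0]
    simp

/-- The transposed operator multiplies the test function by the coefficients before differentiating,
so the factors `f i` pass through without commutators. -/
theorem vfAct_eq_sum {ι : Type*} (S : Finset ι) (Z : SmoothVF n M) (W : ι → SmoothVF n M)
    (f : ι → C^∞⟮𝓡 n, M; ℝ⟯) (h : ∀ p, Z p = ∑ i ∈ S, f i p • W i p) (u : Dist n M) :
    vfAct Z u = ∑ i ∈ S, mulDist (f i) (vfAct (W i) u) := by
  refine Dist.ext_coord fun e ψ => ?_
  rw [Dist.sum_coord, vfAct_coord]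
  simp only [mulDist_coord, vfAct_coord]
  rw [Finset.sum_neg_distrib, neg_inj, ← map_sum]
  congr 1
  have hc : ∀ y i, vfCoord e.1 Z y i = ∑ j ∈ S, f j (e.1.symm y) * vfCoord e.1 (W j) y i := fun y i => by
    have h1 : vfCoord e.1 Z y = ∑ j ∈ S, f j (e.1.symm y) • vfCoord e.1 (W j) y := by
      rw [vfCoord, h]
      erw [map_sum]
      refine Finset.sum_congr rfl fun j _ => ?_
      erw [map_smul]
      rfl
    rw [h1]
    simp
  rw [divTest]
  simp only [divTest]
  rw [Finset.sum_comm]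
  refine Finset.sum_congr rfl fun i _ => ?_
  rw [← LineDeriv.lineDerivOp_sum]
  congr 1
  ext x
  rw [FunLike.coe_sum, Finset.sum_apply]
  simp only [mulTest_apply, hc, Finset.mul_sum]
  exact Finset.sum_congr rfl fun j _ => by ring

end MulDist
end
end ScaledBG

namespace ScaledBG
noncomputable section
open Filter
open scoped FourierTransform
open FourierTransform

/-! ### The cube and its scalings -/

section Cube
variable {n : ℕ}

theorem norm_le_of_mem_cube {x : Euc n} (hx : x ∈ cube n 2) : ‖x‖ ≤ √(n * 4) := by
  rw [EuclideanSpace.norm_eq]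
  refine Real.sqrt_le_sqrt ?_
  calc ∑ i, ‖x i‖ ^ 2 ≤ ∑ i : Fin n, (2 : ℝ) ^ 2 :=
        Finset.sum_le_sum fun i _ => pow_le_pow_left₀ (norm_nonneg _) (hx i).le 2
    _ = n * 4 := by simp; norm_num

/-- All supports lie in one bounded cube, where the polynomial weights of the Schwartz seminorms are
bounded. -/
theorem exists_seminorm_bound {ι : Type*} {a : ι → Euc n → ℝ}
    (ha : ∀ i, IsTest (cube n 2 : Set (Euc n)) (a i))
    (hb : UnifBdd (fun _ : ι => (cube n 2 : Set (Euc n))) a) (k l : ℕ) :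
    ∃ C, ∀ i, SchwartzMap.seminorm ℂ k l (ha i).toSchwartz ≤ C := by
  obtain ⟨C, hC0, hC⟩ := hb.exists_bound l
  refine ⟨√(n * 4) ^ k * C, fun i => SchwartzMap.seminorm_le_bound ℂ k l _ (by positivity) fun x => ?_⟩
  have h2 : ‖iteratedFDeriv ℝ l (fun x => (a i x : ℂ)) x‖ = ‖iteratedFDeriv ℝ l (a i) x‖ :=
    Complex.ofRealLI.norm_iteratedFDeriv_comp_left ((ha i).1.contDiffAt) (by exact_mod_cast le_top)
  change ‖x‖ ^ k * ‖iteratedFDeriv ℝ l (fun x => (a i x : ℂ)) x‖ ≤ _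
  rw [h2]
  by_cases hx : x ∈ cube n 2
  · exact mul_le_mul (pow_le_pow_left₀ (norm_nonneg _) (norm_le_of_mem_cube hx) _)
      (hC l le_rfl i x hx) (norm_nonneg _) (by positivity)
  · have h3 : iteratedFDeriv ℝ l (a i) x = 0 :=
      image_eq_zero_of_notMem_tsupport fun h => hx ((ha i).2.2 (tsupport_iteratedFDeriv_subset l h))
    rw [h3, norm_zero, mul_zero]
    positivity

theorem scaleMap_symmetric (ρ : Fin n → ℝ) (hρ : ∀ i, 0 < ρ i) (x y : Euc n) :
    inner ℝ (scaleMap ρ hρ x) y = inner ℝ x (scaleMap ρ hρ y) := by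
  simp only [PiLp.inner_apply, scaleMap]
  refine Finset.sum_congr rfl fun i _ => ?_
  change y i * (x i / ρ i) = y i / ρ i * x i
  ring

theorem scaleMap_symm_symmetric (ρ : Fin n → ℝ) (hρ : ∀ i, 0 < ρ i) (x y : Euc n) :
    inner ℝ ((scaleMap ρ hρ).symm x) y = inner ℝ x ((scaleMap ρ hρ).symm y) := by
  have := scaleMap_symmetric ρ hρ ((scaleMap ρ hρ).symm x) ((scaleMap ρ hρ).symm y)
  simpa using this.symm

theorem norm_scaleMap_symm_le (ρ : Fin n → ℝ) (hρ : ∀ i, 0 < ρ i) (hρ1 : ∀ i, ρ i ≤ 1) (x : Euc n) :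
    ‖(scaleMap ρ hρ).symm x‖ ≤ ‖x‖ := by
  rw [EuclideanSpace.norm_eq, EuclideanSpace.norm_eq]
  refine Real.sqrt_le_sqrt (Finset.sum_le_sum fun i _ => ?_)
  refine pow_le_pow_left₀ (norm_nonneg _) ?_ 2
  change ‖x i * ρ i‖ ≤ _
  rw [norm_mul, Real.norm_of_nonneg (hρ i).le]
  exact mul_le_of_le_one_right (norm_nonneg _) (hρ1 i)

end Cube

/-! ### Uniform functions and spanning sets acting on the Sobolev spaces -/

namespace ScaledBGStructure
variable {n : ℕ} {M : Type*} [TopologicalSpace M] [ChartedSpace (Euc n) M] {A : Type*}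
variable (B : ScaledBGStructure n M A)

theorem isUniformFunction_iff {f : C^∞⟮𝓡 n, M; ℝ⟯} : B.IsUniformFunction f ↔
    UnifBdd (fun _ : A => (cube n 2 : Set (Euc n))) fun α y => f ((B.chart α).1.symm y) :=
  ⟨fun h => ⟨fun _ => (cube n 2).isOpen, fun α => by
      rw [← B.range_chart α]; exact contDiffOn_comp_chart_symm f (B.chart α), h.2⟩,
    fun h => ⟨f.contMDiff, h.bound⟩⟩

/-- In the cell `α` the multiplier is `f ∘ φ_α⁻¹`, cut off by one fixed `θ` equal to one on the
support of `χ`; its Schwartz seminorms are therefore bounded uniformly in `α`. -/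
theorem cut_mulDist {f : C^∞⟮𝓡 n, M; ℝ⟯} (hf : B.IsUniformFunction f) (χ : 𝓓(cube n 2, ℝ)) :
    ∃ g : A → 𝓢(Euc n, ℂ), (∀ k l : ℕ, ∃ C, ∀ α, SchwartzMap.seminorm ℂ k l (g α) ≤ C) ∧
      ∀ α u φ, B.cut χ α (mulDist f u) φ = B.cut χ α u (mulSchwartz (g α) φ) := by
  obtain ⟨θ, hθ, hθ1⟩ := exists_isTest_eq_one (cube n 2).isOpen χ.hasCompactSupport χ.tsupport_subset
  have hb := B.isUniformFunction_iff.1 hf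
  have ha : ∀ α, IsTest (cube n 2 : Set (Euc n)) fun x => θ x * f ((B.chart α).1.symm x) := fun α =>
    hθ.mul_contDiffOn (cube n 2).isOpen (hb.contDiffOn α)
  refine ⟨fun α => (ha α).toSchwartz, exists_seminorm_bound ha
    ((UnifBdd.of_isTest (fun _ => (cube n 2).isOpen) hθ).mul hb), fun α u φ => ?_⟩
  rw [cut_apply, cut_apply, cutExtend_apply]
  symm
  rw [mulDist_coord, mulDist_coord]
  refine cutExtend_eq _ _ fun x => ?_
  simp only [cutoff_apply, mulSchwartz_apply, IsTest.toSchwartz_apply, mulTest_apply, cutSchwartz_apply,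
    SchwartzMap.postcompCLM_apply, Complex.reCLM_apply, Complex.imCLM_apply]
  by_cases hx : x ∈ tsupport χ
  · rw [hθ1 x hx]
    conv_lhs => rw [← Complex.re_add_im (φ x)]
    push_cast; ring
  · simp [image_eq_zero_of_notMem_tsupport hx]

theorem localize_apply (χ : 𝓓(cube n 2, ℝ)) (α : A) (u : Dist n M) (φ : 𝓢(Euc n, ℂ)) :
    B.localize χ α u φ = ((∏ i, B.ρ α i : ℝ) : ℂ)⁻¹ *
      B.cut χ α u (compLinear (scaleMap (B.ρ α) (B.ρ_pos α)) φ) := rfl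

theorem prod_ρ_pos (α : A) : 0 < ∏ i, B.ρ α i := Finset.prod_pos fun i _ => B.ρ_pos α i

theorem cut_eq_localize (χ : 𝓓(cube n 2, ℝ)) (α : A) (u : Dist n M) (φ : 𝓢(Euc n, ℂ)) :
    B.cut χ α u φ = ((∏ i, B.ρ α i : ℝ) : ℂ) *
      B.localize χ α u (compLinear (scaleMap (B.ρ α) (B.ρ_pos α)).symm φ) := by
  rw [localize_apply, mul_inv_cancel_left₀ (by exact_mod_cast (B.prod_ρ_pos α).ne')]
  congr 1
  ext x
  simp

/-- Multiplication by a uniform function is bounded on the localizations to the unit cells,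
uniformly in the unit cell. -/
theorem exists_sobolevNorm_mulDist_le {f : C^∞⟮𝓡 n, M; ℝ⟯} (hf : B.IsUniformFunction f)
    (χ : 𝓓(cube n 2, ℝ)) (s : ℝ) :
    ∃ C, 0 ≤ C ∧ ∀ α u, TemperedDistribution.MemSobolev s 2 (B.localize χ α u) →
      TemperedDistribution.MemSobolev s 2 (B.localize χ α (mulDist f u)) ∧
      sobolevNorm s (B.localize χ α (mulDist f u)) ≤ C * sobolevNorm s (B.localize χ α u) := by
  obtain ⟨g, hg, hcut⟩ := B.cut_mulDist hf χ
  obtain ⟨C, hC0, hC⟩ := exists_fourierL1_bound hg |(-s)|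
  refine ⟨2 ^ (|(-s)| / 2) * C, by positivity, fun α u hu => ?_⟩
  refine memSobolev_of_bound (mul_nonneg (by positivity) (sobolevNorm_nonneg _ _)) fun φ => ?_
  -- In scaled coordinates the multiplier is `g α ∘ S_α⁻¹`. Since `S_α⁻¹` is a contraction, the
  -- bound for the unscaled `g α` serves for all `α`.
  have h1 : B.localize χ α (mulDist f u) φ = B.localize χ α u
      (mulSchwartz (compLinear (scaleMap (B.ρ α) (B.ρ_pos α)).symm (g α)) φ) := by
    rw [localize_apply, localize_apply, hcut]
    congr 2
    ext x
    simp
  rw [h1]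
  refine (MemSobolev.norm_apply_le hu _).trans ?_
  calc _ ≤ sobolevNorm s (B.localize χ α u) * (2 ^ (|(-s)| / 2) * C * hNorm (-s) φ) := by
        refine mul_le_mul_of_nonneg_left ((hNorm_mulSchwartz_le _ _ _).trans ?_) (sobolevNorm_nonneg _ _)
        have h2 : fourierL1 |(-s)| (compLinear (scaleMap (B.ρ α) (B.ρ_pos α)).symm (g α)) ≤ C :=
          (fourierL1_compLinear_le (abs_nonneg _) _ (scaleMap_symm_symmetric _ _)
            (norm_scaleMap_symm_le _ _ (B.ρ_le_one α)) _).trans (hC α)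
        have := hNorm_nonneg (-s) φ
        gcongr
    _ = _ := by ring

theorem mulDist_mem_sobolevSpace {f : C^∞⟮𝓡 n, M; ℝ⟯} (hf : B.IsUniformFunction f)
    {χ : 𝓓(cube n 2, ℝ)} {v : B.WeightFamily} {s : ℝ} {u : Dist n M}
    (hu : u ∈ B.sobolevSpace χ v s) : mulDist f u ∈ B.sobolevSpace χ v s := by
  obtain ⟨C, hC0, hC⟩ := B.exists_sobolevNorm_mulDist_le hf χ s
  refine ⟨fun α => (hC α u (hu.1 α)).1, ?_⟩
  refine Summable.of_nonneg_of_le (fun α => sq_nonneg _) (fun α => ?_) (hu.2.mul_left (C ^ 2))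
  rw [← mul_pow]
  refine pow_le_pow_left₀ (localNorm_nonneg _ _ _ _ _) ?_ 2
  rw [localNorm, localNorm, mul_left_comm]
  exact mul_le_mul_of_nonneg_left (hC α u (hu.1 α)).2 (inv_nonneg.2 (v.pos α).le)

/-- Undoing the scaling costs a factor that depends on the cell. This is harmless because local
compactness is needed one cell at a time. -/
theorem exists_cut_le (χ : 𝓓(cube n 2, ℝ)) (α : A) (s : ℝ) :
    ∃ C, 0 ≤ C ∧ ∀ u, TemperedDistribution.MemSobolev s 2 (B.localize χ α u) →
      ∀ φ, ‖B.cut χ α u φ‖ ≤ C * sobolevNorm s (B.localize χ α u) * hNorm (-s) φ := by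
  obtain ⟨C, hC0, hC⟩ := hNorm_compLinear_le (-s) (scaleMap (B.ρ α) (B.ρ_pos α)).symm
    (scaleMap_symm_symmetric _ _)
  refine ⟨(∏ i, B.ρ α i) * C, mul_nonneg (B.prod_ρ_pos α).le hC0, fun u hu φ => ?_⟩
  rw [cut_eq_localize, norm_mul, Complex.norm_real, Real.norm_of_nonneg (B.prod_ρ_pos α).le, mul_assoc,
    mul_assoc]
  refine mul_le_mul_of_nonneg_left ((MemSobolev.norm_apply_le hu _).trans ?_) (B.prod_ρ_pos α).le
  rw [mul_left_comm]
  exact mul_le_mul_of_nonneg_left (hC φ) (sobolevNorm_nonneg _ _)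

theorem exists_sobolevNorm_le_of_cut (χ : 𝓓(cube n 2, ℝ)) (α : A) (s : ℝ) :
    ∃ C, 0 ≤ C ∧ ∀ u D, 0 ≤ D → (∀ φ, ‖B.cut χ α u φ‖ ≤ D * hNorm (-s) φ) →
      TemperedDistribution.MemSobolev s 2 (B.localize χ α u) ∧
        sobolevNorm s (B.localize χ α u) ≤ C * D := by
  obtain ⟨C, hC0, hC⟩ := hNorm_compLinear_le (-s) (scaleMap (B.ρ α) (B.ρ_pos α))
    (scaleMap_symmetric _ _)
  have hp := inv_nonneg.2 (B.prod_ρ_pos α).le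
  refine ⟨(∏ i, B.ρ α i)⁻¹ * C, mul_nonneg hp hC0, fun u D hD h => ?_⟩
  refine memSobolev_of_bound (mul_nonneg (mul_nonneg hp hC0) hD) fun φ => ?_
  rw [localize_apply, norm_mul, norm_inv, Complex.norm_real, Real.norm_of_nonneg (B.prod_ρ_pos α).le,
    mul_assoc, mul_assoc]
  refine mul_le_mul_of_nonneg_left ((h _).trans ?_) hp
  calc _ ≤ D * (C * hNorm (-s) φ) := mul_le_mul_of_nonneg_left (hC φ) hD
    _ = _ := by ring

variable [IsManifold (𝓡 n) ∞ M]

theorem unifBdd_vfCoord {W : SmoothVF n M} (hW : W ∈ B.coefficientVF) (i : Fin n) :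
    UnifBdd (fun _ : A => (cube n 2 : Set (Euc n))) fun α y => vfCoord (B.chart α).1 W y i :=
  ⟨fun _ => (cube n 2).isOpen, fun α => by
    rw [← B.range_chart α]; exact vfCoord_apply_contDiffOn (B.chart α) W i,
    fun k => let ⟨C, hC⟩ := hW k; ⟨C, fun α x hx => hC α i x hx⟩⟩

theorem isUniformFunction_vfDeriv {W : SmoothVF n M} (hW : W ∈ B.coefficientVF)
    {f : C^∞⟮𝓡 n, M; ℝ⟯} (hf : B.IsUniformFunction f) : B.IsUniformFunction (vfDeriv W f) := by
  rw [isUniformFunction_iff] at hf ⊢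
  refine (UnifBdd.sum (S := Finset.univ) (fun _ => (cube n 2).isOpen) fun i _ =>
    (B.unifBdd_vfCoord hW i).mul (hf.fderiv_apply (unitVec i))).congr fun α x hx => ?_
  have hx' : x ∈ (B.chart α).1.target := by rw [target_chart]; exact hx
  simp only
  rw [← fderiv_vfCoord W (B.chart α) f hx']
  have hv : vfCoord (B.chart α).1 W x = ∑ i, vfCoord (B.chart α).1 W x i • unitVec i := by
    simpa using ((EuclideanSpace.basisFun (Fin n) ℝ).sum_repr (vfCoord (B.chart α).1 W x)).symm
  conv_lhs => rw [hv, map_sum]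
  simp

theorem exists_vfAct_eq_sum {F : Finset B.coefficientVF} (hF : B.IsSpanning F) {Z : SmoothVF n M}
    (hZ : Z ∈ B.coefficientVF) : ∃ f : B.coefficientVF → C^∞⟮𝓡 n, M; ℝ⟯,
      (∀ W, B.IsUniformFunction (f W)) ∧
      ∀ u, vfAct Z u = ∑ W ∈ F, mulDist (f W) (vfAct W.1 u) := by
  obtain ⟨f, hf, hZf⟩ := hF Z hZ
  have h0 : B.IsUniformFunction (0 : C^∞⟮𝓡 n, M; ℝ⟯) := by
    refine ⟨(0 : C^∞⟮𝓡 n, M; ℝ⟯).contMDiff, fun k => ⟨0, fun α x _ => ?_⟩⟩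
    have : (fun y => (0 : C^∞⟮𝓡 n, M; ℝ⟯) ((B.chart α).1.symm y)) = fun _ => (0 : ℝ) := rfl
    rw [this, iteratedFDeriv_fun_zero]; simp
  -- Nothing is known about `f W` for `W ∉ F`; there the coefficient is replaced by zero.
  have h1 : ∀ W, ∃ g : C^∞⟮𝓡 n, M; ℝ⟯, B.IsUniformFunction g ∧ (W ∈ F → ∀ p, g p = f W p) := fun W => by
    by_cases h : W ∈ F
    · exact ⟨⟨f W, (hf W h).1⟩, hf W h, fun _ _ => rfl⟩
    · exact ⟨0, h0, fun h' => absurd h' h⟩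
  choose g hg hgf using h1
  refine ⟨g, hg, fun u => vfAct_eq_sum F Z (fun W => W.1) _ (fun p => ?_) u⟩
  rw [hZf p]
  exact Finset.sum_congr rfl fun W hW => by rw [hgf W hW]

theorem word_nil (u : Dist n M) : B.word [] u = u := rfl

theorem word_cons (W : B.coefficientVF) (l : List B.coefficientVF) (u : Dist n M) :
    B.word (W :: l) u = vfAct W.1 (B.word l u) := by
  simp [word]

theorem word_append_singleton (l : List B.coefficientVF) (W : B.coefficientVF) (u : Dist n M) :
    B.word (l ++ [W]) u = B.word l (vfAct W.1 u) := by
  simp [word]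

/-- Induction on `k`. The field that acts first is the last letter of the word; by the Leibniz rule
it leaves `(W f) u` and `f (W u)`, with at most `k` fields still to act, and `W f` is again uniform.
-/
theorem mulDist_mem_mixedSpace {χ : 𝓓(cube n 2, ℝ)} {v : B.WeightFamily} {s : ℝ} (k : ℕ) :
    ∀ {f : C^∞⟮𝓡 n, M; ℝ⟯} (_ : B.IsUniformFunction f) {u : Dist n M}
      (_ : u ∈ B.mixedSpace χ v s k), mulDist f u ∈ B.mixedSpace χ v s k := by
  induction k with
  | zero =>
    intro f hf u hu l hl
    obtain rfl := List.length_eq_zero_iff.1 (Nat.le_zero.1 hl)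
    exact B.mulDist_mem_sobolevSpace hf (hu [] le_rfl)
  | succ k ih =>
    intro f hf u hu l hl
    rcases List.eq_nil_or_concat l with rfl | ⟨l, W, rfl⟩
    · exact B.mulDist_mem_sobolevSpace hf (hu [] (by simp))
    · have hl' : l.length ≤ k := by simpa using hl
      rw [List.concat_eq_append, word_append_singleton, vfAct_mulDist, map_add]
      refine add_mem (ih (B.isUniformFunction_vfDeriv W.2 hf) (fun l' hl' => hu l' (by omega)) l hl')
        (ih hf (fun l' hl' => ?_) l hl')
      rw [← word_append_singleton]
      exact hu _ (by simpa using hl')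

/-- It suffices to test `𝒲`-regularity on a finite spanning set. -/
theorem mem_mixedSpace_of_spanning {F : Finset B.coefficientVF} (hF : B.IsSpanning F)
    {χ : 𝓓(cube n 2, ℝ)} {v : B.WeightFamily} {s : ℝ} (k : ℕ) : ∀ {u : Dist n M},
    (∀ l : List B.coefficientVF, (∀ W ∈ l, W ∈ F) → l.length ≤ k →
      B.word l u ∈ B.sobolevSpace χ v s) → u ∈ B.mixedSpace χ v s k := by
  induction k with
  | zero =>
    intro u hu l hl
    obtain rfl := List.length_eq_zero_iff.1 (Nat.le_zero.1 hl)
    exact hu [] (by simp) le_rfl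
  | succ k ih =>
    intro u hu l hl
    rcases List.eq_nil_or_concat l with rfl | ⟨l, Z, rfl⟩
    · exact hu [] (by simp) (by simp)
    · have hl' : l.length ≤ k := by simpa using hl
      -- The field acting first is expanded in `F`. Each `W u` with `W ∈ F` satisfies the hypothesis
      -- for `k`, and the space it thereby lies in is stable under multiplication by the
      -- coefficients.
      obtain ⟨f, hf, hZ⟩ := B.exists_vfAct_eq_sum hF Z.2
      rw [List.concat_eq_append, word_append_singleton, hZ, map_sum]
      refine sum_mem fun W hW => B.mulDist_mem_mixedSpace k (hf W) (ih fun l' hl'F hl' => ?_) l hl'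
      rw [← word_append_singleton]
      refine hu _ (fun W' hW' => ?_) (by simpa using hl')
      rcases List.mem_append.1 hW' with h | h
      · exact hl'F _ h
      · rw [List.mem_singleton.1 h]; exact hW

end ScaledBGStructure
end
end ScaledBG

namespace ScaledBG
noncomputable section
open Filter
open scoped FourierTransform
open FourierTransform

/-! ### Cut-off coordinate vector fields -/

section CoordField
variable {n : ℕ} {M : Type*} [TopologicalSpace M] [T2Space M] [ChartedSpace (Euc n) M]
  [IsManifold (𝓡 n) ∞ M]

open Classical in
/-- The vector field `a ∂_v` in the chart `e`, extended by zero, pointwise. -/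
def coordFieldFun (e : Chart n M) (a : Euc n → ℝ) (v : Euc n) (p : M) : Euc n :=
  if p ∈ e.1.source then
    (show Euc n →L[ℝ] Euc n from mfderiv (𝓡 n) (𝓡 n) e.1.symm (e.1 p)) (a (e.1 p) • v) else 0

omit [T2Space M] [IsManifold (𝓡 n) ∞ M] in
theorem coordFieldFun_of_mem (e : Chart n M) (a : Euc n → ℝ) (v : Euc n) {p : M}
    (hp : p ∈ e.1.source) : coordFieldFun e a v p =
      (show Euc n →L[ℝ] Euc n from mfderiv (𝓡 n) (𝓡 n) e.1.symm (e.1 p)) (a (e.1 p) • v) :=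
  if_pos hp

omit [T2Space M] [IsManifold (𝓡 n) ∞ M] in
theorem coordFieldFun_of_notMem (e : Chart n M) {a : Euc n → ℝ} (v : Euc n) {p : M}
    (hp : p ∉ e.1.symm '' tsupport a) : coordFieldFun e a v p = 0 := by
  by_cases h : p ∈ e.1.source
  · have h0 : a (e.1 p) = 0 := image_eq_zero_of_notMem_tsupport fun h' => hp ⟨_, h', e.1.left_inv h⟩
    rw [coordFieldFun_of_mem e a v h, h0, zero_smul, map_zero]
  · exact if_neg h

/-- The vector field `a ∂_v` in the chart `e`, extended by zero. -/
def coordField (e : Chart n M) {a : Euc n → ℝ} (ha : IsTest e.1.target a) (v : Euc n) :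
    SmoothVF n M where
  toFun := coordFieldFun e a v
  contMDiff_toFun := by
    intro p
    by_cases hp : p ∈ e.1.source
    · have h1 := (contMDiffOn_symm_of_mem_maximalAtlas e.2).contMDiffOn_tangentMapWithin (m := ∞)
        (by simp) e.1.open_target.uniqueMDiffOn
      have h2 : ContMDiff (𝓡 n) (𝓡 n).tangent ∞
          (fun y => (⟨y, a y • v⟩ : TangentBundle (𝓡 n) (Euc n))) :=
        contMDiff_vectorSpace_iff_contDiff.2 (ha.1.smul contDiff_const)
      have h3 := h1.comp (h2.comp_contMDiffOn (contMDiffOn_of_mem_maximalAtlas e.2))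
        (fun q hq => e.1.map_source hq)
      refine (h3.contMDiffAt (e.1.open_source.mem_nhds hp)).congr_of_eventuallyEq ?_
      filter_upwards [e.1.open_source.mem_nhds hp] with q hq
      simp only [Function.comp, tangentMapWithin]
      rw [mfderivWithin_of_isOpen e.1.open_target (e.1.map_source hq)]
      refine Bundle.TotalSpace.ext (e.1.left_inv hq).symm ?_
      exact heq_of_eq (coordFieldFun_of_mem e a v hq)
    -- The image of the support is compact, hence closed in the Hausdorff space `M`, so the field
    -- vanishes near every point outside the chart domain.
    · have hK : IsCompact (e.1.symm '' tsupport a) :=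
        ha.2.1.isCompact.image_of_continuousOn (e.1.continuousOn_symm.mono ha.2.2)
      have hp' : p ∉ e.1.symm '' tsupport a := by
        rintro ⟨y, hy, rfl⟩; exact hp (e.1.map_target (ha.2.2 hy))
      refine (Bundle.contMDiff_zeroSection ℝ (TangentSpace (𝓡 n) : M → Type _)).contMDiffAt.congr_of_eventuallyEq ?_
      filter_upwards [hK.isClosed.isOpen_compl.mem_nhds hp'] with q hq
      exact Bundle.TotalSpace.ext rfl (heq_of_eq (coordFieldFun_of_notMem e v hq))

theorem vfCoord_coordField (e e' : Chart n M) {a : Euc n → ℝ} (ha : IsTest e.1.target a) (v : Euc n)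
    {y : Euc n} (hy : y ∈ (chartChange e' e).source) :
    vfCoord e'.1 (coordField e ha v) y =
      a (chartChange e' e y) • fderiv ℝ (chartChange e e') (chartChange e' e y) v := by
  rw [chartChange_source] at hy
  have hp := hy.2
  have hq : e'.1.symm y ∈ e'.1.source := e'.1.map_target hy.1
  change (show Euc n →L[ℝ] Euc n from mfderiv (𝓡 n) (𝓡 n) e'.1 (e'.1.symm y))
    (coordFieldFun e a v (e'.1.symm y)) = _
  rw [coordFieldFun_of_mem e a v hp, map_smul, map_smul]
  have h1 : MDifferentiableAt (𝓡 n) (𝓡 n) e.1.symm (e.1 (e'.1.symm y)) :=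
    ((contMDiffOn_symm_of_mem_maximalAtlas e.2).contMDiffAt
      (e.1.open_target.mem_nhds (e.1.map_source hp))).mdifferentiableAt (by simp)
  have h2 : MDifferentiableAt (𝓡 n) (𝓡 n) e'.1 (e.1.symm (e.1 (e'.1.symm y))) := by
    rw [e.1.left_inv hp]
    exact ((contMDiffOn_of_mem_maximalAtlas e'.2).contMDiffAt
      (e'.1.open_source.mem_nhds hq)).mdifferentiableAt (by simp)
  have h3 := mfderiv_comp (e.1 (e'.1.symm y)) h2 h1
  have h4 : fderiv ℝ (chartChange e e') (chartChange e' e y) =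
      mfderiv (𝓡 n) (𝓡 n) (e'.1 ∘ e.1.symm) (e.1 (e'.1.symm y)) := by
    rw [mfderiv_eq_fderiv]; rfl
  rw [h4, h3, e.1.left_inv hp]
  rfl

theorem vfCoord_coordField_of_notMem (e e' : Chart n M) {a : Euc n → ℝ} (ha : IsTest e.1.target a)
    (v : Euc n) {y : Euc n} (hy : y ∈ e'.1.target) (hy' : y ∉ (chartChange e' e).source) :
    vfCoord e'.1 (coordField e ha v) =ᶠ[𝓝 y] 0 := by
  have hp : e'.1.symm y ∉ e.1.source := fun h => hy' (by rw [chartChange_source]; exact ⟨hy, h⟩)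
  have hK : IsCompact (e.1.symm '' tsupport a) :=
    ha.2.1.isCompact.image_of_continuousOn (e.1.continuousOn_symm.mono ha.2.2)
  have hp' : e'.1.symm y ∉ e.1.symm '' tsupport a := by
    rintro ⟨z, hz, h⟩; exact hp (h ▸ e.1.map_target (ha.2.2 hz))
  filter_upwards [(e'.1.continuousAt_symm hy).preimage_mem_nhds
    (hK.isClosed.isOpen_compl.mem_nhds hp')] with z hz
  change (show Euc n →L[ℝ] Euc n from mfderiv (𝓡 n) (𝓡 n) e'.1 (e'.1.symm z))
    (coordFieldFun e a v (e'.1.symm z)) = 0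
  rw [coordFieldFun_of_notMem e v hz, map_zero]

end CoordField

namespace ScaledBGStructure
variable {n : ℕ} {M : Type*} [TopologicalSpace M] [T2Space M] [ChartedSpace (Euc n) M]
  [IsManifold (𝓡 n) ∞ M] {A : Type*}
variable (B : ScaledBGStructure n M A)

omit [T2Space M] [IsManifold (𝓡 n) ∞ M] in
theorem unifBdd_chartChange (j : Fin n) {ι : Type*} (f g : ι → A) :
    UnifBdd (fun i => (chartChange (B.chart (f i)) (B.chart (g i))).source)
      fun i x => chartChange (B.chart (f i)) (B.chart (g i)) x j :=
  ⟨fun i => (chartChange _ _).open_source,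
    fun i => contDiffOn_euclidean.1 (chartChange_contDiffOn (B.chart (f i)) (B.chart (g i))) j,
    fun k => by
      obtain ⟨C, hC⟩ := B.transition_bdd k
      exact ⟨C, fun i x hx => hC (f i) (g i) j x (by rwa [chartChange_source] at hx)⟩⟩

/-- In the cell `α` the coefficients are `(a · ∂_v τ_{αβ}^j) ∘ τ_{βα}` on the overlap and zero
elsewhere, so the bounds on transition functions suffice. Hence `𝒲` contains all coordinate
derivatives locally. -/
theorem coordField_mem (β : A) {a : Euc n → ℝ} (ha : IsTest (B.chart β).1.target a) (v : Euc n) :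
    coordField (B.chart β) ha v ∈ B.coefficientVF := by
  have h : ∀ j : Fin n, UnifBdd (fun α => (chartChange (B.chart α) (B.chart β)).source)
      fun α y => vfCoord (B.chart α).1 (coordField (B.chart β) ha v) y j := fun j => by
    have h1 := B.unifBdd_chartChange j (fun _ : A => β) id
    have h2 : UnifBdd (fun α => (chartChange (B.chart α) (B.chart β)).source)
        fun α => chartChange (B.chart α) (B.chart β) :=
      .of_components (fun j => B.unifBdd_chartChange j id fun _ : A => β)
        fun _ => (chartChange _ _).open_source
    have h3 := (UnifBdd.of_isTest (fun α => (chartChange (B.chart β) (B.chart α)).open_source) ha).mul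
      (h1.fderiv_apply v)
    have hτ : ∀ α, MapsTo (chartChange (B.chart α) (B.chart β))
        (chartChange (B.chart α) (B.chart β)).source (chartChange (B.chart β) (B.chart α)).source :=
      fun α y hy => by
        rw [chartChange_source] at hy ⊢
        refine ⟨(B.chart β).1.map_source hy.2, ?_⟩
        rw [mem_preimage, chartChange, OpenPartialHomeomorph.coe_trans, Function.comp_apply,
          (B.chart β).1.left_inv hy.2]
        exact (B.chart α).1.map_target hy.1
    refine (h3.comp h2 hτ).congr fun α y hy => ?_
    · simp only
      rw [vfCoord_coordField _ _ ha v hy]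
      have h5 : DifferentiableAt ℝ (chartChange (B.chart β) (B.chart α)) (chartChange (B.chart α) (B.chart β) y) :=
        ((chartChange_contDiffOn _ _).contDiffAt ((chartChange _ _).open_source.mem_nhds (hτ α hy))).differentiableAt (by simp)
      have h6 := ((EuclideanSpace.proj j : Euc n →L[ℝ] ℝ).hasFDerivAt.comp _ h5.hasFDerivAt).fderiv
      simp only [PiLp.smul_apply, smul_eq_mul]
      congr 1
      exact (congrArg (fun L => L v) h6).symm
  intro k
  choose C hC using fun j => (h j).bound k
  refine ⟨∑ j, |C j|, fun α j x hx => ?_⟩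
  by_cases hx' : x ∈ (chartChange (B.chart α) (B.chart β)).source
  · exact (hC j α x hx').trans ((le_abs_self _).trans
      (Finset.single_le_sum (f := fun j => |C j|) (fun _ _ => abs_nonneg _) (Finset.mem_univ j)))
  · have h7 := vfCoord_coordField_of_notMem (B.chart β) (B.chart α) ha v (by rw [B.target_chart]; exact hx) hx'
    have h8 : (fun y => vfCoord (B.chart α).1 (coordField (B.chart β) ha v) y j) =ᶠ[𝓝 x] fun _ => 0 := by
      filter_upwards [h7] with y hy
      rw [hy]; rfl
    rw [(h8.iteratedFDeriv ℝ k).eq_of_nhds, iteratedFDeriv_fun_zero]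
    simp only [Pi.zero_apply, norm_zero]
    positivity

theorem vfCoord_coordField_self (e : Chart n M) {a : Euc n → ℝ} (ha : IsTest e.1.target a) (v : Euc n)
    {y : Euc n} (hy : y ∈ e.1.target) : vfCoord e.1 (coordField e ha v) y = a y • v := by
  have hs : y ∈ (chartChange e e).source := by
    rw [chartChange_source]; exact ⟨hy, e.1.map_target hy⟩
  have h1 : ∀ z ∈ e.1.target, chartChange e e z = z := fun z hz => e.1.right_inv hz
  rw [vfCoord_coordField e e ha v hs, h1 y hy]
  have h2 : (chartChange e e : Euc n → Euc n) =ᶠ[𝓝 y] id := by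
    filter_upwards [e.1.open_target.mem_nhds hy] with z hz using h1 z hz
  rw [h2.fderiv_eq, fderiv_id]
  rfl

end ScaledBGStructure
end
end ScaledBG

/-! ### Gain of local regularity from `𝒲` -/

namespace ScaledBG
noncomputable section
open Filter
open scoped FourierTransform
open FourierTransform

theorem IsTest.mono {n : ℕ} {Ω Ω' : Set (Euc n)} {a : Euc n → ℝ} (ha : IsTest Ω a) (h : Ω ⊆ Ω') :
    IsTest Ω' a := ⟨ha.1, ha.2.1, ha.2.2.trans h⟩

section
variable {n : ℕ} {M : Type*} [TopologicalSpace M] [T2Space M] [ChartedSpace (Euc n) M]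
  [IsManifold (𝓡 n) ∞ M]

/-- Where `a = 1` the field has constant coefficients, so the divergence is a plain derivative. -/
theorem divTest_coordField (e : Chart n M) {a : Euc n → ℝ} (ha : IsTest e.1.target a) (i : Fin n)
    {ψ : 𝓓(e.range, ℝ)} (hψ : ∀ x, ψ x ≠ 0 → a x = 1) (x : Euc n) :
    divTest (coordField e ha (unitVec i)) e ψ x = fderiv ℝ ψ x (unitVec i) := by
  rw [divTest_apply]
  have h1 : ∀ j : Fin n, (fun y => ψ y * vfCoord e.1 (coordField e ha (unitVec i)) y j) =
      fun y => ψ y * (unitVec i : Euc n) j := fun j => by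
    ext y
    by_cases hy : ψ y = 0
    · simp [hy]
    · have hy' : y ∈ e.1.target := ψ.tsupport_subset (subset_tsupport _ hy)
      rw [ScaledBGStructure.vfCoord_coordField_self e ha _ hy', hψ y hy, one_smul]
  simp only [h1]
  have hd : DifferentiableAt ℝ ψ x := ψ.contDiff.differentiable (by simp) x
  simp only [fderiv_mul_const hd, smul_apply, smul_eq_mul]
  rw [Finset.sum_eq_single i]
  · simp [unitVec]
  · intro j _ hj
    simp [unitVec, hj]
  · simp

end

namespace ScaledBGStructure
variable {n : ℕ} {M : Type*} [TopologicalSpace M] [ChartedSpace (Euc n) M] {A : Type*}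
variable (B : ScaledBGStructure n M A)

theorem cube_one_subset (α : A) : (cube n 1 : Set (Euc n)) ⊆ (B.chart α).range := by
  rw [B.range_chart]
  exact fun x hx i => (hx i).trans (by norm_num)

/-- The cutoff of the cell `β` reaches beyond `(-1,1)ⁿ`. Re-expanding in pieces supported in the
inner cubes means that estimates are needed only where `χ = 1`. -/
theorem cut_eq_sum {χ : 𝓓(cube n 2, ℝ)} (hχ : ∀ x : Euc n, (∀ i, |x i| ≤ 1) → χ x = 1) (β : A) :
    ∃ (t : Finset A) (a : A → Euc n → ℝ)
      (ha : ∀ α, IsTest (chartChange (B.chart α) (B.chart β)).source (a α)),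
      (∀ α, tsupport (a α) ⊆ cube n 1) ∧ ∀ (u : Dist n M) (φ : 𝓢(Euc n, ℂ)),
        B.cut χ β u φ = ∑ α ∈ t, B.cut χ α u
          (pullSchwartz (isDiffeo_chartChange (B.chart α) (B.chart β)) (ha α)
            (mulSchwartz (isTest χ).toSchwartz φ)) := by
  obtain ⟨t, a, ha, ha1, h⟩ := B.exists_coord_eq_sum hχ (B.chart β) (K := tsupport χ)
    χ.hasCompactSupport (by rw [B.target_chart]; exact χ.tsupport_subset)
  refine ⟨t, a, ha, ha1, fun u φ => ?_⟩
  have hs : ∀ ψ : 𝓢(Euc n, ℝ), tsupport (cutSchwartz (B.cutoff χ β) ψ) ⊆ tsupport χ := fun ψ =>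
    closure_mono (Function.support_mul_subset_left _ _)
  rw [cut_apply, cutExtend_apply, h u _ (hs _), h u _ (hs _), Finset.mul_sum, ← Finset.sum_add_distrib]
  refine Finset.sum_congr rfl fun α _ => ?_
  rw [← smul_eq_mul, ← map_smul, ← map_add]
  congr 1
  ext x
  simp only [add_apply, smul_apply, pullSchwartz_apply, IsTest.toSchwartz_apply, cutSchwartz_apply,
    cutoff_apply, mulSchwartz_apply, SchwartzMap.postcompCLM_apply, Complex.reCLM_apply,
    Complex.imCLM_apply, smul_eq_mul, Complex.real_smul]
  conv_rhs => rw [← Complex.re_add_im (φ (chartChange (B.chart α) (B.chart β) x))]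
  push_cast; ring

/-- Boundedness of the localizations of a family of distributions in `H^s`, in each unit cell. -/
def CutBdd (χ : 𝓓(cube n 2, ℝ)) {ι : Type*} (u : ι → Dist n M) (s : ℝ) : Prop :=
  ∀ α, ∃ C : ℝ, 0 ≤ C ∧ ∀ i φ, ‖B.cut χ α (u i) φ‖ ≤ C * hNorm (-s) φ

variable {B} {χ : 𝓓(cube n 2, ℝ)} {ι : Type*} {u : ι → Dist n M} {s : ℝ}

theorem CutBdd.mono (h : B.CutBdd χ u s) {s' : ℝ} (hs : s' ≤ s) : B.CutBdd χ u s' := fun α => by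
  obtain ⟨C, hC0, hC⟩ := h α
  exact ⟨C, hC0, fun i φ => (hC i φ).trans (mul_le_mul_of_nonneg_left (hNorm_mono (by linarith) φ) hC0)⟩

theorem CutBdd.of_sobolevNorm (hu : ∀ i α, TemperedDistribution.MemSobolev s 2 (B.localize χ α (u i)))
    (h : ∀ α, ∃ C, ∀ i, sobolevNorm s (B.localize χ α (u i)) ≤ C) : B.CutBdd χ u s := fun α => by
  obtain ⟨C, hC0, hC⟩ := B.exists_cut_le χ α s
  obtain ⟨D, hD⟩ := h α
  refine ⟨C * |D|, by positivity, fun i φ => (hC _ (hu i α) φ).trans ?_⟩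
  have := hNorm_nonneg (-s) φ
  gcongr
  exact (hD i).trans (le_abs_self _)

theorem CutBdd.exists_sobolevNorm_le (h : B.CutBdd χ u s) (α : A) : ∃ C, 0 ≤ C ∧ ∀ i,
    TemperedDistribution.MemSobolev s 2 (B.localize χ α (u i)) ∧
      sobolevNorm s (B.localize χ α (u i)) ≤ C := by
  obtain ⟨C, hC0, hC⟩ := h α
  obtain ⟨D, hD0, hD⟩ := B.exists_sobolevNorm_le_of_cut χ α s
  exact ⟨D * C, by positivity, fun i => hD _ C hC0 (hC i)⟩

theorem CutBdd.mulDist (h : B.CutBdd χ u s) {f : C^∞⟮𝓡 n, M; ℝ⟯} (hf : B.IsUniformFunction f) :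
    B.CutBdd χ (fun i => mulDist f (u i)) s := fun α => by
  obtain ⟨g, -, hg⟩ := B.cut_mulDist hf χ
  obtain ⟨C, hC0, hC⟩ := h α
  have h0 := fourierL1_nonneg |(-s)| (g α)
  refine ⟨C * (2 ^ (|(-s)| / 2) * fourierL1 |(-s)| (g α)), by positivity, fun i φ => ?_⟩
  rw [hg]
  refine (hC i _).trans ?_
  rw [mul_assoc]
  exact mul_le_mul_of_nonneg_left (hNorm_mulSchwartz_le _ _ _) hC0

theorem CutBdd.sum {κ : Type*} {S : Finset κ} {u : κ → ι → Dist n M}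
    (h : ∀ j ∈ S, B.CutBdd χ (u j) s) : B.CutBdd χ (fun i => ∑ j ∈ S, u j i) s := fun α => by
  have h1 : ∀ j, ∃ C : ℝ, 0 ≤ C ∧ (j ∈ S → ∀ i φ, ‖B.cut χ α (u j i) φ‖ ≤ C * hNorm (-s) φ) := fun j => by
    by_cases hj : j ∈ S
    · obtain ⟨C, hC0, hC⟩ := h j hj α
      exact ⟨C, hC0, fun _ => hC⟩
    · exact ⟨0, le_rfl, fun h' => absurd h' hj⟩
  choose C hC0 hC using h1
  refine ⟨∑ j ∈ S, C j, Finset.sum_nonneg fun j _ => hC0 j, fun i φ => ?_⟩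
  rw [map_sum, FunLike.coe_sum, Finset.sum_apply, Finset.sum_mul]
  exact (norm_sum_le _ _).trans (Finset.sum_le_sum fun j hj => hC j hj i φ)

variable [IsManifold (𝓡 n) ∞ M]

theorem CutBdd.vfAct_of_spanning {F : Finset B.coefficientVF} (hF : B.IsSpanning F)
    (h : ∀ W ∈ F, B.CutBdd χ (fun i => vfAct W.1 (u i)) s) {Z : SmoothVF n M}
    (hZ : Z ∈ B.coefficientVF) : B.CutBdd χ (fun i => vfAct Z (u i)) s := by
  obtain ⟨f, hf, hZf⟩ := B.exists_vfAct_eq_sum hF hZ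
  simp only [hZf]
  exact CutBdd.sum fun W hW => (h W hW).mulDist (hf W)

variable [T2Space M]

/-- Integration by parts. Functions supported in `(-1,1)ⁿ` do not see `χ`, so no derivative falls on
the cutoff. -/
theorem cut_vfAct_coordField (hχ : ∀ x : Euc n, (∀ i, |x i| ≤ 1) → χ x = 1) (α : A)
    {κ a : Euc n → ℝ} (hκ : IsTest (cube n 1 : Set (Euc n)) κ) (ha : IsTest (B.chart α).1.target a)
    (hκa : ∀ x ∈ tsupport κ, a x = 1) (i : Fin n) (u : Dist n M) (φ : 𝓢(Euc n, ℂ)) :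
    B.cut χ α (vfAct (coordField (B.chart α) ha (unitVec i)) u) (mulSchwartz hκ.toSchwartz φ) =
      - B.cut χ α u (∂_{(unitVec i : Euc n)} (mulSchwartz hκ.toSchwartz φ)) := by
  have hκ' := hκ.mono (B.cube_one_subset α)
  have h1 := hκ'.mul_contDiff (Complex.reCLM.contDiff.comp (φ.smooth ⊤))
  have h2 := hκ'.mul_contDiff (Complex.imCLM.contDiff.comp (φ.smooth ⊤))
  have hs : ∀ x, κ x ≠ 0 → χ x = 1 := fun x hx =>
    hχ x fun i => (hκ.2.2 (subset_tsupport _ hx) i).le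
  have hsupp : ∀ g : Euc n → ℝ, ∀ x, κ x * g x ≠ 0 → a x = 1 := fun g x hx =>
    hκa x (subset_tsupport _ (left_ne_zero_of_mul hx))
  rw [cut_apply, cutExtend_eq _ _ (ψ₁ := h1.toTest) (ψ₂ := h2.toTest) fun x => ?_, vfAct_coord,
    vfAct_coord, cut_apply, cutExtend_eq _ _
      (ψ₁ := divTest (coordField (B.chart α) ha (unitVec i)) (B.chart α) h1.toTest)
      (ψ₂ := divTest (coordField (B.chart α) ha (unitVec i)) (B.chart α) h2.toTest) fun x => ?_]
  · ring
  · rw [divTest_coordField _ _ _ (hsupp _), divTest_coordField _ _ _ (hsupp _), cutoff_apply,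
      SchwartzMap.lineDerivOp_apply_eq_fderiv]
    have hd1 : DifferentiableAt ℝ h1.toTest x := h1.1.differentiable (by simp) x
    have hd2 : DifferentiableAt ℝ h2.toTest x := h2.1.differentiable (by simp) x
    have h3 : (mulSchwartz hκ.toSchwartz φ : Euc n → ℂ) = fun y =>
        Complex.ofRealCLM (h1.toTest y) + Complex.ofRealCLM (h2.toTest y) * Complex.I := by
      ext y
      simp only [mulSchwartz_apply, IsTest.toSchwartz_apply, IsTest.toTest_apply,
        Complex.ofRealCLM_apply, Function.comp, Complex.reCLM_apply, Complex.imCLM_apply]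
      conv_lhs => rw [← Complex.re_add_im (φ y)]
      push_cast; ring
    have h4 : fderiv ℝ (mulSchwartz hκ.toSchwartz φ) x (unitVec i) =
        fderiv ℝ h1.toTest x (unitVec i) + fderiv ℝ h2.toTest x (unitVec i) * Complex.I := by
      have h8 := ((Complex.ofRealCLM.hasFDerivAt.comp x hd1.hasFDerivAt).add
        ((Complex.ofRealCLM.hasFDerivAt.comp x hd2.hasFDerivAt).mul_const Complex.I)).fderiv
      rw [h3]
      refine (congrArg (fun L => L (unitVec i)) h8).trans ?_
      simp [mul_comm]
    have key : (χ x : ℂ) * (fderiv ℝ h1.toTest x (unitVec i) + fderiv ℝ h2.toTest x (unitVec i) * Complex.I)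
        = fderiv ℝ h1.toTest x (unitVec i) + fderiv ℝ h2.toTest x (unitVec i) * Complex.I := by
      by_cases hx : x ∈ tsupport κ
      · rw [hχ x fun i => (hκ.2.2 hx i).le]; simp
      · have h5 : ∀ g : Euc n → ℝ, fderiv ℝ (fun y => κ y * g y) x (unitVec i) = 0 := fun g => by
          rw [fderiv_of_notMem_tsupport (𝕜 := ℝ) fun h =>
            hx (closure_mono (Function.support_mul_subset_left _ _) h)]
          rfl
        have h6 : fderiv ℝ h1.toTest x (unitVec i) = 0 := h5 _
        have h7 : fderiv ℝ h2.toTest x (unitVec i) = 0 := h5 _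
        rw [h6, h7]; simp
    rw [h4]
    exact key
  · rw [cutoff_apply, mulSchwartz_apply, IsTest.toSchwartz_apply, IsTest.toTest_apply,
      IsTest.toTest_apply]
    by_cases hx : κ x = 0
    · simp [hx]
    · rw [hs x hx]
      conv_lhs => rw [← Complex.re_add_im (φ x)]
      simp only [Function.comp, Complex.reCLM_apply, Complex.imCLM_apply]
      push_cast; ring


theorem mulSchwartz_lineDeriv {κ : Euc n → ℝ} {Ω : Set (Euc n)} (hκ : IsTest Ω κ) (v : Euc n)
    (φ : 𝓢(Euc n, ℂ)) : mulSchwartz hκ.toSchwartz (∂_{v} φ) =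
      ∂_{v} (mulSchwartz hκ.toSchwartz φ) - mulSchwartz (hκ.fderiv_apply v).toSchwartz φ := by
  ext x
  rw [sub_apply, mulSchwartz_apply, mulSchwartz_apply, SchwartzMap.lineDerivOp_apply_eq_fderiv,
    SchwartzMap.lineDerivOp_apply_eq_fderiv]
  have h1 : HasFDerivAt (fun y => (κ y : ℂ)) (Complex.ofRealCLM.comp (fderiv ℝ κ x)) x :=
    Complex.ofRealCLM.hasFDerivAt.comp x (hκ.1.differentiable (by simp) x).hasFDerivAt
  have h2 := (h1.mul (φ.differentiableAt (x := x)).hasFDerivAt).fderiv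
  have h3 : (mulSchwartz hκ.toSchwartz φ : Euc n → ℂ) = (fun y => (κ y : ℂ)) * φ := by
    ext y; rfl
  rw [h3, h2]
  simp only [IsTest.toSchwartz_apply, add_apply, smul_apply, smul_eq_mul,
    ContinuousLinearMap.comp_apply, Complex.ofRealCLM_apply]
  ring

/-- Regularity under `𝒲` improves the localizations by one order in the interior of a unit cell. -/
theorem CutBdd.exists_cut_mulSchwartz_le (hχ : ∀ x : Euc n, (∀ i, |x i| ≤ 1) → χ x = 1)
    (h : B.CutBdd χ u s)
    (hW : ∀ Z ∈ B.coefficientVF, B.CutBdd χ (fun i => vfAct Z (u i)) s) (α : A) {κ : Euc n → ℝ}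
    (hκ : IsTest (cube n 1 : Set (Euc n)) κ) :
    ∃ C, 0 ≤ C ∧ ∀ i φ, ‖B.cut χ α (u i) (mulSchwartz hκ.toSchwartz φ)‖ ≤ C * hNorm (-s - 1) φ := by
  obtain ⟨a, ha, ha1⟩ := exists_isTest_eq_one (B.chart α).1.open_target hκ.2.1
    (hκ.2.2.trans (B.cube_one_subset α))
  obtain ⟨C, hC0, hC⟩ := h α
  choose D hD0 hD using fun j : Fin n => hW _ (B.coordField_mem α ha (unitVec j)) α
  have hL : ∀ g : 𝓢(Euc n, ℂ), ∃ L : ℝ, 0 ≤ L ∧ ∀ φ, hNorm (-s) (mulSchwartz g φ) ≤ L * hNorm (-s) φ :=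
    fun g => ⟨_, mul_nonneg (by positivity) (fourierL1_nonneg _ g), hNorm_mulSchwartz_le (-s) g⟩
  obtain ⟨L, hL0, hL1⟩ := hL hκ.toSchwartz
  choose L' hL'0 hL'1 using fun j : Fin n => hL (hκ.fderiv_apply (unitVec j)).toSchwartz
  set c : ℝ := (4 * Real.pi ^ 2)⁻¹ with hc
  have hc0 : 0 ≤ c := by positivity
  refine ⟨C * L + c * ∑ j : Fin n, (D j * L + C * L' j) * (2 * Real.pi * ‖(unitVec j : Euc n)‖), ?_, fun i φ => ?_⟩
  · refine add_nonneg (by positivity) (mul_nonneg hc0 (Finset.sum_nonneg fun j _ => ?_))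
    have := hD0 j; have := hL'0 j
    positivity
  -- `θ` is two orders more regular than `φ`, and `φ = (1 - Δ/(4π²)) θ`. One of the two derivatives
  -- in `Δ` is moved onto `u i`, where `hW` controls it. What remains are first derivatives of `θ`
  -- in `H^{-s}`, bounded by `φ` in `H^{-s-1}`.
  set θ := besselSchwartz (-2) φ with hθ
  have hφ : φ = θ - c • ∑ j : Fin n, ∂_{unitVec j} (∂_{unitVec j} θ) := by
    rw [← besselSchwartz_two, hθ, besselSchwartz_besselSchwartz]
    norm_num
  have e1 : mulSchwartz hκ.toSchwartz φ = mulSchwartz hκ.toSchwartz θ -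
      (c : ℂ) • ∑ j : Fin n, (∂_{unitVec j} (mulSchwartz hκ.toSchwartz (∂_{unitVec j} θ)) -
        mulSchwartz (hκ.fderiv_apply (unitVec j)).toSchwartz (∂_{unitVec j} θ)) := by
    conv_lhs => rw [hφ]
    rw [map_sub, show c • ∑ j : Fin n, ∂_{unitVec j} (∂_{unitVec j} θ) =
      (c : ℂ) • ∑ j : Fin n, ∂_{unitVec j} (∂_{unitVec j} θ) by ext x; simp, map_smul, map_sum]
    simp only [mulSchwartz_lineDeriv]
  have e2 : B.cut χ α (u i) (mulSchwartz hκ.toSchwartz φ) =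
      B.cut χ α (u i) (mulSchwartz hκ.toSchwartz θ) + (c : ℂ) * ∑ j : Fin n,
        (B.cut χ α (vfAct (coordField (B.chart α) ha (unitVec j)) (u i))
            (mulSchwartz hκ.toSchwartz (∂_{unitVec j} θ)) +
          B.cut χ α (u i) (mulSchwartz (hκ.fderiv_apply (unitVec j)).toSchwartz (∂_{unitVec j} θ))) := by
    rw [e1, map_sub, map_smul, map_sum, smul_eq_mul, sub_eq_add_neg, ← mul_neg, ← Finset.sum_neg_distrib]
    congr 2
    refine Finset.sum_congr rfl fun j _ => ?_
    rw [map_sub, cut_vfAct_coordField hχ α hκ ha ha1]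
    ring
  have hθ0 : hNorm (-s) θ ≤ hNorm (-s - 1) φ := by
    rw [hθ, hNorm_besselSchwartz]; exact hNorm_mono (by linarith) φ
  have hθ1 : ∀ j : Fin n, hNorm (-s) (∂_{unitVec j} θ) ≤
      2 * Real.pi * ‖(unitVec j : Euc n)‖ * hNorm (-s - 1) φ := fun j => by
    refine (hNorm_lineDeriv_le _ _ _).trans_eq ?_
    rw [hθ, hNorm_besselSchwartz]
    congr 2; ring
  have hN := hNorm_nonneg (-s - 1) φ
  rw [e2, add_mul]
  refine (norm_add_le _ _).trans (add_le_add ?_ ?_)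
  · refine (hC i _).trans ?_
    rw [mul_assoc]
    exact mul_le_mul_of_nonneg_left ((hL1 _).trans (mul_le_mul_of_nonneg_left hθ0 hL0)) hC0
  · rw [norm_mul, Complex.norm_real, Real.norm_of_nonneg hc0, mul_assoc]
    refine mul_le_mul_of_nonneg_left ?_ hc0
    rw [Finset.sum_mul]
    refine (norm_sum_le _ _).trans (Finset.sum_le_sum fun j _ => ?_)
    calc _ ≤ D j * (L * hNorm (-s) (∂_{unitVec j} θ)) + C * (L' j * hNorm (-s) (∂_{unitVec j} θ)) :=
          (norm_add_le _ _).trans (add_le_add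
            ((hD j i _).trans (mul_le_mul_of_nonneg_left (hL1 _) (hD0 j)))
            ((hC i _).trans (mul_le_mul_of_nonneg_left (hL'1 j _) hC0)))
      _ = (D j * L + C * L' j) * hNorm (-s) (∂_{unitVec j} θ) := by ring
      _ ≤ (D j * L + C * L' j) * (2 * Real.pi * ‖(unitVec j : Euc n)‖ * hNorm (-s - 1) φ) := by
          refine mul_le_mul_of_nonneg_left (hθ1 j) ?_
          have := hD0 j; have := hL'0 j
          positivity
      _ = _ := by ring

/-- Regularity under `𝒲` improves the local regularity by one order. -/
theorem CutBdd.gain (hχ : ∀ x : Euc n, (∀ i, |x i| ≤ 1) → χ x = 1) (h : B.CutBdd χ u s)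
    (hW : ∀ Z ∈ B.coefficientVF, B.CutBdd χ (fun i => vfAct Z (u i)) s) {m : ℤ} (hm : m ≤ s + 1) :
    B.CutBdd χ u m := fun β => by
  obtain ⟨t, a, ha, ha1, hcut⟩ := B.cut_eq_sum hχ β
  choose κ hκ hκ1 using fun α => exists_isTest_eq_one (cube n 1).isOpen (ha α).2.1 (ha1 α)
  choose C hC0 hC using fun α => h.exists_cut_mulSchwartz_le hχ hW α (hκ α)
  choose D hD0 hD using fun α =>
    exists_hNorm_pullSchwartz_le (isDiffeo_chartChange (B.chart α) (B.chart β)) (-m) (ha α)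
  set L := 2 ^ (|-(m : ℝ)| / 2) * fourierL1 |-(m : ℝ)| (isTest χ).toSchwartz with hL
  have hL0 : 0 ≤ L := mul_nonneg (by positivity) (fourierL1_nonneg _ _)
  refine ⟨(∑ α ∈ t, C α * D α) * L, mul_nonneg (Finset.sum_nonneg fun α _ =>
    mul_nonneg (hC0 α) (hD0 α)) hL0, fun i φ => ?_⟩
  rw [hcut, mul_assoc, Finset.sum_mul]
  refine (norm_sum_le _ _).trans (Finset.sum_le_sum fun α _ => ?_)
  set ψ := pullSchwartz (isDiffeo_chartChange (B.chart α) (B.chart β)) (ha α)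
    (mulSchwartz (isTest χ).toSchwartz φ) with hψ
  -- `κ α` equals one on the support of `a α`, so it can be inserted to make the interior estimate
  -- applicable.
  have h1 : ψ = mulSchwartz (hκ α).toSchwartz ψ := by
    ext x
    rw [mulSchwartz_apply, IsTest.toSchwartz_apply]
    by_cases hx : x ∈ tsupport (a α)
    · rw [hκ1 α x hx]; simp
    · rw [hψ, pullSchwartz_apply, image_eq_zero_of_notMem_tsupport hx]; simp
  have h2 := hD α (mulSchwartz (isTest χ).toSchwartz φ)
  rw [Int.cast_neg] at h2
  rw [h1]
  calc _ ≤ C α * hNorm (-s - 1) ψ := hC α i ψ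
    _ ≤ C α * (D α * (L * hNorm (-m) φ)) := by
        refine mul_le_mul_of_nonneg_left ?_ (hC0 α)
        -- By `hm`, `-s - 1 ≤ -m`; the change of coordinates is then estimated in the integer order
        -- `-m`.
        refine (hNorm_mono (by linarith) ψ).trans (h2.trans ?_)
        exact mul_le_mul_of_nonneg_left (hNorm_mulSchwartz_le _ _ _) (hD0 α)
    _ = _ := by ring

end ScaledBGStructure
end
end ScaledBG

/-! ### Unit cells and weights at infinity -/

namespace ScaledBG
noncomputable section
open Filter
open scoped FourierTransform
open FourierTransform

theorem convex_cube (n : ℕ) (r : ℝ) : Convex ℝ (cube n r : Set (Euc n)) := by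
  intro x hx y hy a b ha hb hab i
  calc |a * x i + b * y i| ≤ |a * x i| + |b * y i| := abs_add_le _ _
    _ = a * |x i| + b * |y i| := by rw [abs_mul, abs_mul, abs_of_nonneg ha, abs_of_nonneg hb]
    _ < r := by
        rcases ha.eq_or_lt with rfl | ha'
        · obtain rfl : b = 1 := by linarith
          simpa using hy i
        · have h1 := mul_lt_mul_of_pos_left (hx i) ha'
          have h2 := mul_le_mul_of_nonneg_left (hy i).le hb
          calc _ < a * r + b * r := by linarith
            _ = r := by rw [← add_mul, hab, one_mul]

/-- A square-summable bounded family which converges to zero pointwise converges to zero in `ℓ²`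
after multiplication by a null sequence. -/
theorem tendsto_tsum_mul_of_cofinite {A : Type*} {r : A → ℝ} (hr : Tendsto r cofinite (𝓝 0))
    (hr0 : ∀ α, 0 ≤ r α) {e : ℕ → A → ℝ} (he0 : ∀ j α, 0 ≤ e j α) (hes : ∀ j, Summable (e j)) {C : ℝ}
    (hC : ∀ j, ∑' α, e j α ≤ C) (he : ∀ α, Tendsto (fun j => e j α) atTop (𝓝 0)) :
    Tendsto (fun j => ∑' α, r α * e j α) atTop (𝓝 0) := by
  classical
  obtain ⟨R, hR⟩ := hr.bddAbove_range_of_cofinite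
  have hR' : ∀ α, r α ≤ R := fun α => hR ⟨α, rfl⟩
  have hs : ∀ j, Summable fun α => r α * e j α := fun j =>
    Summable.of_nonneg_of_le (fun α => mul_nonneg (hr0 α) (he0 j α))
      (fun α => mul_le_mul_of_nonneg_right (hR' α) (he0 j α)) ((hes j).mul_left R)
  have hC0 : 0 ≤ C := (tsum_nonneg (he0 0)).trans (hC 0)
  rw [Metric.tendsto_atTop]
  intro ε hε
  -- Off this finite set the sum is at most `ε / (2 (C + 1)) * C ≤ ε / 2` for every `j`; on it,
  -- termwise convergence suffices. `C + 1` avoids division by zero.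
  have h1 : {α | ¬ r α < ε / (2 * (C + 1))}.Finite :=
    hr.eventually (gt_mem_nhds (by positivity))
  have h2 : Tendsto (fun j => ∑ α ∈ h1.toFinset, r α * e j α) atTop (𝓝 0) := by
    simpa using tendsto_finsetSum h1.toFinset fun α _ => (he α).const_mul (r α)
  obtain ⟨N, hN⟩ := (h2.eventually (gt_mem_nhds (half_pos hε))).exists_forall_of_atTop
  refine ⟨N, fun j hj => ?_⟩
  rw [Real.dist_eq, sub_zero, abs_of_nonneg (tsum_nonneg fun α => mul_nonneg (hr0 α) (he0 j α)),
    ← (hs j).sum_add_tsum_compl (s := h1.toFinset)]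
  have h3 : ∑' α : ↑((h1.toFinset : Set A)ᶜ), r α * e j α ≤ ε / (2 * (C + 1)) * C := by
    calc _ ≤ ∑' α : ↑((h1.toFinset : Set A)ᶜ), ε / (2 * (C + 1)) * e j α := by
          refine ((hs j).subtype _).tsum_le_tsum (fun α => ?_) (((hes j).mul_left _).subtype _)
          refine mul_le_mul_of_nonneg_right ?_ (he0 j α)
          have := α.2
          simp only [Set.Finite.coe_toFinset, mem_compl_iff, mem_ofPred_eq, not_not] at this
          exact this.le
      _ ≤ ∑' α, ε / (2 * (C + 1)) * e j α :=
          Summable.tsum_subtype_le _ _ (fun α => mul_nonneg (by positivity) (he0 j α)) ((hes j).mul_left _)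
      _ ≤ _ := by
          rw [tsum_mul_left]
          exact mul_le_mul_of_nonneg_left (hC j) (by positivity)
  have h4 : ε / (2 * (C + 1)) * C ≤ ε / 2 := by
    rw [div_mul_eq_mul_div, div_le_div_iff₀ (by positivity) (by positivity)]
    nlinarith
  linarith [hN j hj]

namespace ScaledBGStructure
variable {n : ℕ} {M : Type*} [TopologicalSpace M] [ChartedSpace (Euc n) M] {A : Type*}
variable (B : ScaledBGStructure n M A)

/-- The center `φ_α⁻¹(0)` of a unit cell. -/
def center (α : A) : M := (B.chart α).1.symm 0

theorem zero_mem_target (α : A) : (0 : Euc n) ∈ (B.chart α).1.target := by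
  rw [B.target_chart]; intro i; simp

theorem center_mem_source (α : A) : B.center α ∈ (B.chart α).1.source :=
  (B.chart α).1.map_target (B.zero_mem_target α)

theorem chart_center (α : A) : (B.chart α).1 (B.center α) = 0 :=
  (B.chart α).1.right_inv (B.zero_mem_target α)

theorem finite_setOf_mem_source (p : M) : {α | p ∈ (B.chart α).1.source}.Finite := by
  obtain ⟨N, hN⟩ := B.finite_overlap
  by_contra h
  obtain ⟨t, ht, htc⟩ := Set.Infinite.exists_subset_card_eq h (N + 1)
  have : p ∈ ⋂ α ∈ t, (B.chart α).1.source := mem_iInter₂.2 fun α hα => ht hα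
  rw [hN t htc] at this
  exact this

variable [T2Space M]

/-- Seen in a fixed cell around `p`, the bumps `θ ∘ φ_α` have gradients bounded uniformly in `α`,
and each equals one at the centre of its cell. If the centre is close enough to `p`, the bump is
nonzero at `p`, so `p ∈ U_α`; by finite overlap this happens for finitely many `α` only. -/
theorem exists_nhds_finite_center (p : M) : ∃ V ∈ 𝓝 p, {α | B.center α ∈ V}.Finite := by
  obtain ⟨β, hpβ, -⟩ := B.cover p
  obtain ⟨θ, hθ, hθ1⟩ := exists_isTest_eq_one (cube n 2).isOpen (isCompact_singleton (x := (0 : Euc n)))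
    (singleton_subset_iff.2 fun i => by simp)
  have h2 : UnifBdd (fun α => (chartChange (B.chart β) (B.chart α)).source)
      fun α x => θ (chartChange (B.chart β) (B.chart α) x) :=
    (UnifBdd.of_isTest (Ω := fun _ : A => univ) (fun _ => isOpen_univ) hθ).comp
      (.of_components (fun j => B.unifBdd_chartChange j (fun _ : A => β) id)
        fun _ => (chartChange _ _).open_source) fun _ => mapsTo_univ _ _
  obtain ⟨C, hC⟩ := h2.bound 1
  set f : A → Euc n → ℝ := fun α => (chartChange (B.chart β) (B.chart α)).source.indicator
    fun x => θ (chartChange (B.chart β) (B.chart α) x) with hf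
  have hd : ∀ α, ∀ x ∈ (B.chart β).1.target, DifferentiableAt ℝ (f α) x ∧ ‖fderiv ℝ (f α) x‖ ≤ |C| := by
    intro α x hx
    by_cases hx' : x ∈ (chartChange (B.chart β) (B.chart α)).source
    · have he : f α =ᶠ[𝓝 x] fun x => θ (chartChange (B.chart β) (B.chart α) x) := by
        filter_upwards [(chartChange (B.chart β) (B.chart α)).open_source.mem_nhds hx'] with z hz
        exact indicator_of_mem hz _
      refine ⟨((h2.contDiffAt hx').differentiableAt (by simp)).congr_of_eventuallyEq he, ?_⟩
      rw [he.fderiv_eq, ← norm_iteratedFDeriv_one]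
      exact (hC α x hx').trans (le_abs_self _)
    · have hp : (B.chart β).1.symm x ∉ (B.chart α).1.source := fun h =>
        hx' (by rw [chartChange_source]; exact ⟨hx, h⟩)
      have hθα : tsupport θ ⊆ (B.chart α).1.target := by rw [B.target_chart]; exact hθ.2.2
      have hK : IsCompact ((B.chart α).1.symm '' tsupport θ) :=
        hθ.2.1.isCompact.image_of_continuousOn ((B.chart α).1.continuousOn_symm.mono hθα)
      have hp' : (B.chart β).1.symm x ∉ (B.chart α).1.symm '' tsupport θ := by
        rintro ⟨z, hz, h⟩; exact hp (h ▸ (B.chart α).1.map_target (hθα hz))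
      have he : f α =ᶠ[𝓝 x] fun _ => 0 := by
        filter_upwards [((B.chart β).1.continuousAt_symm hx).preimage_mem_nhds
          (hK.isClosed.isOpen_compl.mem_nhds hp')] with z hz
        by_cases hz' : z ∈ (chartChange (B.chart β) (B.chart α)).source
        · rw [hf]; dsimp only
          rw [indicator_of_mem hz']
          refine image_eq_zero_of_notMem_tsupport fun h => hz ⟨_, h, ?_⟩
          rw [chartChange_source] at hz'
          exact (B.chart α).1.left_inv hz'.2
        · exact indicator_of_notMem hz' _
      refine ⟨(differentiableAt_const _).congr_of_eventuallyEq he, ?_⟩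
      rw [he.fderiv_eq]
      simp
  -- With radius `1 / (|C| + 1)`, the mean value inequality on the convex cube keeps the variation
  -- of `f α` below one.
  refine ⟨(B.chart β).1.source ∩ (B.chart β).1 ⁻¹' Metric.ball ((B.chart β).1 p) (1 / (|C| + 1)),
    inter_mem ((B.chart β).1.open_source.mem_nhds hpβ)
      (((B.chart β).1.continuousAt hpβ).preimage_mem_nhds (Metric.ball_mem_nhds _ (by positivity))),
    (B.finite_setOf_mem_source p).subset ?_⟩
  rintro α ⟨hα1, hα2⟩
  have hc0 : (B.chart β).1 (B.center α) ∈ (B.chart β).1.target := (B.chart β).1.map_source hα1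
  have hc1 : (B.chart β).1 p ∈ (B.chart β).1.target := (B.chart β).1.map_source hpβ
  have hconv : Convex ℝ (B.chart β).1.target := by rw [B.target_chart]; exact convex_cube n 2
  have hmv := hconv.norm_image_sub_le_of_norm_fderiv_le (f := f α) (fun x hx => (hd α x hx).1)
    (fun x hx => (hd α x hx).2) hc0 hc1
  have hf0 : f α ((B.chart β).1 (B.center α)) = 1 := by
    have hs : (B.chart β).1 (B.center α) ∈ (chartChange (B.chart β) (B.chart α)).source := by
      rw [chartChange_source]
      refine ⟨hc0, ?_⟩
      rw [mem_preimage, (B.chart β).1.left_inv hα1]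
      exact B.center_mem_source α
    rw [hf]; dsimp only
    rw [indicator_of_mem hs, chartChange, OpenPartialHomeomorph.coe_trans, Function.comp_apply,
      (B.chart β).1.left_inv hα1, B.chart_center]
    exact hθ1 0 rfl
  rw [mem_preimage, Metric.mem_ball, dist_comm, dist_eq_norm, lt_div_iff₀ (by positivity)] at hα2
  have h5 : ‖f α ((B.chart β).1 p) - 1‖ < 1 := by
    rw [hf0] at hmv
    refine hmv.trans_lt ?_
    nlinarith [norm_nonneg ((B.chart β).1 p - (B.chart β).1 (B.center α)), abs_nonneg C]
  have h6 : (B.chart β).1 p ∈ (chartChange (B.chart β) (B.chart α)).source := by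
    by_contra h
    rw [hf] at h5; dsimp only at h5
    rw [indicator_of_notMem h] at h5
    norm_num at h5
  rw [chartChange_source] at h6
  have h7 := h6.2
  rwa [mem_preimage, (B.chart β).1.left_inv hpβ] at h7

/-- Only finitely many unit cells are centered in a given compact set. -/
theorem tendsto_center : Tendsto B.center cofinite (cocompact M) := by
  rw [(hasBasis_cocompact (X := M)).tendsto_right_iff]
  intro K hK
  choose V hV hVf using B.exists_nhds_finite_center
  obtain ⟨t, -, ht⟩ := hK.elim_nhds_subcover V fun p _ => hV p
  rw [eventually_cofinite]
  refine (t.finite_toSet.biUnion fun p _ => hVf p).subset fun α hα => ?_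
  rw [mem_ofPred_eq, mem_compl_iff, not_not] at hα
  obtain ⟨p, hp, h⟩ := mem_iUnion₂.1 (ht hα)
  exact mem_iUnion₂.2 ⟨p, hp, h⟩

variable [IsManifold (𝓡 n) ∞ M]

/-- Both families are compared with their weights at the centre of each cell, which lies in `U'_α`
and leaves every compact set. -/
theorem tendsto_weight_ratio {w w' : M → ℝ} (hw : B.IsWeight w) (hw' : B.IsWeight w')
    (hlim : Tendsto (fun p => w p / w' p) (cocompact M) (𝓝 0))
    {v v' : B.WeightFamily} (hv : v.Equivalent w) (hv' : v'.Equivalent w') :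
    Tendsto (fun α => v.val α / v'.val α) cofinite (𝓝 0) := by
  obtain ⟨C, hC⟩ := hv
  obtain ⟨C', hC'⟩ := hv'
  have h1 : Tendsto (fun α => |C| * |C'| * (w (B.center α) / w' (B.center α))) cofinite (𝓝 0) := by
    simpa using (hlim.comp B.tendsto_center).const_mul (|C| * |C'|)
  refine squeeze_zero (fun α => (div_pos (v.pos α) (v'.pos α)).le) (fun α => ?_) h1
  have hin : B.center α ∈ B.innerCell α := ⟨B.center_mem_source α, by
    rw [B.chart_center]; intro i; simp⟩
  have hp := hw.2.1 (B.center α)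
  have hp' := hw'.2.1 (B.center α)
  rw [← mul_div_assoc, div_le_div_iff₀ (v'.pos α) hp']
  have h2 : v.val α ≤ |C| * w (B.center α) := (hC α _ hin).2.trans
    (mul_le_mul_of_nonneg_right (le_abs_self _) hp.le)
  have h3 : w' (B.center α) ≤ |C'| * v'.val α := (hC' α _ hin).1.trans
    (mul_le_mul_of_nonneg_right (le_abs_self _) (v'.pos α).le)
  calc _ ≤ |C| * w (B.center α) * (|C'| * v'.val α) := by
        gcongr
    _ = _ := by ring

end ScaledBGStructure
end
end ScaledBG

/-! ### From local to global convergence of subsequences -/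

namespace ScaledBG
noncomputable section
open Filter
open scoped FourierTransform
open FourierTransform

theorem MemSobolev.of_le {n : ℕ} {s s' : ℝ} (hs : s' ≤ s) {T : 𝓢'(Euc n, ℂ)}
    (h : TemperedDistribution.MemSobolev s 2 T) :
    TemperedDistribution.MemSobolev s' 2 T ∧ sobolevNorm s' T ≤ sobolevNorm s T :=
  memSobolev_of_bound (sobolevNorm_nonneg _ _) fun φ => (MemSobolev.norm_apply_le h φ).trans
    (mul_le_mul_of_nonneg_left (hNorm_mono (by linarith) φ) (sobolevNorm_nonneg _ _))

theorem tendsto_toTemperedDistribution_apply {n : ℕ} {f : ℕ → Lp ℂ 2 (volume : Measure (Euc n))}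
    {a : Lp ℂ 2 (volume : Measure (Euc n))} (h : Tendsto f atTop (𝓝 a)) (φ : 𝓢(Euc n, ℂ)) :
    Tendsto (fun j => (f j : 𝓢'(Euc n, ℂ)) φ) atTop (𝓝 ((a : 𝓢'(Euc n, ℂ)) φ)) := by
  rw [tendsto_iff_norm_sub_tendsto_zero] at h ⊢
  refine squeeze_zero (fun _ => norm_nonneg _) (fun j => ?_)
    (by simpa using h.const_mul ‖φ.toLp 2 (volume : Measure (Euc n))‖)
  have h1 : (f j : 𝓢'(Euc n, ℂ)) φ - (a : 𝓢'(Euc n, ℂ)) φ =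
      ((f j - a : Lp ℂ 2 (volume : Measure (Euc n))) : 𝓢'(Euc n, ℂ)) φ := by
    simp only [← Lp.toTemperedDistributionCLM_apply, map_sub, sub_apply]
  rw [h1, Lp.toTemperedDistribution_apply]
  exact (norm_integral_le_integral_norm _).trans (norm_integral_smul_Lp_le φ _)

/-- Convergence in `L²` implies convergence as tempered distributions, where limits are unique. -/
theorem besselPotential_eq_of_tendsto {n : ℕ} {s : ℝ} {T : ℕ → 𝓢'(Euc n, ℂ)} {T' : 𝓢'(Euc n, ℂ)}
    {f : ℕ → Lp ℂ 2 (volume : Measure (Euc n))} {a : Lp ℂ 2 (volume : Measure (Euc n))}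
    (hT : ∀ φ, Tendsto (fun j => T j φ) atTop (𝓝 (T' φ)))
    (hf : ∀ j, TemperedDistribution.besselPotential (Euc n) ℂ s (T j) = f j)
    (h : Tendsto f atTop (𝓝 a)) : TemperedDistribution.besselPotential (Euc n) ℂ s T' = a := by
  ext φ
  refine tendsto_nhds_unique ?_ (tendsto_toTemperedDistribution_apply h φ)
  simp only [← hf, besselPotential_apply_apply]
  exact hT _

/-- A criterion for the compactness of an inclusion in terms of sequences. -/
theorem isCompactInclusion_of_subseq {V : Type*} [AddCommGroup V] [Module ℂ V] {X Y : Submodule ℂ V}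
    {p : Seminorm ℂ X} {q : Seminorm ℂ Y} (h : X ≤ Y)
    (H : ∀ x : ℕ → X, (∀ j, p (x j) ≤ 1) → ∃ (y : Y) (φ : ℕ → ℕ), StrictMono φ ∧
      Tendsto (fun j => q (Submodule.inclusion h (x (φ j)) - y)) atTop (𝓝 0)) :
    IsCompactInclusion p q := by
  refine ⟨h, ?_⟩
  let := p.toAddGroupSeminorm.toSeminormedAddCommGroup
  let := q.toAddGroupSeminorm.toSeminormedAddCommGroup
  refine ⟨closure (Submodule.inclusion h '' Metric.ball 0 1), isCompact_closure_of_subseq fun y hy => ?_,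
    mem_of_superset (Metric.ball_mem_nhds 0 one_pos) fun x hx => subset_closure ⟨x, hx, rfl⟩⟩
  choose x hx hxy using hy
  obtain ⟨z, φ, hφ, hz⟩ := H x fun j => by
    have := hx j
    rw [mem_ball_zero_iff] at this
    exact this.le
  refine ⟨z, φ, hφ, ?_⟩
  rw [tendsto_iff_norm_sub_tendsto_zero]
  refine hz.congr fun j => ?_
  rw [Function.comp_apply, ← hxy]
  rfl

namespace ScaledBGStructure
variable {n : ℕ} {M : Type*} [TopologicalSpace M] [ChartedSpace (Euc n) M] {A : Type*}
variable {B : ScaledBGStructure n M A} {χ : 𝓓(cube n 2, ℝ)} {v v' : B.WeightFamily} {s s' : ℝ}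

theorem localNorm_eq_ratio_mul (u : Dist n M) (α : A) :
    B.localNorm χ v' s u α = v.val α / v'.val α * B.localNorm χ v s u α := by
  rw [localNorm, localNorm]
  have := (v.pos α).ne'
  field_simp

theorem localNorm_mono (hs : s' ≤ s) {u : Dist n M} {α : A}
    (h : TemperedDistribution.MemSobolev s 2 (B.localize χ α u)) :
    B.localNorm χ v s' u α ≤ B.localNorm χ v s u α :=
  mul_le_mul_of_nonneg_left (MemSobolev.of_le hs h).2 (inv_nonneg.2 (v.pos α).le)

theorem sobolevSpace_mono (hs : s' ≤ s) : B.sobolevSpace χ v s ≤ B.sobolevSpace χ v s' := fun _ hu =>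
  ⟨fun α => (MemSobolev.of_le hs (hu.1 α)).1, hu.2.of_nonneg_of_le (fun _ => sq_nonneg _) fun α =>
    pow_le_pow_left₀ (localNorm_nonneg _ _ _ _ _) (localNorm_mono hs (hu.1 α)) 2⟩

/-- A family that tends to zero along `cofinite` is bounded. -/
theorem sobolevSpace_le_of_ratio (hr : Tendsto (fun α => v.val α / v'.val α) cofinite (𝓝 0)) :
    B.sobolevSpace χ v s ≤ B.sobolevSpace χ v' s := fun _ hu => by
  obtain ⟨R, hR⟩ := hr.bddAbove_range_of_cofinite
  refine ⟨hu.1, (hu.2.mul_left (R ^ 2)).of_nonneg_of_le (fun _ => sq_nonneg _) fun α => ?_⟩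
  rw [localNorm_eq_ratio_mul (v := v), mul_pow]
  exact mul_le_mul_of_nonneg_right
    (pow_le_pow_left₀ (div_pos (v.pos α) (v'.pos α)).le (hR ⟨α, rfl⟩) 2) (sq_nonneg _)

theorem sobolevSeminorm_eq (u : B.sobolevSpace χ v s) :
    B.sobolevSeminorm χ v s u = √(∑' α, B.localNorm χ v s u.1 α ^ 2) := rfl

theorem tsum_localNorm_sq_le {u : B.sobolevSpace χ v s} {C : ℝ} (hC : 0 ≤ C)
    (h : B.sobolevSeminorm χ v s u ≤ C) : ∑' α, B.localNorm χ v s u.1 α ^ 2 ≤ C ^ 2 := by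
  rwa [sobolevSeminorm_eq, Real.sqrt_le_left hC] at h

theorem CutBdd.of_sobolevSeminorm {ι : Type*} {u : ι → Dist n M}
    (hu : ∀ i, u i ∈ B.sobolevSpace χ v s) (h : ∀ i, B.sobolevSeminorm χ v s ⟨u i, hu i⟩ ≤ 1) :
    B.CutBdd χ u s := by
  refine .of_sobolevNorm (fun i => (hu i).1) fun α => ⟨v.val α, fun i => ?_⟩
  have h1 := tsum_localNorm_sq_le zero_le_one (h i)
  have h2 := ((hu i).2.le_tsum α fun _ _ => sq_nonneg _).trans h1
  rw [one_pow, sq_le_one_iff₀ (localNorm_nonneg _ _ _ _ _), localNorm, inv_mul_le_iff₀ (v.pos α),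
    mul_one] at h2
  exact h2

/-- Supplies the reproducing function for `isCompact_closure_bessel`: a cutoff equal to one on the
support of `χ`, in scaled coordinates. -/
theorem exists_localize_mulSchwartz (B : ScaledBGStructure n M A) (χ : 𝓓(cube n 2, ℝ)) (α : A) :
    ∃ g : 𝓢(Euc n, ℂ), ∀ u φ, B.localize χ α u (mulSchwartz g φ) = B.localize χ α u φ := by
  obtain ⟨θ, hθ, hθ1⟩ := exists_isTest_eq_one isOpen_univ χ.hasCompactSupport (subset_univ _)
  refine ⟨compLinear (scaleMap (B.ρ α) (B.ρ_pos α)).symm hθ.toSchwartz, fun u φ => ?_⟩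
  rw [localize_apply, localize_apply, cut_apply]
  congr 1
  refine cutExtend_congr _ _ fun x hx => ?_
  simp [hθ1 x (subset_tsupport _ hx)]

variable [IsManifold (𝓡 n) ∞ M]

theorem tendsto_word_coord (l : List B.coefficientVF) {u : ℕ → Dist n M} {u' : Dist n M}
    (h : ∀ (e : Chart n M) (ψ : 𝓓(e.range, ℝ)), Tendsto (fun j => (u j).1 e ψ) atTop (𝓝 (u'.1 e ψ))) :
    ∀ (e : Chart n M) (ψ : 𝓓(e.range, ℝ)),
      Tendsto (fun j => (B.word l (u j)).1 e ψ) atTop (𝓝 ((B.word l u').1 e ψ)) := by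
  induction l with
  | nil => exact h
  | cons W l ih =>
    intro e ψ
    simp only [word_cons, vfAct_coord]
    exact (ih e _).neg

omit [IsManifold (𝓡 n) ∞ M] in
theorem tendsto_localize {u : ℕ → Dist n M} {u' : Dist n M}
    (h : ∀ (e : Chart n M) (ψ : 𝓓(e.range, ℝ)), Tendsto (fun j => (u j).1 e ψ) atTop (𝓝 (u'.1 e ψ)))
    (α : A) (φ : 𝓢(Euc n, ℂ)) :
    Tendsto (fun j => B.localize χ α (u j) φ) atTop (𝓝 (B.localize χ α u' φ)) := by
  simp only [localize_apply, cut_apply, cutExtend_apply]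
  exact ((h _ _).add ((h _ _).const_mul _)).const_mul _

/-- Local boundedness in a better space implies the existence of a subsequence which converges
locally. -/
theorem exists_subseq_tendsto_local (hχ : ∀ x : Euc n, (∀ i, |x i| ≤ 1) → χ x = 1)
    {ι : Type*} [Countable ι] (L : ι → List B.coefficientVF) {i₀ : ι} (hi₀ : L i₀ = [])
    {u : ℕ → Dist n M} {m : ℝ} (hm : s' < m)
    (hc : ∀ i, B.CutBdd χ (fun j => B.word (L i) (u j)) m) :
    ∃ (u' : Dist n M) (φ : ℕ → ℕ), StrictMono φ ∧ ∀ i α,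
      TemperedDistribution.MemSobolev s' 2 (B.localize χ α (B.word (L i) u')) ∧
      Tendsto (fun j => sobolevNorm s' (B.localize χ α (B.word (L i) (u (φ j)) - B.word (L i) u')))
        atTop (𝓝 0) ∧
      Tendsto (fun j => sobolevNorm s' (B.localize χ α (B.word (L i) (u (φ j))))) atTop
        (𝓝 (sobolevNorm s' (B.localize χ α (B.word (L i) u')))) := by
  have : Countable A := B.countable
  choose g hg using B.exists_localize_mulSchwartz χ
  choose C hC0 hC using fun i => (hc i).exists_sobolevNorm_le
  have hf : ∀ i j α, ∃ f : Lp ℂ 2 (volume : Measure (Euc n)),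
      TemperedDistribution.besselPotential (Euc n) ℂ s' (B.localize χ α (B.word (L i) (u j))) = f :=
    fun i j α => (MemSobolev.of_le hm.le (hC i α j).1).1
  choose f hf using hf
  set S : ι × A → Set (Lp ℂ 2 (volume : Measure (Euc n))) := fun x => closure
    {f | ∃ T : 𝓢'(Euc n, ℂ), (∀ φ, T (mulSchwartz (g x.2) φ) = T φ) ∧
      TemperedDistribution.MemSobolev m 2 T ∧ sobolevNorm m T ≤ C x.1 x.2 ∧
      TemperedDistribution.besselPotential (Euc n) ℂ s' T = f} with hS
  -- Compactness of a countable product of metric compacta replaces a diagonal argument: one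
  -- subsequence works for all words and all cells.
  have hScomp : IsCompact (univ.pi S) := isCompact_univ_pi fun x => isCompact_closure_bessel hm _ _
  obtain ⟨a, -, φ, hφ, ha⟩ := hScomp.tendsto_subseq (x := fun j (x : ι × A) => f x.1 j x.2)
    fun j x _ => subset_closure ⟨_, hg x.2 _, (hC x.1 x.2 j).1, (hC x.1 x.2 j).2, hf x.1 j x.2⟩
  rw [tendsto_pi_nhds] at ha
  have ha' : ∀ i α, Tendsto (fun j => f i (φ j) α) atTop (𝓝 (a (i, α))) := fun i α => ha (i, α)
  have hloc : ∀ i j α ψ, B.localize χ α (B.word (L i) (u j)) ψ =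
      (f i j α : 𝓢'(Euc n, ℂ)) (besselSchwartz (-s') ψ) := fun i j α ψ => by
    rw [← hf, besselPotential_apply_apply, besselSchwartz_besselSchwartz]
    simp
  have hbs' : ∀ i, B.CutBdd χ (fun j => B.word (L i) (u (φ j))) s' := fun i α => by
    obtain ⟨D, hD0, hD⟩ := (hc i).mono hm.le α
    exact ⟨D, hD0, fun j => hD (φ j)⟩
  -- The limit is built from the empty word `L i₀` alone. The order `-s'` is rounded up because an
  -- integer is required.
  obtain ⟨u', hu'⟩ := B.exists_dist_limit hχ (u := fun j => u (φ j)) ⌈-s'⌉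
    (fun α => by
      obtain ⟨D, hD0, hD⟩ := hbs' i₀ α
      refine ⟨D, fun j ψ => ?_⟩
      have h1 := hD j ψ
      simp only [hi₀, word_nil] at h1
      exact h1.trans (mul_le_mul_of_nonneg_left (hNorm_mono (Int.le_ceil _) ψ) hD0))
    (fun α ψ => by
      refine ⟨_, (((tendsto_toTemperedDistribution_apply (ha' i₀ α) (besselSchwartz (-s')
        (compLinear (scaleMap (B.ρ α) (B.ρ_pos α)).symm ψ))).const_mul
        ((∏ i, B.ρ α i : ℝ) : ℂ)).congr fun j => ?_)⟩
      rw [← hloc, hi₀, word_nil, ← cut_eq_localize])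
  -- Vector fields act continuously for pointwise convergence, so the limits belonging to the other
  -- words are those words applied to the same `u'`.
  have hbess : ∀ i α, TemperedDistribution.besselPotential (Euc n) ℂ s'
      (B.localize χ α (B.word (L i) u')) = a (i, α) := fun i α => by
    have h1 := tendsto_word_coord (u := fun j => u (φ j)) (L i) hu'
    exact besselPotential_eq_of_tendsto (T := fun j => B.localize χ α (B.word (L i) (u (φ j))))
      (f := fun j => f i (φ j) α) (fun ψ => tendsto_localize h1 α ψ) (fun j => hf i (φ j) α) (ha' i α)
  have hdiff : ∀ i j α, TemperedDistribution.besselPotential (Euc n) ℂ s'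
      (B.localize χ α (B.word (L i) (u (φ j)) - B.word (L i) u')) =
        (f i (φ j) α - a (i, α) : Lp ℂ 2 (volume : Measure (Euc n))) := fun i j α => by
    rw [map_sub, map_sub, hf, hbess, ← Lp.toTemperedDistributionCLM_apply,
      ← Lp.toTemperedDistributionCLM_apply, ← Lp.toTemperedDistributionCLM_apply, map_sub]
  refine ⟨u', φ, hφ, fun i α => ⟨⟨_, hbess i α⟩, ?_, ?_⟩⟩
  · simp only [sobolevNorm_eq (hdiff i _ α)]
    exact tendsto_iff_norm_sub_tendsto_zero.1 (ha' i α)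
  · simp only [sobolevNorm_eq (hf i _ α), sobolevNorm_eq (hbess i α)]
    exact (ha' i α).norm

omit [IsManifold (𝓡 n) ∞ M] in
/-- Local convergence and boundedness in `v H^s` imply convergence in `v' H^s`. -/
theorem tendsto_sobolevSeminorm (hr : Tendsto (fun α => v.val α / v'.val α) cofinite (𝓝 0))
    {x : ℕ → Dist n M} {x' : Dist n M} (hx : ∀ j, x j ∈ B.sobolevSpace χ v s)
    (hsum : ∀ j, ∑' α, B.localNorm χ v s (x j) α ^ 2 ≤ 1)
    (hx' : ∀ α, TemperedDistribution.MemSobolev s 2 (B.localize χ α x'))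
    (hd : ∀ α, Tendsto (fun j => sobolevNorm s (B.localize χ α (x j - x'))) atTop (𝓝 0))
    (hl : ∀ α, Tendsto (fun j => sobolevNorm s (B.localize χ α (x j))) atTop
      (𝓝 (sobolevNorm s (B.localize χ α x')))) :
    ∃ h : ∀ j, x j - x' ∈ B.sobolevSpace χ v' s, x' ∈ B.sobolevSpace χ v' s ∧
      Tendsto (fun j => B.sobolevSeminorm χ v' s ⟨_, h j⟩) atTop (𝓝 0) := by
  -- As in Fatou's lemma, finite partial sums pass to the limit; this bounds the limit in the space
  -- with weight `v`.
  have hfin : ∀ t : Finset A, ∑ α ∈ t, B.localNorm χ v s x' α ^ 2 ≤ 1 := fun t =>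
    le_of_tendsto (tendsto_finsetSum t fun α _ => ((hl α).const_mul (v.val α)⁻¹).pow 2)
      (.of_forall fun j => ((hx j).2.sum_le_tsum t fun _ _ => sq_nonneg _).trans (hsum j))
  have hu : x' ∈ B.sobolevSpace χ v s := ⟨hx', summable_of_sum_le (fun _ => sq_nonneg _) hfin⟩
  have hsum' : ∑' α, B.localNorm χ v s x' α ^ 2 ≤ 1 := hu.2.tsum_le_of_sum_le hfin
  have hsub : ∀ j, x j - x' ∈ B.sobolevSpace χ v s := fun j => sub_mem (hx j) hu
  refine ⟨fun j => sobolevSpace_le_of_ratio hr (hsub j), sobolevSpace_le_of_ratio hr hu, ?_⟩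
  have hr2 : Tendsto (fun α => (v.val α / v'.val α) ^ 2) cofinite (𝓝 0) := by simpa using hr.pow 2
  have hbd : ∀ j, ∑' α, B.localNorm χ v s (x j - x') α ^ 2 ≤ 2 ^ 2 := fun j => by
    have h2 := map_sub_le_add (B.sobolevSeminorm χ v s) ⟨_, hx j⟩ ⟨_, hu⟩
    have h3 : B.sobolevSeminorm χ v s ⟨_, hx j⟩ ≤ 1 := by
      rw [sobolevSeminorm_eq, Real.sqrt_le_one]; exact hsum j
    have h4 : B.sobolevSeminorm χ v s ⟨_, hu⟩ ≤ 1 := by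
      rw [sobolevSeminorm_eq, Real.sqrt_le_one]; exact hsum'
    exact tsum_localNorm_sq_le (u := ⟨_, hsub j⟩) (by norm_num) (h2.trans (by linarith))
  -- The squared norm for `v'` is the one for `v` with the factor `(v α / v' α) ^ 2` inserted in the
  -- sum.
  have h5 := tendsto_tsum_mul_of_cofinite hr2 (fun α => sq_nonneg _)
    (e := fun j α => B.localNorm χ v s (x j - x') α ^ 2) (fun j α => sq_nonneg _)
    (fun j => (hsub j).2) hbd fun α => by
      simpa [localNorm] using ((hd α).const_mul (v.val α)⁻¹).pow 2
  have h6 := (Real.continuous_sqrt.tendsto 0).comp h5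
  rw [Real.sqrt_zero] at h6
  refine h6.congr fun j => ?_
  rw [sobolevSeminorm_eq, Function.comp_apply]
  congr 1
  exact tsum_congr fun α => by rw [localNorm_eq_ratio_mul (v := v) (v' := v'), mul_pow]

/-- Boundedness in `v H^s` and local boundedness in a better space imply the existence of a limit,
in the norms of `v' H^{s'}`, of a subsequence. -/
theorem exists_subseq_tendsto (hχ : ∀ x : Euc n, (∀ i, |x i| ≤ 1) → χ x = 1)
    (hr : Tendsto (fun α => v.val α / v'.val α) cofinite (𝓝 0)) (hs : s' ≤ s)
    {ι : Type*} [Countable ι] (L : ι → List B.coefficientVF) {i₀ : ι} (hi₀ : L i₀ = [])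
    {u : ℕ → Dist n M} (hu : ∀ i j, B.word (L i) (u j) ∈ B.sobolevSpace χ v s)
    (hu1 : ∀ i j, B.sobolevSeminorm χ v s ⟨_, hu i j⟩ ≤ 1) {m : ℝ} (hm : s' < m)
    (hc : ∀ i, B.CutBdd χ (fun j => B.word (L i) (u j)) m) :
    ∃ (u' : Dist n M) (φ : ℕ → ℕ), StrictMono φ ∧ ∀ i,
      ∃ h : ∀ j, B.word (L i) (u (φ j)) - B.word (L i) u' ∈ B.sobolevSpace χ v' s',
        B.word (L i) u' ∈ B.sobolevSpace χ v' s' ∧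
        Tendsto (fun j => B.sobolevSeminorm χ v' s' ⟨_, h j⟩) atTop (𝓝 0) := by
  obtain ⟨u', φ, hφ, h⟩ := exists_subseq_tendsto_local hχ L hi₀ hm hc
  refine ⟨u', φ, hφ, fun i => tendsto_sobolevSeminorm hr (fun j => sobolevSpace_mono hs (hu i (φ j)))
    (fun j => ?_) (fun α => (h i α).1) (fun α => (h i α).2.1) fun α => (h i α).2.2⟩
  refine ((sobolevSpace_mono hs (hu i (φ j))).2.tsum_le_tsum (fun α =>
    pow_le_pow_left₀ (localNorm_nonneg _ _ _ _ _) (localNorm_mono hs ((hu i (φ j)).1 α)) 2)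
    (hu i (φ j)).2).trans ?_
  simpa using tsum_localNorm_sq_le zero_le_one (hu1 i (φ j))

end ScaledBGStructure
end
end ScaledBG

/-! ### The two compactness statements -/

namespace ScaledBG
noncomputable section
open Filter
open scoped FourierTransform
open FourierTransform

namespace ScaledBGStructure
variable {n : ℕ} {M : Type*} [TopologicalSpace M] [ChartedSpace (Euc n) M] {A : Type*}
variable {B : ScaledBGStructure n M A} {χ : 𝓓(cube n 2, ℝ)} {v v' : B.WeightFamily} {s s' : ℝ}
variable [IsManifold (𝓡 n) ∞ M]

theorem isCompactInclusion_sobolevSpace (hχ : ∀ x : Euc n, (∀ i, |x i| ≤ 1) → χ x = 1)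
    (hr : Tendsto (fun α => v.val α / v'.val α) cofinite (𝓝 0)) (hs : s' < s) :
    IsCompactInclusion (B.sobolevSeminorm χ v s) (B.sobolevSeminorm χ v' s') := by
  refine isCompactInclusion_of_subseq ((sobolevSpace_mono hs.le).trans (sobolevSpace_le_of_ratio hr))
    fun x hx => ?_
  obtain ⟨u', φ, hφ, h⟩ := exists_subseq_tendsto (u := fun j => (x j).1) hχ hr hs.le
    (fun _ : Unit => []) (i₀ := ()) rfl (fun _ j => (x j).2) (fun _ j => hx j) hs
    fun _ => CutBdd.of_sobolevSeminorm (fun j => (x j).2) hx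
  obtain ⟨h1, h2, h3⟩ := h ()
  exact ⟨⟨u', h2⟩, φ, hφ, h3⟩

theorem mixedSeminorm_eq (F : Finset B.coefficientVF) (k : ℕ) (u : B.mixedSpace χ v s k) :
    B.mixedSeminorm F χ v s k u = √(∑ x : (j : Fin (k + 1)) × (Fin j → F),
      B.sobolevSeminorm χ v s (B.wordMap χ v s k (List.ofFn fun i => (x.2 i).1)
        (by simpa using Nat.lt_succ_iff.1 x.1.2) u) ^ 2) := rfl

theorem exists_ofFn_eq {F : Finset B.coefficientVF} {k : ℕ} {l : List B.coefficientVF}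
    (hF : ∀ W ∈ l, W ∈ F) (hl : l.length ≤ k) :
    ∃ x : (j : Fin (k + 1)) × (Fin j → F), List.ofFn (fun i => (x.2 i).1) = l :=
  ⟨⟨⟨l.length, by omega⟩, fun i => ⟨l.get i, hF _ (l.get_mem i)⟩⟩, List.ofFn_get l⟩

theorem sobolevSeminorm_word_le {F : Finset B.coefficientVF} {k : ℕ} (u : B.mixedSpace χ v s k)
    {l : List B.coefficientVF} (hF : ∀ W ∈ l, W ∈ F) (hl : l.length ≤ k) :
    B.sobolevSeminorm χ v s ⟨B.word l u.1, u.2 l hl⟩ ≤ B.mixedSeminorm F χ v s k u := by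
  obtain ⟨x, rfl⟩ := exists_ofFn_eq hF hl
  rw [mixedSeminorm_eq]
  refine Real.le_sqrt_of_sq_le ?_
  exact Finset.single_le_sum (f := fun x : (j : Fin (k + 1)) × (Fin j → F) =>
    B.sobolevSeminorm χ v s (B.wordMap χ v s k (List.ofFn fun i => (x.2 i).1)
      (by simpa using Nat.lt_succ_iff.1 x.1.2) u) ^ 2) (fun _ _ => sq_nonneg _) (Finset.mem_univ x)

variable [T2Space M]

theorem isCompactInclusion_mixedSpace (hχ : ∀ x : Euc n, (∀ i, |x i| ≤ 1) → χ x = 1)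
    (hr : Tendsto (fun α => v.val α / v'.val α) cofinite (𝓝 0)) {F : Finset B.coefficientVF}
    (hF : B.IsSpanning F) {k k' : ℕ} (hs : s' ≤ s) (hk : k' ≤ k) (h : s' < s ∨ k' < k) :
    IsCompactInclusion (B.mixedSeminorm F χ v s k) (B.mixedSeminorm F χ v' s' k') := by
  have hle : B.mixedSpace χ v s k ≤ B.mixedSpace χ v' s' k' := fun u hu l hl =>
    sobolevSpace_le_of_ratio hr (sobolevSpace_mono hs (hu l (hl.trans hk)))
  refine isCompactInclusion_of_subseq hle fun x hx => ?_
  let J := (j : Fin (k' + 1)) × (Fin j → F)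
  let L : J → List B.coefficientVF := fun y => List.ofFn fun i => (y.2 i).1
  have hLF : ∀ y, ∀ W ∈ L y, W ∈ F := fun y W hW => by
    obtain ⟨i, rfl⟩ := List.mem_ofFn.1 hW
    exact (y.2 i).2
  have hLl : ∀ y, (L y).length ≤ k' := fun y => by
    simpa [L] using Nat.lt_succ_iff.1 y.1.2
  have hbdd : ∀ l : List B.coefficientVF, (∀ W ∈ l, W ∈ F) → l.length ≤ k →
      B.CutBdd χ (fun j => B.word l (x j).1) s := fun l hlF hl =>
    CutBdd.of_sobolevSeminorm (fun j => (x j).2 l hl)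
      fun j => (sobolevSeminorm_word_le (x j) hlF hl).trans (hx j)
  -- Rellich's theorem needs local bounds in an order above `s'` for all words of length at most
  -- `k'`. If `s' < s`, take `m = s`. If `k' < k`, one more field may act on each such word, and
  -- `CutBdd.gain` reaches the integer `⌊s⌋ + 1`, which exceeds `s` and is at most `s + 1`.
  obtain ⟨m, hm, hc⟩ : ∃ m, s' < m ∧ ∀ y, B.CutBdd χ (fun j => B.word (L y) (x j).1) m := by
    rcases h with h | h
    · exact ⟨s, h, fun y => hbdd _ (hLF y) ((hLl y).trans hk)⟩
    · refine ⟨(⌊s⌋ + 1 : ℤ), hs.trans_lt (by push_cast; exact Int.lt_floor_add_one s), fun y => ?_⟩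
      refine (hbdd _ (hLF y) ((hLl y).trans hk)).gain hχ (fun Z hZ =>
        CutBdd.vfAct_of_spanning hF (fun W hW => ?_) hZ) (by
          push_cast; linarith [Int.floor_le s])
      simp only [← word_cons]
      refine hbdd _ (fun W' hW' => ?_) (by have := hLl y; simp only [List.length_cons]; omega)
      rcases List.mem_cons.1 hW' with rfl | h'
      · exact hW
      · exact hLF y _ h'
  obtain ⟨y₀, hy₀⟩ := exists_ofFn_eq (F := F) (k := k') (l := []) (by simp) (by simp)
  obtain ⟨u', φ, hφ, hu'⟩ := exists_subseq_tendsto (u := fun j => (x j).1) hχ hr hs L (i₀ := y₀) hy₀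
    (fun y j => (x j).2 _ ((hLl y).trans hk))
    (fun y j => (sobolevSeminorm_word_le (x j) (hLF y) ((hLl y).trans hk)).trans (hx j)) hm hc
  -- The subsequence was chosen using words with letters in `F` only; spanning extends the
  -- regularity of the limit to all words in `𝒲`.
  have hmem : u' ∈ B.mixedSpace χ v' s' k' := B.mem_mixedSpace_of_spanning hF k' fun l hlF hl => by
    obtain ⟨y, rfl⟩ := exists_ofFn_eq hlF hl
    exact (hu' y).2.1
  refine ⟨⟨u', hmem⟩, φ, hφ, ?_⟩
  have h1 : ∀ y, Tendsto (fun j => B.sobolevSeminorm χ v' s' (B.wordMap χ v' s' k' (L y) (hLl y)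
      (Submodule.inclusion hle (x (φ j)) - ⟨u', hmem⟩)) ^ 2) atTop (𝓝 0) := fun y => by
    obtain ⟨h2, -, h3⟩ := hu' y
    have h4 := h3.pow 2
    rw [zero_pow two_ne_zero] at h4
    refine h4.congr fun j => ?_
    congr 2
    exact Subtype.ext (map_sub (B.word (L y)) _ _).symm
  have h5 := (Real.continuous_sqrt.tendsto 0).comp
    (by simpa using tendsto_finsetSum Finset.univ fun y (_ : y ∈ (Finset.univ : Finset J)) => h1 y :
      Tendsto (fun j => ∑ y : J, B.sobolevSeminorm χ v' s' (B.wordMap χ v' s' k' (L y) (hLl y)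
        (Submodule.inclusion hle (x (φ j)) - ⟨u', hmem⟩)) ^ 2) atTop (𝓝 0))
  rw [Real.sqrt_zero] at h5
  exact h5

end ScaledBGStructure
end
end ScaledBG

theorem mainTheorem5 {n : ℕ} {M : Type*} [TopologicalSpace M] [T2Space M]
    [ChartedSpace (Euc n) M] [IsManifold (𝓡 n) ∞ M] {A : Type*} (B : ScaledBGStructure n M A)
    (χ : 𝓓(cube n 2, ℝ)) (hχ : ∀ x : Euc n, (∀ i, |x i| ≤ 1) → χ x = 1)
    (w w' : M → ℝ) (hw : B.IsWeight w) (hw' : B.IsWeight w')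
    (hlim : Tendsto (fun p => w p / w' p) (cocompact M) (𝓝 0))
    (v v' : B.WeightFamily) (hv : v.Equivalent w) (hv' : v'.Equivalent w') :
    (∀ s s' : ℝ, s' < s →
      IsCompactInclusion (B.sobolevSeminorm χ v s) (B.sobolevSeminorm χ v' s')) ∧
    ∀ F : Finset B.coefficientVF, B.IsSpanning F →
      ∀ (s s' : ℝ) (k k' : ℕ), s' ≤ s → k' ≤ k → (s' < s ∨ k' < k) →
        IsCompactInclusion (B.mixedSeminorm F χ v s k) (B.mixedSeminorm F χ v' s' k') := by
  have hr := B.tendsto_weight_ratio hw hw' hlim hv hv'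
  exact ⟨fun _ _ hs => ScaledBGStructure.isCompactInclusion_sobolevSpace hχ hr hs,
    fun _ hF _ _ _ _ hs hk h => ScaledBGStructure.isCompactInclusion_mixedSpace hχ hr hF hs hk h⟩
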